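/- Formulas of the infinitary language $\mathcal L^{\in}_{\infty,\infty}$ of set theory are built from $\bot$, $x_i\in x_j$, $x_i=x_j$ (one variable for each ordinal) by $\to$, by $\bigvee_{\alpha<\beta}$ and $\bigwedge_{\alpha<\beta}$ for ordinals $\beta$, and by quantifiers $\exists\mathbf x$, $\forall\mathbf x$ over contexts, i.e. sequences $\mathbf x$ of pairwise distinct variables of any ordinal length $\ell(\mathbf x)$. For $y$ not in $\mathbf x$, the bounded quantifiers are $\forall\mathbf x\in y\,\varphi:=\forall\mathbf x(\mathbf x\in y\to\varphi)$ and $\exists\mathbf x\in y\,\varphi:=\exists\mathbf x(\mathbf x\in y\wedge\varphi)$. Here, if $\ell(\mathbf x)$ is finite, $\mathbf x\in y$ says that every $x_j\in y$; if $\ell(\mathbf x)=\mu$ is infinite, $\mathbf x\in y$ is the formula saying that there are $f,d$ and $\mathbf z=\langle z_j\mid j<\mu\rangle$ such that $f$ is a function whose domain is the ordinal $d$, $z_{j'}\in z_j$ for $j'<j<\mu$, $z_j\in d$ and $f(z_j)=x_j$ for all $j<\mu$, $\forall x(x\in d\to\bigvee_{j<\mu}z_j=x)$, and $f\in y$. A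 $\Delta^\infty_0$-formula is one all of whose quantifiers are bounded; a $\Sigma^\infty_1$-formula is one of the form $\exists\mathbf x\,\psi$ with $\psi$ a $\Delta_0^\infty$-formula and $\mathbf x$ a context of any ordinal length. A \emph{code} of a set $x$ is a pair $a=\langle\rho,C\rangle$ of an ordinal and a set of ordinals such that, for some set $X$, ordinal $\alpha$ and bijection $d_a:\alpha\to\mathrm{tc}(\{X\})$, one has $\rho<\alpha$, $d_a(\rho)=x$, and $C$ is the set of all $\mathfrak g(\beta,\gamma)$ with $\beta,\gamma<\alpha$ and $d_a(\beta)\in d_a(\gamma)$, where $\mathfrak g$ is Gödel's pairing function. A \emph{potential realiser} is a pair $r=\langle c,P\rangle$ of a program $c\in\mathbb N$ of an Ordinal Turing Machine (OTM) and a set $P$ of ordinals used as parameter; ordinals, sets of ordinals, and pairs and sequences of these are presented to and returned by OTMs through a fixed coding as binary sequences of ordinal length. The relation $r\Vdash\varphi$, for formulas $\varphi$ with sets as constants and no free variables, is defined by recursion: \begin{itemize} \item $r\Vdash\bot$ never holds; \item $r\Vdash X=Y$ iff for all codes $a=\langle\rho_a,C_a\rangle$ of $X$ and $b=\langle\rho_b,C_b\rangle$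 of $Y$ the map $f:\xi\mapsto r(a,b,\xi)$ is an isomorphism of codes, i.e. a bijection from $\{\xi\mid d_a(\xi)\in\mathrm{tc}(\{X\})\}$ to $\{\xi\mid d_b(\xi)\in\mathrm{tc}(\{Y\})\}$ with $f(\rho_a)=\rho_b$ and $d_a(\xi)=d_b(f(\xi))$ for all $\xi$; \item $r\Vdash X\in Y$ iff for all codes $a$ of $X$ and $b$ of $Y$, $r(a,b)=\langle\alpha,s\rangle$ with $d_b(\alpha)\in Y$ and $s\Vdash X=d_b(\alpha)$; \item $r\Vdash\varphi\to\psi$ iff $r(s)\Vdash\psi$ for every $s\Vdash\varphi$; \item $r\Vdash\bigvee_{\alpha<\beta}\varphi_\alpha$ iff $r(0)=\langle\gamma,s\rangle$ with $\gamma<\beta$ and $s\Vdash\varphi_\gamma$; \item $r\Vdash\bigwedge_{\alpha<\beta}\varphi_\alpha$ iff $r(\alpha)\Vdash\varphi_\alpha$ for all $\alpha<\beta$; \item $r\Vdash\exists\mathbf x\,\varphi$ iff $r(0)=\langle a,s\rangle$ with $a$ a code of a sequence $\bar X$ of length $\ell(\mathbf x)$ and $s\Vdash\varphi[\bar X/\mathbf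 x]$; \item $r\Vdash\forall\mathbf x\,\varphi$ iff $r(a)\Vdash\varphi[\bar X/\mathbf x]$ for every code $a$ of every sequence $\bar X$ of length $\ell(\mathbf x)$. \end{itemize} \emph{Uniform} realisability is the relation given by the same recursion with realisers restricted throughout to those that code single-valued functions, i.e. whose output depends only on the sets that the inputs encode and not on the codes chosen for them: a uniform realiser $r$ of $\forall\mathbf x\,\varphi$ also satisfies $r(a)=r(a')$ whenever $a,a'$ are codes of the same sequence of length $\ell(\mathbf x)$, and for a uniform realiser of $X\in Y$ the set $d_b(\alpha)$ and the realiser $s$ in $r(a,b)=\langle\alpha,s\rangle$ do not depend on the codes $a$ of $X$ and $b$ of $Y$. \textbf{Lemma.} Let $\varphi(\mathbf x)$ be a $\Sigma^\infty_1$-formula whose free variables all appear in the context $\mathbf x$, and let $\bar X$ be a sequence of sets of length $\ell(\mathbf x)$. Then $\varphi[\bar X/\mathbf x]$ has a uniform realiser if and only if $\varphi[\bar X/\mathbf x]$ is true (in the universe of sets). -/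

import Mathlib

universe u

namespace OTMRealisability

open Order Filter

noncomputable section

/-! ### The infinitary language of set theory -/

/-- Variables `x_i` are indexed by the ordinals; the universe of sets is `ZFSet.{u}`, whose
ordinals are `Ordinal.{u}`. -/
abbrev Var : Type (u + 1) := Ordinal.{u}

/-- A context: a sequence of (pairwise distinct) variables of ordinal length. -/
structure Context : Type (u + 1) where
  length : Ordinal.{u}
  var : Set.Iio length → Var.{u}
  inj : Function.Injective var

/-- The context `⟨x⟩` of length one. -/
def Context.single (x : Var.{u}) : Context.{u} where
  length := 1
  var := fun _ => x
  inj := fun a b _ => by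
    have ha : a.1 < 1 := a.2
    have hb : b.1 < 1 := b.2
    rw [Order.lt_one_iff] at ha hb
    exact Subtype.ext (ha.trans hb.symm)

/-- Formulas of the language `L_{∞,∞}` of set theory. -/
inductive Formula : Type (u + 1) where
  | bot : Formula
  | mem (x y : Var.{u}) : Formula
  | eq (x y : Var.{u}) : Formula
  | imp (φ ψ : Formula) : Formula
  | disj (β : Ordinal.{u}) (φ : Set.Iio β → Formula) : Formula
  | conj (β : Ordinal.{u}) (φ : Set.Iio β → Formula) : Formula
  | ex (x : Context.{u}) (φ : Formula) : Formula
  | all (x : Context.{u}) (φ : Formula) : Formula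

namespace Formula

/-- The free variables of a formula. -/
def freeVars : Formula.{u} → Set Var.{u}
  | bot => ∅
  | mem x y => {x, y}
  | eq x y => {x, y}
  | imp φ ψ => freeVars φ ∪ freeVars ψ
  | disj _ φ => ⋃ α, freeVars (φ α)
  | conj _ φ => ⋃ α, freeVars (φ α)
  | ex x φ => freeVars φ \ Set.range x.var
  | all x φ => freeVars φ \ Set.range x.var

/-- `x` is a context of `φ`: all free variables of `φ` appear in `x`. -/
def HasContext (φ : Formula.{u}) (x : Context.{u}) : Prop :=
  φ.freeVars ⊆ Set.range x.var

/-- Binary conjunction, as a conjunction of length two. -/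
def and (φ ψ : Formula.{u}) : Formula.{u} :=
  conj 2 fun i => open Classical in if i.1 = 0 then φ else ψ

/-- Binary disjunction, as a disjunction of length two. -/
def or (φ ψ : Formula.{u}) : Formula.{u} :=
  disj 2 fun i => open Classical in if i.1 = 0 then φ else ψ

/-- `∃ x ∈ y, φ` for a single variable `x`. -/
def exIn (x y : Var.{u}) (φ : Formula.{u}) : Formula.{u} :=
  ex (.single x) (and (mem x y) φ)

/-- `∀ x ∈ y, φ` for a single variable `x`. -/
def allIn (x y : Var.{u}) (φ : Formula.{u}) : Formula.{u} :=
  all (.single x) (imp (mem x y) φ)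

/-! In the following formulas the last arguments (named in the parentheses) are the bound
variables. -/

/-- `p = (a, b) = {{a}, {a, b}}` (bound: `s t w`). -/
def isPair (p a b s t w : Var.{u}) : Formula.{u} :=
  exIn s p <| exIn t p <|
    and (and (mem a s) (allIn w s (eq w a))) <|
    and (and (mem a t) (and (mem b t) (allIn w t (or (eq w a) (eq w b))))) <|
    allIn w p (or (eq w s) (eq w t))

/-- `p` is an ordered pair with first component `a` (bound: `e b s t w`). -/
def hasFirst (p a e b s t w : Var.{u}) : Formula.{u} :=
  exIn e p <| exIn b e <| isPair p a b s t w

/-- `d` is an ordinal, i.e. a transitive set of transitive sets (bound: `k l w`). -/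
def isOrdinal (d k l w : Var.{u}) : Formula.{u} :=
  allIn k d <| allIn l k <| and (mem l d) (allIn w l (mem w k))

/-- `f` is a function with domain `d` (bound: `p q a e b s t w`). -/
def isFunction (f d p q a e b s t w : Var.{u}) : Formula.{u} :=
  and (allIn p f (exIn a d (hasFirst p a e b s t w))) <|
  and (allIn a d (exIn p f (hasFirst p a e b s t w))) <|
  allIn a d <| allIn p f <| allIn q f <|
    imp (and (hasFirst p a e b s t w) (hasFirst q a e b s t w)) (eq p q)

/-- `f(z) = x` (bound: `p s t w`). -/
def appEq (f z x p s t w : Var.{u}) : Formula.{u} :=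
  exIn p f <| isPair p z x s t w

/-- An ordinal above the indices of `y` and of all the variables in the context `x`. -/
def freshBase (x : Context.{u}) (y : Var.{u}) : Ordinal.{u} :=
  max (⨆ j, succ (x.var j)) (succ y)

/-- The context `⟨x_{b + j} | j < μ⟩`. -/
def freshContext (b μ : Ordinal.{u}) : Context.{u} where
  length := μ
  var := fun j => b + j.1
  inj := fun _ _ h => Subtype.ext (add_left_cancel h)

/-- The formula abbreviated by `𝐱 ∈ y`, for a context `𝐱` of length `μ`:
there are `f`, `d` and `𝐳` of length `μ` such that `f` is a function whose domain is the ordinal `d`,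
`z_{j'} ∈ z_j` for `j' < j < μ`, `z_j ∈ d` and `f(z_j) = x_j` for `j < μ`, every element of
`d` is some `z_j`, and `f ∈ y`. All bound variables are fresh. -/
def memSeq (x : Context.{u}) (y : Var.{u}) : Formula.{u} :=
  let B := freshBase x y
  let f := B
  let d := B + 1
  let c : ℕ → Var.{u} := fun n => B + 2 + n
  let b := B + Ordinal.omega0
  let z : Ordinal.{u} → Var.{u} := fun j => b + j
  ex (.single f) <| ex (.single d) <| ex (freshContext b x.length) <|
    and (and (isOrdinal d (c 0) (c 1) (c 2))
        (isFunction f d (c 0) (c 1) (c 2) (c 3) (c 4) (c 5) (c 6) (c 7))) <|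
    and (and
        (conj x.length fun j =>
          and (conj j.1 fun i => mem (z i) (z j)) <|
          and (mem (z j) d) (appEq f (z j) (x.var j) (c 0) (c 1) (c 2) (c 3)))
        (allIn (c 0) d (disj x.length fun j => eq (z j) (c 0)))) <|
    mem f y

/-- `IsBound x y β`: the formula `β` is the bounding condition of the quantifiers `∀ 𝐱 ∈ y` and
`∃ 𝐱 ∈ y`. For infinite contexts it is the formula `𝐱 ∈ y` above; finite contexts are
bounded as usual, `x_j ∈ y` for every `j`. -/
inductive IsBound (x : Context.{u}) (y : Var.{u}) : Formula.{u} → Prop where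
  | single (w : Var.{u}) (h : x = .single w) : IsBound x y (mem w y)
  | finite (h : x.length < Ordinal.omega0) : IsBound x y (conj x.length fun j => mem (x.var j) y)
  | infinite (h : Ordinal.omega0 ≤ x.length) : IsBound x y (memSeq x y)

/-- `Δ^∞_0`-formulas: all quantifiers are bounded. -/
inductive IsDeltaZero : Formula.{u} → Prop where
  | bot : IsDeltaZero bot
  | mem (x y : Var.{u}) : IsDeltaZero (mem x y)
  | eq (x y : Var.{u}) : IsDeltaZero (eq x y)
  | imp {φ ψ : Formula.{u}} : IsDeltaZero φ → IsDeltaZero ψ → IsDeltaZero (imp φ ψ)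
  | disj {β : Ordinal.{u}} {φ : Set.Iio β → Formula.{u}} :
      (∀ α, IsDeltaZero (φ α)) → IsDeltaZero (disj β φ)
  | conj {β : Ordinal.{u}} {φ : Set.Iio β → Formula.{u}} :
      (∀ α, IsDeltaZero (φ α)) → IsDeltaZero (conj β φ)
  | exBdd {x : Context.{u}} {y : Var.{u}} {β φ : Formula.{u}} : y ∉ Set.range x.var →
      IsBound x y β → IsDeltaZero φ → IsDeltaZero (ex x (and β φ))
  | allBdd {x : Context.{u}} {y : Var.{u}} {β φ : Formula.{u}} : y ∉ Set.range x.var →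
      IsBound x y β → IsDeltaZero φ → IsDeltaZero (all x (imp β φ))

/-- `Σ^∞_1`-formulas: `∃ 𝐱 ψ` with `ψ` a `Δ^∞_0`-formula and `𝐱` a context of any length. -/
def IsSigmaOne (φ : Formula.{u}) : Prop :=
  ∃ (x : Context.{u}) (ψ : Formula.{u}), ψ.IsDeltaZero ∧ φ = ex x ψ

end Formula

/-- Assignments of sets to variables. The pair of a formula `φ` and an assignment `v` stands for
the formula obtained from `φ` by replacing every free variable `x` by the constant symbol for
the set `v x`. -/
abbrev Assignment : Type (u + 1) := Var.{u} → ZFSet.{u}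

/-- Reassign the sets `X_j` to the variables `x_j` of a context. -/
def Assignment.update (v : Assignment.{u}) (x : Context.{u})
    (X : Set.Iio x.length → ZFSet.{u}) : Assignment.{u} :=
  Function.extend x.var X v

/-- Substitution `[X̄/𝐱]`. (Variables outside `𝐱` get a default value; they do not matter for
formulas in context `𝐱`.) -/
def substitution (x : Context.{u}) (X : Set.Iio x.length → ZFSet.{u}) : Assignment.{u} :=
  Assignment.update (fun _ => ∅) x X

/-- Truth in the universe of sets. -/
def Formula.IsTrue : Formula.{u} → Assignment.{u} → Prop
  | .bot, _ => False
  | .mem x y, v => v x ∈ v y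
  | .eq x y, v => v x = v y
  | .imp φ ψ, v => φ.IsTrue v → ψ.IsTrue v
  | .disj _ φ, v => ∃ α, (φ α).IsTrue v
  | .conj _ φ, v => ∀ α, (φ α).IsTrue v
  | .ex x φ, v => ∃ X, φ.IsTrue (v.update x X)
  | .all x φ, v => ∀ X, φ.IsTrue (v.update x X)

/-! ### Ordinal Turing machines -/

/-- The three head movements. -/
inductive Move where
  | stay | left | right

instance : Encodable Move :=
  Encodable.ofLeftInverse
    (fun m : Move => match m with | .stay => (0 : Fin 3) | .left => 1 | .right => 2)
    (fun i => if i = 0 then Move.stay else if i = 1 then .left else .right)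
    (fun m => by cases m <;> rfl)

/-- A Turing machine program with `scratch` many scratch tapes and working states `0, …, halt - 1`;
the state `halt` is the halting state. Tape `0` is the parameter tape, tapes `1`, `2`, `3` are
the further input tapes, tape `4` is the output tape, all other tapes are scratch tapes. In a
working state, the machine reads all its tapes, and the transition table says what the new state
is, what is written on each tape, and how each head moves. -/
structure Program where
  scratch : ℕ
  halt : ℕ
  table : Fin halt → (Fin (scratch + 5) → Bool) →
    Fin (halt + 1) × (Fin (scratch + 5) → Bool × Move)

/-- The coding of programs as natural numbers. -/
instance : Encodable Program :=
  Encodable.ofLeftInverse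
    (α := Σ k n : ℕ, Fin n → (Fin (k + 5) → Bool) → Fin (n + 1) × (Fin (k + 5) → Bool × Move))
    (fun p => ⟨p.scratch, p.halt, p.table⟩) (fun q => ⟨q.1, q.2.1, q.2.2⟩) (fun _ => rfl)

/-- The content of a tape, with a cell for every ordinal. -/
abbrev Tape : Type (u + 1) := Ordinal.{u} → Bool

/-- A configuration of a machine with `n` tapes. -/
structure Config (n : ℕ) : Type (u + 1) where
  state : ℕ
  head : Fin n → Ordinal.{u}
  tape : Fin n → Tape.{u}

/-- Head movement; a head on a limit cell or on cell `0` that moves left goes to cell `0`. -/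
def Move.apply (m : Move) (h : Ordinal.{u}) : Ordinal.{u} :=
  match m with
  | .stay => h
  | .right => h + 1
  | .left => open Classical in if IsSuccPrelimit h then 0 else Ordinal.pred h

namespace Program

variable (p : Program)

/-- One step of the machine. Nothing changes once the halting state is reached. -/
def step (C : Config.{u} (p.scratch + 5)) : Config.{u} (p.scratch + 5) :=
  if hs : C.state < p.halt then
    let r := p.table ⟨C.state, hs⟩ fun i => C.tape i (C.head i)
    { state := r.1
      head := fun i => (r.2 i).2.apply (C.head i)
      tape := fun i => Function.update (C.tape i) (C.head i) (r.2 i).1 }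
  else C

/-- The configuration at time `t`: at limit times, the state, the head positions and the contents
of all the cells are the inferior limits of their values at the previous times. -/
def run (C : Config.{u} (p.scratch + 5)) (t : Ordinal.{u}) : Config.{u} (p.scratch + 5) :=
  Ordinal.limitRecOn t C (fun _ D => p.step D) fun t _ D =>
    { state := liminf (fun s : Set.Iio t => (D s.1 s.2).state) atTop
      head := fun i => liminf (fun s : Set.Iio t => (D s.1 s.2).head i) atTop
      tape := fun i ξ => liminf (fun s : Set.Iio t => (D s.1 s.2).tape i ξ) atTop }

/-- The initial configuration with given parameter tape and input tapes; all other tapes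
are blank. -/
def init (P : Tape.{u}) (inp : Fin 3 → Tape.{u}) : Config.{u} (p.scratch + 5) where
  state := 0
  head := fun _ => 0
  tape := fun i =>
    if i.1 = 0 then P else if h : i.1 - 1 < 3 then inp ⟨i.1 - 1, h⟩ else fun _ => false

/-- The machine halts with `out` on its output tape. -/
def Outputs (P : Tape.{u}) (inp : Fin 3 → Tape.{u}) (out : Tape.{u}) : Prop :=
  ∃ t : Ordinal.{u}, (p.run (p.init P inp) t).state = p.halt ∧
    (p.run (p.init P inp) t).tape ⟨4, by omega⟩ = out

end Program

/-! ### Low-level coding -/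

/-- Sets of ordinals (the bounded classes of ordinals). -/
abbrev OrdSet : Type (u + 1) := {X : Set Ordinal.{u} // BddAbove X}

/-- Pairs of an ordinal and a set of ordinals. -/
abbrev OrdPair : Type (u + 1) := Ordinal.{u} × OrdSet.{u}

/-- The tape that contains `1` exactly in the cells with positions in `S`. -/
def Tape.ofSet (S : Set Ordinal.{u}) : Tape.{u} :=
  fun ξ => open Classical in decide (ξ ∈ S)

/-- The least strict upper bound of a set of ordinals. -/
def OrdSet.bound (X : OrdSet.{u}) : Ordinal.{u} := sSup (succ '' X.1)

/-- The positions of the ones in the binary sequence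
`0 i_0 0 i_1 ⋯ 0 i_γ 0 ⋯ 0 1 1 0 0 ⋯ 0 1` that encodes `⟨α, X⟩`: the block of the bits `i_γ` (`i_γ = 1`
iff `γ ∈ X`) has length `2 * bound X` and is followed by `011`, then by `α` zeros,
then by a final `1`. -/
def OrdPair.ones (a : OrdPair.{u}) : Set Ordinal.{u} :=
  {ξ | ∃ γ ∈ a.2.1, ξ = 2 * γ + 1} ∪
    {2 * a.2.bound + 1, 2 * a.2.bound + 2, 2 * a.2.bound + 3 + a.1}

/-- The length of that sequence. -/
def OrdPair.len (a : OrdPair.{u}) : Ordinal.{u} := 2 * a.2.bound + 3 + a.1 + 1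

/-- The low-level code of a pair. -/
def OrdPair.tape (a : OrdPair.{u}) : Tape.{u} := Tape.ofSet a.ones

/-- The low-level code of a sequence `⟨a, b⟩` of two pairs: the concatenation of the codes of the
entries, followed by `1111`. -/
def OrdPair.tape₂ (a b : OrdPair.{u}) : Tape.{u} :=
  Tape.ofSet (a.ones ∪ (fun ξ => a.len + ξ) '' b.ones ∪
    {a.len + b.len, a.len + b.len + 1, a.len + b.len + 2, a.len + b.len + 3})

/-- A set of ordinals `X`, as the pair `⟨0, X⟩`. -/
def OrdSet.toPair (X : OrdSet.{u}) : OrdPair.{u} := (0, X)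

/-- An ordinal `α`, as the set of the ordinals below `α`. -/
def ordPair (α : Ordinal.{u}) : OrdPair.{u} := OrdSet.toPair ⟨Set.Iio α, bddAbove_Iio⟩

/-- A blank tape. -/
def blank : Tape.{u} := fun _ => false

/-! ### Potential realisers -/

/-- Potential realisers: an OTM-program (a natural number) and a set of ordinals. -/
structure Realiser : Type (u + 1) where
  program : ℕ
  param : OrdSet.{u}

/-- A potential realiser as a pair of an ordinal and a set of ordinals. -/
def Realiser.toPair (r : Realiser.{u}) : OrdPair.{u} := ((r.program : Ordinal.{u}), r.param)

/-- `r` halts on the given inputs, with `out` on the output tape. -/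
def Realiser.Computes (r : Realiser.{u}) (inp : Fin 3 → Tape.{u}) (out : Tape.{u}) : Prop :=
  ∃ p : Program, Encodable.decode r.program = some p ∧ p.Outputs r.param.toPair.tape inp out

/-- Computations with one input, `r(a) = out`. -/
def Realiser.Computes₁ (r : Realiser.{u}) (a : OrdPair.{u}) (out : Tape.{u}) : Prop :=
  r.Computes ![a.tape, blank, blank] out

/-- Computations with two inputs, `r(a, b) = out`. -/
def Realiser.Computes₂ (r : Realiser.{u}) (a b : OrdPair.{u}) (out : Tape.{u}) : Prop :=
  r.Computes ![a.tape, b.tape, blank] out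

/-- Computations with three inputs, `r(a, b, c) = out`. -/
def Realiser.Computes₃ (r : Realiser.{u}) (a b c : OrdPair.{u}) (out : Tape.{u}) : Prop :=
  r.Computes ![a.tape, b.tape, c.tape] out

/-! ### High-level coding -/

/-- The well-ordering of pairs of ordinals that underlies Gödel's pairing function: compare
maxima first, then the first components, then the second components. -/
def godelKey (p : Ordinal.{u} × Ordinal.{u}) : Ordinal.{u} ×ₗ Ordinal.{u} ×ₗ Ordinal.{u} :=
  toLex (max p.1 p.2, toLex (p.1, p.2))

/-- Gödel's pairing function: the position of a pair in that well-ordering. -/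
def godelPair (p : Ordinal.{u} × Ordinal.{u}) : Ordinal.{u} :=
  ⨆ q : {q : Ordinal.{u} × Ordinal.{u} // godelKey q < godelKey p}, succ (godelPair q.1)
termination_by godelKey p
decreasing_by exact q.2

/-- `y ∈ tc({x})`. -/
def InTC (y x : ZFSet.{u}) : Prop := Relation.ReflTransGen (· ∈ ·) y x

/-- `C` is a pre-code for `X`, witnessed by the bijection `d : α → tc({X})`. -/
structure IsPreCode (C : OrdSet.{u}) (X : ZFSet.{u}) (α : Ordinal.{u})
    (d : Set.Iio α → ZFSet.{u}) : Prop where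
  injective : Function.Injective d
  range_eq : Set.range d = {y | InTC y X}
  mem_iff : ∀ β γ : Ordinal.{u}, godelPair (β, γ) ∈ C.1 ↔
    ∃ (hβ : β < α) (hγ : γ < α), d ⟨β, hβ⟩ ∈ d ⟨γ, hγ⟩

/-- `a = ⟨ρ, C⟩` is a code of `x`, i.e. `C` is a pre-code and `d_C(ρ) = x`. For a code `b` and an
ordinal `α`, accordingly, `IsCode (α, b.2) y` says that `d_b(α) = y`. -/
def IsCode (a : OrdPair.{u}) (x : ZFSet.{u}) : Prop :=
  ∃ (X : ZFSet.{u}) (α : Ordinal.{u}) (d : Set.Iio α → ZFSet.{u}), IsPreCode a.2 X α d ∧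
    ∃ h : a.1 < α, d ⟨a.1, h⟩ = x

/-- The essential domain of a code. -/
def essdom (a : OrdPair.{u}) : Set Ordinal.{u} :=
  {ξ | ∃ x y, IsCode a x ∧ IsCode (ξ, a.2) y ∧ InTC y x}

/-- Isomorphisms of codes. -/
structure IsCodeIso (a b : OrdPair.{u}) (f : Ordinal.{u} → Ordinal.{u}) : Prop where
  bijOn : Set.BijOn f (essdom a) (essdom b)
  map_rep : f a.1 = b.1
  decode_eq : ∀ ξ ∈ essdom a, ∃ y, IsCode (ξ, a.2) y ∧ IsCode (f ξ, b.2) y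

/-- The set `{(i, X_i) | i < α}`, i.e. the function with domain the von Neumann ordinal `α` that the
sequence `⟨X_i | i < α⟩` is. -/
def seqSet {α : Ordinal.{u}} (X : Set.Iio α → ZFSet.{u}) : ZFSet.{u} :=
  ZFSet.range fun i : Set.Iio α => ZFSet.pair i.1.toZFSet (X i)

/-! ### Realisability -/

/-- `r ⊩ X = Y`: for all codes `a` of `X` and `b` of `Y`, the function `ξ ↦ r(a, b, ξ)` on the
essential domain of `a` is a code-isomorphism from `a` to `b`. (As an element `ξ` of the
essential domain of a code represents a set, such an `r` is always single-valued.) -/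
def RealisesEq (r : Realiser.{u}) (X Y : ZFSet.{u}) : Prop :=
  ∀ a b, IsCode a X → IsCode b Y → ∃ f, IsCodeIso a b f ∧
    ∀ ξ ∈ essdom a, r.Computes₃ a b (ordPair ξ) (ordPair (f ξ)).tape

/-- `r ⊩ X ∈ Y`: for all codes `a` of `X` and `b` of `Y`, `r(a, b) = ⟨α, s⟩` with `d_b(α) ∈ Y` and
`s ⊩ X = d_b(α)`. -/
def RealisesMem (r : Realiser.{u}) (X Y : ZFSet.{u}) : Prop :=
  ∀ a b, IsCode a X → IsCode b Y → ∃ (α : Ordinal.{u}) (s : Realiser.{u}) (Z : ZFSet.{u}),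
    r.Computes₂ a b (OrdPair.tape₂ (ordPair α) s.toPair) ∧
    IsCode (α, b.2) Z ∧ Z ∈ Y ∧ RealisesEq s X Z

/-- Single-valuedness of a realiser of `X ∈ Y`: the set `d_b(α)` and the realiser `s` that
`r(a, b) = ⟨α, s⟩` stands for do not depend on the choice of the codes `a`, `b` of `X`, `Y`. -/
def SingleValuedMem (r : Realiser.{u}) (X Y : ZFSet.{u}) : Prop :=
  ∀ a a' b b', IsCode a X → IsCode a' X → IsCode b Y → IsCode b' Y →
    ∀ (α α' : Ordinal.{u}) (s s' : Realiser.{u}),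
      r.Computes₂ a b (OrdPair.tape₂ (ordPair α) s.toPair) →
      r.Computes₂ a' b' (OrdPair.tape₂ (ordPair α') s'.toPair) →
      (∃ Z, IsCode (α, b.2) Z ∧ IsCode (α', b'.2) Z) ∧ s = s'

/-- Single-valuedness of a realiser of `∀ 𝐱 φ` with `𝐱` of length `α`: the realiser `r(a)` does
not depend on the choice of the code `a` of a sequence of length `α`. -/
def SingleValuedAll (r : Realiser.{u}) (α : Ordinal.{u}) : Prop :=
  ∀ (X : Set.Iio α → ZFSet.{u}) (a a' : OrdPair.{u}),
    IsCode a (seqSet X) → IsCode a' (seqSet X) →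
    ∀ s s' : Realiser.{u}, r.Computes₁ a s.toPair.tape → r.Computes₁ a' s'.toPair.tape → s = s'

/-- The realisability relation, for the formula `φ` with constants for sets given by `v`.

`Realises False φ v r` is OTM-realisability. `Realises True φ v r` is uniform OTM-realisability:
throughout the recursion, realisers are restricted to those that code a single-valued function,
i.e. what they return depends only on the sets encoded by the inputs and not on their codes.
This is a restriction for the inputs that are codes of sets, that is for `∈` and `∀` (for `=` see
`RealisesEq`); ordinals and realisers, the inputs in the other clauses, have a unique code. -/
def Realises (uniform : Prop) : Formula.{u} → Assignment.{u} → Realiser.{u} → Prop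
  | .bot, _, _ => False
  | .eq x y, v, r => RealisesEq r (v x) (v y)
  | .mem x y, v, r => RealisesMem r (v x) (v y) ∧ (uniform → SingleValuedMem r (v x) (v y))
  | .imp φ ψ, v, r => ∀ s, Realises uniform φ v s →
      ∃ t, r.Computes₁ s.toPair t.toPair.tape ∧ Realises uniform ψ v t
  | .disj β φ, v, r => ∃ (γ : Set.Iio β) (s : Realiser.{u}),
      r.Computes₁ (ordPair 0) (OrdPair.tape₂ (ordPair γ.1) s.toPair) ∧
      Realises uniform (φ γ) v s
  | .conj β φ, v, r => ∀ γ : Set.Iio β, ∃ s,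
      r.Computes₁ (ordPair γ.1) s.toPair.tape ∧ Realises uniform (φ γ) v s
  | .ex x φ, v, r => ∃ (X : Set.Iio x.length → ZFSet.{u}) (a : OrdPair.{u}) (s : Realiser.{u}),
      r.Computes₁ (ordPair 0) (OrdPair.tape₂ a s.toPair) ∧ IsCode a (seqSet X) ∧
      Realises uniform φ (v.update x X) s
  | .all x φ, v, r =>
      (∀ (X : Set.Iio x.length → ZFSet.{u}) (a : OrdPair.{u}), IsCode a (seqSet X) →
        ∃ s, r.Computes₁ a s.toPair.tape ∧ Realises uniform φ (v.update x X) s) ∧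
      (uniform → SingleValuedAll r x.length)

/-- A formula (with constants) is uniformly realised if it has a uniform realiser. -/
def UniformlyRealised (φ : Formula.{u}) (v : Assignment.{u}) : Prop :=
  ∃ r, Realises True φ v r

end

end OTMRealisability

/-! By induction on the formula, every $\Delta_0^\infty$-formula is uniformly realised under an
assignment if and only if it is true under it (`RealisedIffTrue`, for all assignments at once). The
leading existential quantifier is one more closure step. That realised formulas are true follows
clause by clause; for an implication the converse for the antecedent is used as well.

For the other direction, the parameter of a realiser may be an arbitrary set of ordinals, so
everything the realiser has to return can be chosen beforehand and stored there. A true implication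
gets a constant realiser if its antecedent is true; otherwise the antecedent has no realiser at all,
and anything works. Disjunctions and existential quantifiers get constant realisers
(`exists_constantRealiser`), conjunctions a table indexed by ordinals (`exists_table`). For a
bounded universal quantifier the bound confines the relevant sequences to sets of rank below some
`o`. Hence a set-sized table of realisers suffices, with a default entry for all other sequences,
where the bounding condition fails and the implication is vacuous. The entry depends only on the
sequence and not on its code, so the realiser is single-valued.

What remains is machine work: a machine that is given a code of a set must find out which set it is
(`exists_setTable`), where a set sits in the code of another (`exists_locate`), and which ordinals
of two codes denote the same set (`exists_translate`). For all three the parameter holds a script: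
an enumeration `c` of the sets of rank below `o` in which elements precede the sets that contain
them, given by its membership matrix, with a block of data for every entry. The machine goes through
the script and determines, for every `i`, which ordinals of the input codes denote `c i`. By
`codeRow_eq` this is a recursion: an ordinal of the code denotes `c i` if all elements of `c i` have
been found in the code and its predecessors in the code are exactly the ordinals found for them. At
the wanted entry the machine stops and copies the data block. To compare predecessors, it visits all
pairs of ordinals in Gödel's order. `godelPair_of_lt` and `godelPair_of_le` show that the head on
the set of Gödel pairs then only moves right while two other heads run over the components.

Programs are written in a small structured language (`Cmd`) and compiled to transition tables. The
central rule is `Exec.loop`: a transfinite loop is correct if each round leads from one store to the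
next, the stores at limit stages are the inferior limits of the earlier ones, and no round dips
below the store it starts from. The last condition ensures that what happens inside the rounds does
not disturb the inferior limits; it is why `Exec` carries a lower bound for all intermediate stores.
-/

namespace OTMRealisability

open Order Filter

noncomputable section

/-! ### Transfinite sums and limits -/

/-- The sum of the ordinals `d j` over all `j < i`. -/
def ordSum (d : Ordinal.{u} → Ordinal.{u}) (i : Ordinal.{u}) : Ordinal.{u} :=
  ⨆ j : Set.Iio i, (ordSum d j.1 + d j.1)
termination_by i
decreasing_by exact j.2

theorem ordSum_add_le {d : Ordinal.{u} → Ordinal.{u}} {i j : Ordinal.{u}} (h : j < i) :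
    ordSum d j + d j ≤ ordSum d i := by
  rw [ordSum.eq_1 d i]
  exact Ordinal.le_iSup (fun j : Set.Iio i => ordSum d j.1 + d j.1) ⟨j, h⟩

theorem ordSum_le {d : Ordinal.{u} → Ordinal.{u}} {i a : Ordinal.{u}}
    (h : ∀ j < i, ordSum d j + d j ≤ a) : ordSum d i ≤ a := by
  rw [ordSum.eq_1 d i]
  exact Ordinal.iSup_le fun j => h j.1 j.2

theorem ordSum_mono (d : Ordinal.{u} → Ordinal.{u}) : Monotone (ordSum d) := by
  intro i j h
  exact ordSum_le fun k hk => ordSum_add_le (hk.trans_le h)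

theorem ordSum_zero (d : Ordinal.{u} → Ordinal.{u}) : ordSum d 0 = 0 :=
  le_antisymm (ordSum_le fun _ hj => absurd hj not_lt_zero) zero_le

theorem ordSum_add_one (d : Ordinal.{u} → Ordinal.{u}) (i : Ordinal.{u}) :
    ordSum d (i + 1) = ordSum d i + d i := by
  refine le_antisymm (ordSum_le fun j hj => ?_) (ordSum_add_le (lt_add_one i))
  rcases (Order.lt_add_one_iff.1 hj).eq_or_lt with rfl | h
  · exact le_rfl
  · exact (ordSum_add_le h).trans le_self_add

/-- The least `j` whose block ends after `s` also starts before it. With block lengths as running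
times, this tells which loop round is active at time `s`. -/
theorem exists_of_lt_ordSum {d : Ordinal.{u} → Ordinal.{u}} {i s : Ordinal.{u}}
    (h : s < ordSum d i) : ∃ j < i, ordSum d j ≤ s ∧ s < ordSum d j + d j := by
  have ex : ∃ j, j < i ∧ s < ordSum d j + d j := by
    by_contra! hc
    exact absurd h (not_lt.2 (ordSum_le hc))
  obtain ⟨j, ⟨hj, hs⟩, hmin⟩ := WellFounded.has_min (wellFounded_lt (α := Ordinal.{u}))
    {j | j < i ∧ s < ordSum d j + d j} ex
  refine ⟨j, hj, ordSum_le fun k hk => ?_, hs⟩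
  by_contra! hc
  exact hmin k ⟨hk.trans hj, hc⟩ hk

theorem ordSum_strictMono {d : Ordinal.{u} → Ordinal.{u}} (hd : ∀ i, 0 < d i) :
    StrictMono (ordSum d) := by
  intro i j h
  exact (lt_add_of_pos_right _ (hd i)).trans_le (ordSum_add_le h)

theorem ordSum_isNormal {d : Ordinal.{u} → Ordinal.{u}} (hd : ∀ i, 0 < d i) :
    IsNormal (ordSum d) := by
  refine isNormal_iff.2 ⟨ordSum_strictMono hd, fun o ho a h => ordSum_le fun j hj => ?_⟩
  rw [← ordSum_add_one]
  exact h _ (ho.add_one_lt hj)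

/-- In a well-order the inferior limit is the value that is attained from above cofinally often and
whose predecessors are eventually exceeded. This form covers states, heads and cells alike. -/
theorem liminf_Iio_eq {α : Type*} [ConditionallyCompleteLinearOrder α] [WellFoundedLT α]
    {t : Ordinal.{u}} (ht : IsSuccLimit t) (f : Set.Iio t → α) (v : α) (b : α) (hb : ∀ a : α, b ≤ a)
    (low : ∀ a < v, ∃ s₀ : Set.Iio t, ∀ s, s₀ ≤ s → a < f s)
    (up : ∀ s₀ : Set.Iio t, ∃ s, s₀ ≤ s ∧ f s ≤ v) : liminf f atTop = v := by
  have : Nonempty (Set.Iio t) := ⟨⟨0, ht.bot_lt⟩⟩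
  have ub : ∀ a, (∀ᶠ s in atTop, a ≤ f s) → a ≤ v := by
    intro a ha
    obtain ⟨s₀, h⟩ := eventually_atTop.1 ha
    obtain ⟨s, hs, hv⟩ := up s₀
    exact (h s hs).trans hv
  rw [liminf_eq]
  apply le_antisymm
  · exact csSup_le ⟨b, Eventually.of_forall fun s => hb _⟩ ub
  · by_contra! hlt
    -- `w` plays the role of the successor of the supremum: values that eventually exceed the
    -- supremum are eventually at least `w`, so `w` would be at most the supremum.
    obtain ⟨w, hw, hmin⟩ := WellFounded.has_min (wellFounded_lt (α := α))
      {w | sSup {a | ∀ᶠ s in atTop, a ≤ f s} < w} ⟨v, hlt⟩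
    have : w ≤ sSup {a | ∀ᶠ s in atTop, a ≤ f s} := by
      refine le_csSup ⟨v, ub⟩ ?_
      obtain ⟨s₀, h⟩ := low _ hlt
      exact eventually_atTop.2 ⟨s₀, fun s hs => not_lt.1 fun hc => hmin _ (h s hs) hc⟩
    exact absurd hw (not_lt.2 this)

/-- `v` is the inferior limit of `k j` for `j → o`. -/
def HeadLim (k : Ordinal.{u} → Ordinal.{u}) (o v : Ordinal.{u}) : Prop :=
  (∀ a < v, ∃ i < o, ∀ j, i ≤ j → j < o → a < k j) ∧ ∀ i < o, ∃ j, i ≤ j ∧ j < o ∧ k j ≤ v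

/-- `v` is the inferior limit of `k j` for `j → o`. -/
def TapeLim (k : Ordinal.{u} → Set Ordinal.{u}) (o : Ordinal.{u}) (v : Set Ordinal.{u}) : Prop :=
  ∀ ξ, (ξ ∈ v → ∃ i < o, ∀ j, i ≤ j → j < o → ξ ∈ k j) ∧
    (ξ ∉ v → ∀ i < o, ∃ j, i ≤ j ∧ j < o ∧ ξ ∉ k j)

theorem HeadLim.const {o : Ordinal.{u}} (ho : IsSuccLimit o) (v : Ordinal.{u}) :
    HeadLim (fun _ => v) o v :=
  ⟨fun _ h => ⟨0, ho.bot_lt, fun _ _ _ => h⟩, fun i h => ⟨i, le_rfl, h, le_rfl⟩⟩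

theorem HeadLim.of_isNormal {f : Ordinal.{u} → Ordinal.{u}} (hf : IsNormal f) {o : Ordinal.{u}}
    (ho : IsSuccLimit o) : HeadLim f o (f o) := by
  refine ⟨fun a h => ?_, fun i h => ⟨i, le_rfl, h, (hf.strictMono h).le⟩⟩
  obtain ⟨i, hi, h⟩ := (hf.lt_iff_exists_lt ho).1 h
  exact ⟨i, hi, fun j hj _ => h.trans_le (hf.monotone hj)⟩

theorem TapeLim.of_eventually {k : Ordinal.{u} → Set Ordinal.{u}} {o : Ordinal.{u}}
    {v : Set Ordinal.{u}}
    (h : ∀ ξ, ∃ i < o, ∀ j, i ≤ j → j < o → (ξ ∈ k j ↔ ξ ∈ v)) : TapeLim k o v := by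
  intro ξ
  obtain ⟨i, hi, h⟩ := h ξ
  refine ⟨fun hv => ⟨i, hi, fun j hj hjo => (h j hj hjo).2 hv⟩, fun hv i' hi' => ?_⟩
  exact ⟨max i i', le_max_right _ _, max_lt hi hi', fun hc =>
    hv ((h _ (le_max_left _ _) (max_lt hi hi')).1 hc)⟩

theorem TapeLim.const {o : Ordinal.{u}} (ho : IsSuccLimit o) (v : Set Ordinal.{u}) :
    TapeLim (fun _ => v) o v :=
  .of_eventually fun _ => ⟨0, ho.bot_lt, fun _ _ _ => Iff.rfl⟩

theorem TapeLim.of_mono {k : Ordinal.{u} → Set Ordinal.{u}} {o : Ordinal.{u}}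
    {v : Set Ordinal.{u}} (ho : IsSuccLimit o) (h₁ : ∀ j < o, k j ⊆ v)
    (h₂ : ∀ ξ ∈ v, ∃ i < o, ∀ j, i ≤ j → j < o → ξ ∈ k j) : TapeLim k o v := by
  refine .of_eventually fun ξ => ?_
  by_cases hξ : ξ ∈ v
  · obtain ⟨i, hi, h⟩ := h₂ ξ hξ
    exact ⟨i, hi, fun j hj hjo => iff_of_true (h j hj hjo) hξ⟩
  · exact ⟨0, ho.bot_lt, fun j _ hjo => iff_of_false (fun hc => hξ (h₁ j hjo hc)) hξ⟩

/-! ### Runs -/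

/-- The times `s + y` with `y < t` form a final segment of the times below `s + t`, and inferior
limits depend only on final segments. Hence a run can be restarted at time `s`. -/
theorem atTop_Iio_add (s : Ordinal.{u}) {t : Ordinal.{u}} (ht : IsSuccLimit t) :
    map (fun y : Set.Iio t => (⟨s + y.1, add_lt_add_right y.2 s⟩ : Set.Iio (s + t))) atTop =
      atTop := by
  have n1 : Nonempty (Set.Iio t) := ⟨⟨0, ht.bot_lt⟩⟩
  have n2 : Nonempty (Set.Iio (s + t)) := ⟨⟨s + 0, add_lt_add_right ht.bot_lt s⟩⟩
  ext A
  rw [mem_map, mem_atTop_sets, mem_atTop_sets]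
  constructor
  · rintro ⟨⟨a, ha⟩, h⟩
    refine ⟨⟨s + a, add_lt_add_right ha s⟩, fun ⟨b, hb⟩ hab => ?_⟩
    have hsb : s ≤ b := le_self_add.trans hab
    have e : s + (b - s) = b := Ordinal.add_sub_cancel_of_le hsb
    have := h ⟨b - s, by rw [Set.mem_Iio, ← add_lt_add_iff_left s, e]; exact hb⟩
      (by change a ≤ b - s; rw [← add_le_add_iff_left s, e]; exact hab)
    simpa [e] using this
  · rintro ⟨⟨a, ha⟩, h⟩
    have e : a - s < t := by
      rcases le_total s a with h | h
      · rwa [← add_lt_add_iff_left s, Ordinal.add_sub_cancel_of_le h]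
      · rw [Ordinal.sub_eq_zero_iff_le.2 h]
        exact ht.bot_lt
    refine ⟨⟨a - s, e⟩, fun b hab => h _ ?_⟩
    exact (Ordinal.le_add_sub a s).trans (add_le_add_right (show a - s ≤ b.1 from hab) s)

namespace Program

variable (p : Program) (C : Config.{u} (p.scratch + 5))

theorem run_zero : p.run C 0 = C := Ordinal.limitRecOn_zero ..

theorem run_add_one (t : Ordinal.{u}) : p.run C (t + 1) = p.step (p.run C t) :=
  Ordinal.limitRecOn_add_one ..

theorem run_limit {t : Ordinal.{u}} (ht : IsSuccLimit t) : p.run C t =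
    { state := liminf (fun s : Set.Iio t => (p.run C s.1).state) atTop
      head := fun i => liminf (fun s : Set.Iio t => (p.run C s.1).head i) atTop
      tape := fun i ξ => liminf (fun s : Set.Iio t => (p.run C s.1).tape i ξ) atTop } :=
  Ordinal.limitRecOn_limit _ _ _ _ ht

theorem run_add (s t : Ordinal.{u}) : p.run C (s + t) = p.run (p.run C s) t := by
  induction t using Ordinal.limitRecOn with
  | zero => rw [add_zero, run_zero]
  | add_one t ih => rw [← add_assoc, run_add_one, run_add_one, ih]
  | limit t ht ih =>
    rw [run_limit _ _ ht, run_limit _ _ (Ordinal.isSuccLimit_add s ht)]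
    congr 1
    · rw [← atTop_Iio_add s ht]
      exact congrArg (fun f => liminf f atTop) (funext fun y => by simp [ih y.1 y.2])
    · funext i
      rw [← atTop_Iio_add s ht]
      exact congrArg (fun f => liminf f atTop) (funext fun y => by simp [ih y.1 y.2])
    · funext i ξ
      rw [← atTop_Iio_add s ht]
      exact congrArg (fun f => liminf f atTop) (funext fun y => by simp [ih y.1 y.2])

theorem run_of_halted (h : C.state = p.halt) (t : Ordinal.{u}) : p.run C t = C := by
  induction t using Ordinal.limitRecOn with
  | zero => exact run_zero ..
  | add_one t ih => rw [run_add_one, ih, step, dif_neg (by omega)]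
  | limit t ht ih =>
    have : Nonempty (Set.Iio t) := ⟨⟨0, ht.bot_lt⟩⟩
    have : NeBot (atTop : Filter (Set.Iio t)) := atTop_neBot
    rw [run_limit _ _ ht]
    have e : ∀ s : Set.Iio t, p.run C s.1 = C := fun s => ih s.1 s.2
    simp only [e, liminf_const]

variable {p}

/-- A halted configuration persists, so two halting times show the same tape. The single-valuedness
clauses speak of every output of a realiser; this identifies each of them with the computed one. -/
theorem Outputs.unique {P : Tape.{u}} {inp : Fin 3 → Tape.{u}} {out out' : Tape.{u}}
    (h : p.Outputs P inp out) (h' : p.Outputs P inp out') : out = out' := by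
  obtain ⟨t, ht, rfl⟩ := h
  obtain ⟨t', ht', rfl⟩ := h'
  rcases le_total t t' with hle | hle
  · rw [← Ordinal.add_sub_cancel_of_le hle, run_add, run_of_halted _ _ ht]
  · rw [← Ordinal.add_sub_cancel_of_le hle, run_add, run_of_halted _ _ ht']

end Program

theorem Realiser.Computes.unique {r : Realiser.{u}} {inp : Fin 3 → Tape.{u}} {out out' : Tape.{u}}
    (h : r.Computes inp out) (h' : r.Computes inp out') : out = out' := by
  obtain ⟨p, hp, h⟩ := h
  obtain ⟨p', hp', h'⟩ := h'
  obtain rfl : p = p' := Option.some_injective _ (hp.symm.trans hp')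
  exact h.unique h'

/-! ### Structured programs -/

/-- The heads (one for every group `g : G` of tapes) and the ones on the tapes `t : T`. -/
@[ext] structure Store (T G : Type) : Type (u + 1) where
  hd : G → Ordinal.{u}
  tp : T → Set Ordinal.{u}

namespace Store

variable {T G : Type} (grp : T → G)

/-- Everything in `σ` is below its counterpart in `ρ`. -/
def Below (σ ρ : Store.{u} T G) : Prop :=
  (∀ g, σ.hd g ≤ ρ.hd g) ∧ ∀ t, σ.tp t ⊆ ρ.tp t

theorem Below.refl (σ : Store.{u} T G) : σ.Below σ := ⟨fun _ => le_rfl, fun _ => subset_rfl⟩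

theorem Below.trans {σ ρ τ : Store.{u} T G} (h : σ.Below ρ) (h' : ρ.Below τ) : σ.Below τ :=
  ⟨fun g => (h.1 g).trans (h'.1 g), fun t => (h.2 t).trans (h'.2 t)⟩

/-- The store with all heads on cell `0` and blank tapes. -/
def bot : Store.{u} T G := ⟨fun _ => 0, fun _ => ∅⟩

theorem bot_below (σ : Store.{u} T G) : bot.Below σ :=
  ⟨fun _ => zero_le, fun _ => Set.empty_subset _⟩

/-- What the heads read. -/
def rd (σ : Store.{u} T G) (t : T) : Prop := σ.hd (grp t) ∈ σ.tp t

/-- Write `w` and move the heads by `m`. -/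
def act (σ : Store.{u} T G) (w : T → Prop) (m : G → Move) : Store.{u} T G where
  hd g := (m g).apply (σ.hd g)
  tp t := {ξ | (ξ = σ.hd (grp t) ∧ w t) ∨ (ξ ≠ σ.hd (grp t) ∧ ξ ∈ σ.tp t)}

theorem act_stay (σ : Store.{u} T G) : σ.act grp (σ.rd grp) (fun _ => .stay) = σ := by
  ext t ξ
  · rfl
  · by_cases h : ξ = σ.hd (grp t)
    · subst h; simp [act, rd]
    · simp [act, h]

end Store

/-- Structured programs: simultaneous writing and head movements, composition, branching
and transfinite loops. -/
inductive Cmd (T G : Type) where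
  | act (f : (T → Prop) → T → Prop) (m : (T → Prop) → G → Move) : Cmd T G
  | seq (c₁ c₂ : Cmd T G) : Cmd T G
  | ite (b : (T → Prop) → Prop) (c₁ c₂ : Cmd T G) : Cmd T G
  | loop (b : (T → Prop) → Prop) (c : Cmd T G) : Cmd T G

namespace Cmd

variable {T G : Type}

/-- The number of states. -/
def size : Cmd T G → ℕ
  | act _ _ => 1
  | seq c₁ c₂ => c₁.size + c₂.size
  | ite _ c₁ c₂ => 1 + c₁.size + c₂.size
  | loop _ c => 1 + c.size

theorem size_pos : ∀ c : Cmd T G, 0 < c.size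
  | act _ _ => Nat.one_pos
  | seq c₁ _ => Nat.add_pos_left c₁.size_pos _
  | ite _ _ _ => by rw [size]; omega
  | loop _ _ => by rw [size]; omega

open Classical in
/-- The instruction for the state `s`, for the command placed at the states `base, base + 1, …`
and followed by the state `exit`. -/
def instr : Cmd T G → (base exit s : ℕ) → (T → Prop) → ℕ × (T → Prop) × (G → Move)
  | act f m, _, exit, _, r => (exit, f r, m r)
  | seq c₁ c₂, base, exit, s, r =>
    if s < base + c₁.size then c₁.instr base (base + c₁.size) s r
    else c₂.instr (base + c₁.size) exit s r
  | ite b c₁ c₂, base, exit, s, r =>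
    if s = base then (if b r then base + 1 else base + 1 + c₁.size, r, fun _ => .stay)
    else if s < base + 1 + c₁.size then c₁.instr (base + 1) exit s r
    else c₂.instr (base + 1 + c₁.size) exit s r
  | loop b c, base, exit, s, r =>
    if s = base then (if b r then base + 1 else exit, r, fun _ => .stay)
    else c.instr (base + 1) base s r

/-- Jumps stay inside the program or go to its exit, so the truncation by `min` in `Cmd.toProgram`
changes nothing. -/
theorem instr_fst_le (c : Cmd T G) (base exit s : ℕ) (r : T → Prop) (h₁ : base ≤ s)
    (h₂ : s < base + c.size) (N : ℕ) (hN : base + c.size ≤ N) (hE : exit ≤ N) :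
    (c.instr base exit s r).1 ≤ N := by
  induction c generalizing base exit with
  | act f m => exact hE
  | seq c₁ c₂ ih₁ ih₂ =>
    rw [size] at h₂ hN
    rw [instr]
    split_ifs with h
    · exact ih₁ _ _ h₁ h (by omega) (by omega)
    · exact ih₂ _ _ (by omega) (by omega) (by omega) hE
  | ite b c₁ c₂ ih₁ ih₂ =>
    rw [size] at h₂ hN
    rw [instr]
    split_ifs with h h' h'
    · simp only; omega
    · simp only; omega
    · exact ih₁ _ _ (by omega) h' (by omega) hE
    · exact ih₂ _ _ (by omega) (by omega) (by omega) hE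
  | loop b c ih =>
    rw [size] at h₂ hN
    rw [instr]
    split_ifs with h h'
    · simp only; omega
    · simp only; omega
    · exact ih _ _ (by omega) (by omega) (by omega) (by omega)

end Cmd

section Exec

variable {T G : Type} (grp : T → G)

/-- The configuration of a machine given by a state and a store. -/
def conf {n : ℕ} (e : Fin n ≃ T) (q : ℕ) (σ : Store.{u} T G) : Config.{u} n where
  state := q
  head i := σ.hd (grp (e i))
  tape i := Tape.ofSet (σ.tp (e i))

/-- The command `c` is placed at the states `base, …, base + c.size - 1`, followed by `exit`. -/
def CodeAt (p : Program) (e : Fin (p.scratch + 5) ≃ T) (c : Cmd T G) (base exit : ℕ) : Prop :=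
  ∀ s, base ≤ s → s < base + c.size → ∀ σ : Store.{u} T G, p.step (conf grp e s σ) =
    conf grp e (c.instr base exit s (σ.rd grp)).1
      (σ.act grp (c.instr base exit s (σ.rd grp)).2.1 (c.instr base exit s (σ.rd grp)).2.2)

/-- The command `c` leads from the store `σ` to `σ'`, and all stores before `σ'` are above `L`. -/
def Exec (c : Cmd T G) (L σ σ' : Store.{u} T G) : Prop :=
  ∀ (p : Program) (e : Fin (p.scratch + 5) ≃ T) (base exit : ℕ), CodeAt.{u} grp p e c base exit →
    ∃ t, 0 < t ∧ p.run (conf grp e base σ) t = conf grp e exit σ' ∧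
      ∀ s < t, ∃ q ρ, p.run (conf grp e base σ) s = conf grp e q ρ ∧ base ≤ q ∧
        q < base + c.size ∧ L.Below ρ

variable {grp} {L σ σ₁ σ' : Store.{u} T G} {c c₁ c₂ : Cmd T G}

theorem Exec.mono {L' : Store.{u} T G} (h : Exec grp c L σ σ') (hL : L'.Below L) :
    Exec grp c L' σ σ' := by
  intro p e base exit hc
  obtain ⟨t, ht, h₁, h₂⟩ := h p e base exit hc
  refine ⟨t, ht, h₁, fun s hs => ?_⟩
  obtain ⟨q, ρ, h, h₃, h₄, h₅⟩ := h₂ s hs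
  exact ⟨q, ρ, h, h₃, h₄, hL.trans h₅⟩

theorem Exec.act (f : (T → Prop) → T → Prop) (m : (T → Prop) → G → Move) (hL : L.Below σ)
    (h : σ.act grp (f (σ.rd grp)) (m (σ.rd grp)) = σ') : Exec grp (.act f m) L σ σ' := by
  intro p e base exit hc
  -- Time one is written as `0 + 1` so that `run_add_one` and `run_zero` apply.
  refine ⟨0 + 1, by simp, ?_, fun s hs => ⟨base, σ, ?_, le_rfl, by simp [Cmd.size], hL⟩⟩
  · rw [Program.run_add_one, Program.run_zero, hc base le_rfl (by simp [Cmd.size]), ← h]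
    rfl
  · rw [zero_add, Order.lt_one_iff] at hs
    rw [hs, Program.run_zero]

/-- Composition of a run of length `t` with a run of length `t'`. -/
theorem run_comp {p : Program} {C D E : Config.{u} (p.scratch + 5)} {t t' : Ordinal.{u}}
    {A : Config.{u} (p.scratch + 5) → Prop} (h : p.run C t = D) (hA : ∀ s < t, A (p.run C s))
    (h' : p.run D t' = E) (hA' : ∀ s < t', A (p.run D s)) :
    p.run C (t + t') = E ∧ ∀ s < t + t', A (p.run C s) := by
  subst h
  refine ⟨by rw [Program.run_add, h'], fun s hs => ?_⟩
  rcases lt_or_ge s t with hst | hst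
  · exact hA s hst
  · rw [← Ordinal.add_sub_cancel_of_le hst, Program.run_add]
    refine hA' _ ?_
    rwa [← add_lt_add_iff_left t, Ordinal.add_sub_cancel_of_le hst]

theorem Exec.seq (h₁ : Exec grp c₁ L σ σ₁) (h₂ : Exec grp c₂ L σ₁ σ') :
    Exec grp (.seq c₁ c₂) L σ σ' := by
  intro p e base exit hc
  obtain ⟨t, ht, r, i⟩ := h₁ p e base (base + c₁.size) (fun s hs hs' τ => by
    rw [hc s hs (by rw [Cmd.size]; omega) τ, Cmd.instr, if_pos hs'])
  obtain ⟨t', ht', r', i'⟩ := h₂ p e (base + c₁.size) exit (fun s hs hs' τ => by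
    rw [hc s (by omega) (by rw [Cmd.size]; omega) τ, Cmd.instr, if_neg (by omega)])
  have := run_comp (A := fun C => ∃ q ρ, C = conf grp e q ρ ∧ base ≤ q ∧
    q < base + (Cmd.seq c₁ c₂).size ∧ L.Below ρ) r (fun s hs => by
      obtain ⟨q, ρ, h, h₃, h₄, h₅⟩ := i s hs
      exact ⟨q, ρ, h, h₃, by rw [Cmd.size]; omega, h₅⟩) r' (fun s hs => by
      obtain ⟨q, ρ, h, h₃, h₄, h₅⟩ := i' s hs
      exact ⟨q, ρ, h, by omega, by rw [Cmd.size]; omega, h₅⟩)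
  exact ⟨t + t', ht.trans_le le_self_add, this⟩

/-- A first step from state `base` to state `base'`, followed by the execution of a command placed
at `base'`. -/
theorem exec_step {p : Program} {e : Fin (p.scratch + 5) ≃ T} {base base' exit size size' : ℕ}
    (hL : L.Below σ) (hs : 0 < size) (hb : base ≤ base') (hb' : base' + size' ≤ base + size)
    (h : p.step (conf grp e base σ) = conf grp e base' σ)
    (h' : ∃ t, 0 < t ∧ p.run (conf grp e base' σ) t = conf grp e exit σ' ∧
      ∀ s < t, ∃ q ρ, p.run (conf grp e base' σ) s = conf grp e q ρ ∧ base' ≤ q ∧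
        q < base' + size' ∧ L.Below ρ) :
    ∃ t, 0 < t ∧ p.run (conf grp e base σ) t = conf grp e exit σ' ∧
      ∀ s < t, ∃ q ρ, p.run (conf grp e base σ) s = conf grp e q ρ ∧ base ≤ q ∧
        q < base + size ∧ L.Below ρ := by
  obtain ⟨t, ht, r, i⟩ := h'
  have := run_comp (C := conf grp e base σ) (D := conf grp e base' σ) (t := 0 + 1)
    (A := fun C => ∃ q ρ, C = conf grp e q ρ ∧ base ≤ q ∧
      q < base + size ∧ L.Below ρ) (by rw [Program.run_add_one, Program.run_zero, h])
    (fun s hs => by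
      rw [zero_add, Order.lt_one_iff] at hs
      exact ⟨base, σ, by rw [hs, Program.run_zero], le_rfl, by omega, hL⟩) r (fun s hs => by
      obtain ⟨q, ρ, h, h₃, h₄, h₅⟩ := i s hs
      exact ⟨q, ρ, h, by omega, by omega, h₅⟩)
  exact ⟨_, ht.trans_le le_add_self, this⟩

theorem Exec.ite_true {b : (T → Prop) → Prop} (hL : L.Below σ) (hb : b (σ.rd grp))
    (h : Exec grp c₁ L σ σ') : Exec grp (.ite b c₁ c₂) L σ σ' := by
  intro p e base exit hc
  refine exec_step hL (Cmd.size_pos _) (Nat.le_add_right base 1) (size' := c₁.size)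
    (by rw [Cmd.size]; omega) ?_ (h p e (base + 1) exit fun s hs hs' τ => ?_)
  · rw [hc base le_rfl (by rw [Cmd.size]; omega), Cmd.instr, if_pos rfl, if_pos hb, Store.act_stay]
  · rw [hc s (by omega) (by rw [Cmd.size]; omega) τ, Cmd.instr, if_neg (by omega),
      if_pos (by omega)]

theorem Exec.ite_false {b : (T → Prop) → Prop} (hL : L.Below σ) (hb : ¬ b (σ.rd grp))
    (h : Exec grp c₂ L σ σ') : Exec grp (.ite b c₁ c₂) L σ σ' := by
  intro p e base exit hc
  refine exec_step hL (Cmd.size_pos _) (base' := base + 1 + c₁.size) (by omega) (size' := c₂.size)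
    (by rw [Cmd.size]; omega) ?_ (h p e _ exit fun s hs hs' τ => ?_)
  · rw [hc base le_rfl (by rw [Cmd.size]; omega), Cmd.instr, if_pos rfl, if_neg hb, Store.act_stay]
  · rw [hc s (by omega) (by rw [Cmd.size]; omega) τ, Cmd.instr, if_neg (by omega),
      if_neg (by omega)]

/-- At the limit `o` the stores `K j` have the inferior limit `K o`. -/
def StoreLim (K : Ordinal.{u} → Store.{u} T G) (o : Ordinal.{u}) : Prop :=
  (∀ g, HeadLim (fun j => (K j).hd g) o ((K o).hd g)) ∧
    ∀ t, TapeLim (fun j => (K j).tp t) o ((K o).tp t)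

/-- The times `τ j` are the visits to the loop test. Between two visits the state is at least `base`
and the store is above `K j`, so the inferior limit is already determined by the visits. As the loop
test has the smallest state number in the loop, the limit state is again the loop test. -/
theorem run_eq_conf_of_limit {p : Program} {e : Fin (p.scratch + 5) ≃ T}
    {C : Config.{u} (p.scratch + 5)} {base : ℕ} {K : Ordinal.{u} → Store.{u} T G}
    {τ : Ordinal.{u} → Ordinal.{u}} {o : Ordinal.{u}} (ho : IsSuccLimit o)
    (hτ : IsNormal τ) (hK : ∀ j < o, p.run C (τ j) = conf grp e base (K j))
    (h : ∀ s < τ o, ∃ j < o, τ j ≤ s ∧ s < τ (j + 1) ∧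
      ∃ q ρ, p.run C s = conf grp e q ρ ∧ base ≤ q ∧ (K j).Below ρ)
    (hlim : StoreLim K o) : p.run C (τ o) = conf grp e base (K o) := by
  have hlo : IsSuccLimit (τ o) := hτ.map_isSuccLimit ho
  -- From time `τ i` on, only rounds with index at least `i` are active.
  have key : ∀ i < o, ∃ s₀ : Set.Iio (τ o), ∀ s, s₀ ≤ s → ∃ j, i ≤ j ∧ j < o ∧
      ∃ q ρ, p.run C s.1 = conf grp e q ρ ∧ base ≤ q ∧ (K j).Below ρ := by
    intro i hi
    refine ⟨⟨τ i, hτ.strictMono hi⟩, fun s hs => ?_⟩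
    obtain ⟨j, hj, h₁, h₂, h₃⟩ := h s.1 s.2
    refine ⟨j, ?_, hj, h₃⟩
    have : τ i < τ (j + 1) := (show τ i ≤ s.1 from hs).trans_lt h₂
    exact Order.lt_add_one_iff.1 (hτ.strictMono.lt_iff_lt.1 this)
  have cof : ∀ s₀ : Set.Iio (τ o), ∃ i < o, s₀.1 ≤ τ i := by
    intro s₀
    obtain ⟨i, hi, h⟩ := (hτ.lt_iff_exists_lt ho).1 s₀.2
    exact ⟨i, hi, h.le⟩
  rw [Program.run_limit _ _ hlo, conf]
  congr 1
  · refine liminf_Iio_eq hlo _ _ 0 (fun _ => Nat.zero_le _) (fun a ha => ?_) fun s₀ => ?_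
    · obtain ⟨s₀, h₀⟩ := key 0 ho.bot_lt
      refine ⟨s₀, fun s hs => ?_⟩
      obtain ⟨j, -, -, q, ρ, h₁, h₂, -⟩ := h₀ s hs
      rw [h₁]
      exact ha.trans_le h₂
    · obtain ⟨i, hi, h⟩ := cof s₀
      exact ⟨⟨τ i, hτ.strictMono hi⟩, h, by rw [hK i hi]; exact le_rfl⟩
  · funext i
    obtain ⟨low, up⟩ := hlim.1 (grp (e i))
    refine liminf_Iio_eq hlo _ _ 0 (fun _ => zero_le) (fun a ha => ?_) fun s₀ => ?_
    · obtain ⟨i₀, hi₀, h₀⟩ := low a ha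
      obtain ⟨s₀, h₁⟩ := key i₀ hi₀
      refine ⟨s₀, fun s hs => ?_⟩
      obtain ⟨j, hij, hj, q, ρ, h₂, -, h₃⟩ := h₁ s hs
      rw [h₂]
      exact (h₀ j hij hj).trans_le (h₃.1 _)
    · obtain ⟨i₀, hi₀, h₀⟩ := cof s₀
      obtain ⟨j, hj, hjo, h₁⟩ := up i₀ hi₀
      refine ⟨⟨τ j, hτ.strictMono hjo⟩, h₀.trans (hτ.monotone hj), ?_⟩
      rw [hK j hjo]
      exact h₁
  · funext i ξ
    obtain ⟨low, up⟩ := hlim.2 (e i) ξ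
    refine liminf_Iio_eq hlo _ _ false (fun _ => Bool.false_le _) (fun a ha => ?_) fun s₀ => ?_
    · have hv : ξ ∈ (K o).tp (e i) := by
        by_contra hc
        simp only [Tape.ofSet, hc, decide_false] at ha
        exact absurd ha (not_lt.2 (Bool.false_le _))
      obtain ⟨i₀, hi₀, h₀⟩ := low hv
      obtain ⟨s₀, h₁⟩ := key i₀ hi₀
      refine ⟨s₀, fun s hs => ?_⟩
      obtain ⟨j, hij, hj, q, ρ, h₂, -, h₃⟩ := h₁ s hs
      rw [h₂]
      refine ha.trans_le ?_
      simp [conf, Tape.ofSet, h₃.2 _ (h₀ j hij hj)]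
    · obtain ⟨i₀, hi₀, h₀⟩ := cof s₀
      by_cases hv : ξ ∈ (K o).tp (e i)
      · exact ⟨s₀, le_rfl, by simp [Tape.ofSet, hv]⟩
      · obtain ⟨j, hj, hjo, h₁⟩ := up hv i₀ hi₀
        refine ⟨⟨τ j, hτ.strictMono hjo⟩, h₀.trans (hτ.monotone hj), ?_⟩
        rw [hK j hjo]
        simp [conf, Tape.ofSet, h₁]

/-- The rule for transfinite loops: `K i` is the store when the loop condition is tested for the
`i`-th time, and `θ` is the number of iterations. -/
theorem Exec.loop {b : (T → Prop) → Prop} (K : Ordinal.{u} → Store.{u} T G) (θ : Ordinal.{u})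
    (hb : ∀ i < θ, b ((K i).rd grp)) (hθ : ¬ b ((K θ).rd grp))
    (hK : ∀ i < θ, Exec grp c (K i) (K i) (K (i + 1)))
    (hlim : ∀ o ≤ θ, IsSuccLimit o → StoreLim K o) (hL : ∀ i ≤ θ, L.Below (K i)) :
    Exec grp (.loop b c) L (K 0) (K θ) := by
  intro p e base exit hc
  -- The duration of the `i`-th round, test included. For `i ≥ θ` it is given the dummy value `1`,
  -- so that all durations are positive and their sums form a normal function.
  have body : ∀ i, ∃ t, 0 < t ∧ (i < θ → p.run (conf grp e base (K i)) t =
      conf grp e base (K (i + 1)) ∧ ∀ s < t, ∃ q ρ, p.run (conf grp e base (K i)) s =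
        conf grp e q ρ ∧ base ≤ q ∧ q < base + (Cmd.loop b c).size ∧ (K i).Below ρ) := by
    intro i
    by_cases hi : i < θ
    · have := exec_step (grp := grp) (p := p) (e := e) (exit := base) (σ' := K (i + 1))
        (size := (Cmd.loop b c).size) (base := base) (Store.Below.refl (K i))
        (Cmd.size_pos _) (Nat.le_add_right base 1) (size' := c.size) (by rw [Cmd.size]; omega)
        (by rw [hc base le_rfl (by rw [Cmd.size]; omega), Cmd.instr, if_pos rfl,
          if_pos (hb i hi), Store.act_stay])
        (hK i hi p e (base + 1) base fun s hs hs' τ => by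
          rw [hc s (by omega) (by rw [Cmd.size]; omega) τ, Cmd.instr, if_neg (by omega)])
      obtain ⟨t, ht, h⟩ := this
      exact ⟨t, ht, fun _ => h⟩
    · exact ⟨1, zero_lt_one, fun h => absurd h hi⟩
  choose d hd hrun using body
  have hn : IsNormal (ordSum d) := ordSum_isNormal hd
  have main : ∀ i ≤ θ, p.run (conf grp e base (K 0)) (ordSum d i) = conf grp e base (K i) := by
    intro i
    induction i using WellFoundedLT.induction with
    | ind i ih =>
      intro hi
      rcases Ordinal.zero_or_succ_or_isSuccLimit i with rfl | ⟨j, rfl⟩ | hl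
      · rw [ordSum_zero, Program.run_zero]
      · change p.run _ (ordSum d (j + 1)) = conf grp e base (K (j + 1))
        have hj : j < θ := (lt_add_one j).trans_le hi
        rw [ordSum_add_one, Program.run_add, ih j (lt_add_one j) hj.le]
        exact (hrun j hj).1
      · refine run_eq_conf_of_limit hl hn (fun j hj => ih j hj (hj.le.trans hi)) (fun s hs => ?_)
          (hlim i hi hl)
        obtain ⟨j, hj, h₁, h₂⟩ := exists_of_lt_ordSum hs
        refine ⟨j, hj, h₁, by rwa [ordSum_add_one], ?_⟩
        rw [← Ordinal.add_sub_cancel_of_le h₁, Program.run_add, ih j hj (hj.le.trans hi)]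
        obtain ⟨q, ρ, r₁, r₂, -, r₄⟩ := (hrun j (hj.trans_le hi)).2 (s - ordSum d j) (by
          rwa [← add_lt_add_iff_left (ordSum d j), Ordinal.add_sub_cancel_of_le h₁])
        exact ⟨q, ρ, r₁, r₂, r₄⟩
  -- The extra step is the final test, which fails and jumps to `exit`.
  refine ⟨ordSum d θ + (0 + 1), by simp, run_comp (D := conf grp e base (K θ))
    (A := fun C => ∃ q ρ, C = conf grp e q ρ ∧ base ≤ q ∧
      q < base + (Cmd.loop b c).size ∧ L.Below ρ) (main θ le_rfl) (fun s hs => ?_) ?_ ?_⟩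
  · obtain ⟨j, hj, h₁, h₂⟩ := exists_of_lt_ordSum hs
    rw [← Ordinal.add_sub_cancel_of_le h₁, Program.run_add, main j hj.le]
    obtain ⟨q, ρ, r₁, r₂, r₃, r₄⟩ := (hrun j hj).2 (s - ordSum d j) (by
      rwa [← add_lt_add_iff_left (ordSum d j), Ordinal.add_sub_cancel_of_le h₁])
    exact ⟨q, ρ, r₁, r₂, r₃, (hL j hj.le).trans r₄⟩
  · rw [Program.run_add_one, Program.run_zero, hc base le_rfl (by rw [Cmd.size]; omega), Cmd.instr,
      if_pos rfl, if_neg hθ, Store.act_stay]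
  · intro s hs
    rw [zero_add, Order.lt_one_iff] at hs
    exact ⟨base, K θ, by rw [hs, Program.run_zero], le_rfl, by rw [Cmd.size]; omega, hL θ le_rfl⟩

end Exec

/-! ### Compilation -/

section Compile

variable {W G : Type} [Fintype W] (grp : Fin 5 ⊕ W → G)

/-- The tapes of a machine: the five special ones and the scratch tapes. -/
def tapeEquiv (W : Type) [Fintype W] : Fin (Fintype.card W + 5) ≃ Fin 5 ⊕ W :=
  ((finCongr (Nat.add_comm _ _)).trans finSumFinEquiv.symm).trans
    (Equiv.sumCongr (Equiv.refl _) (Fintype.equivFin W).symm)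

theorem tapeEquiv_of_lt {i : ℕ} (h : i < 5) (h' : i < Fintype.card W + 5) :
    tapeEquiv W ⟨i, h'⟩ = .inl ⟨i, h⟩ := by
  have : finSumFinEquiv.symm (finCongr (Nat.add_comm (Fintype.card W) 5) ⟨i, h'⟩) =
      (.inl ⟨i, h⟩ : Fin 5 ⊕ Fin (Fintype.card W)) := by
    rw [Equiv.symm_apply_eq]
    rfl
  change Sum.map _ _ (finSumFinEquiv.symm (finCongr _ ⟨i, h'⟩)) = _
  rw [this]
  rfl

theorem tapeEquiv_of_ge {i : ℕ} (h : ¬ i < 5) (h' : i < Fintype.card W + 5) :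
    ∃ w, tapeEquiv W ⟨i, h'⟩ = .inr w := by
  rcases hw : tapeEquiv W ⟨i, h'⟩ with j | w
  · have := tapeEquiv_of_lt (W := W) j.2 (by omega)
    rw [← hw] at this
    have := congrArg Fin.val ((tapeEquiv W).injective this)
    exact absurd j.2 (by simp only at this; omega)
  · exact ⟨w, rfl⟩

open Classical in
/-- The machine for a command. -/
def Cmd.toProgram (c : Cmd (Fin 5 ⊕ W) G) : Program where
  scratch := Fintype.card W
  halt := c.size
  table s r :=
    let I := c.instr 0 c.size s.1 fun t => r ((tapeEquiv W).symm t) = true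
    (⟨min I.1 c.size, by omega⟩, fun i =>
      (decide (I.2.1 (tapeEquiv W i)), I.2.2 (grp (tapeEquiv W i))))

open Classical in
theorem Cmd.codeAt_toProgram (c : Cmd (Fin 5 ⊕ W) G) :
    CodeAt.{u} grp (c.toProgram grp) (tapeEquiv W) c 0 c.size := by
  intro s _ hs σ
  rw [zero_add] at hs
  have hrd : (fun t => Tape.ofSet (σ.tp (tapeEquiv W ((tapeEquiv W).symm t)))
      (σ.hd (grp (tapeEquiv W ((tapeEquiv W).symm t)))) = true) = σ.rd grp := by
    funext t
    simp [Tape.ofSet, Store.rd]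
  have hle := c.instr_fst_le 0 c.size s (σ.rd grp) (Nat.zero_le _) (by omega) c.size (by omega)
    le_rfl
  refine (dif_pos hs).trans ?_
  have hI : c.instr 0 c.size s (fun t => Tape.ofSet (σ.tp (tapeEquiv W ((tapeEquiv W).symm t)))
      (σ.hd (grp (tapeEquiv W ((tapeEquiv W).symm t)))) = true) =
      c.instr 0 c.size s (σ.rd grp) := by rw [hrd]
  refine Config.mk.injEq .. ▸ ⟨?_, ?_, ?_⟩
  · exact (congrArg (fun I => min I.1 c.size) hI).trans (min_eq_left hle)
  · funext i
    exact congrArg (fun I : ℕ × ((Fin 5 ⊕ W) → Prop) × (G → Move) =>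
      (I.2.2 (grp (tapeEquiv W i))).apply (σ.hd (grp (tapeEquiv W i)))) hI
  · funext i
    refine (congrArg (fun I : ℕ × ((Fin 5 ⊕ W) → Prop) × (G → Move) => Function.update (Tape.ofSet (σ.tp (tapeEquiv W i)))
      (σ.hd (grp (tapeEquiv W i))) (decide (I.2.1 (tapeEquiv W i)))) hI).trans ?_
    funext ξ
    by_cases h : ξ = σ.hd (grp (tapeEquiv W i))
    · subst h
      exact (Function.update_self ..).trans (decide_eq_decide.2
        ⟨fun h => .inl ⟨rfl, h⟩, fun h => h.elim And.right fun h => absurd rfl h.1⟩)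
    · exact (Function.update_of_ne h ..).trans (decide_eq_decide.2
        ⟨fun h' => .inr ⟨h, h'⟩, fun h' => h'.elim (fun h' => absurd h'.1 h) And.right⟩)

theorem Cmd.exists_equiv (c : Cmd (Fin 5 ⊕ W) G) :
    ∃ e : Fin ((c.toProgram grp).scratch + 5) ≃ Fin 5 ⊕ W,
      CodeAt.{u} grp (c.toProgram grp) e c 0 c.size ∧ (c.toProgram grp).halt = c.size ∧
      ∀ i hi, (∃ h, e ⟨i, hi⟩ = .inl ⟨i, h⟩) ∨ ¬ i < 5 ∧ ∃ w, e ⟨i, hi⟩ = .inr w := by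
  refine ⟨tapeEquiv W, c.codeAt_toProgram grp, rfl, fun i hi => ?_⟩
  by_cases h : i < 5
  · exact .inl ⟨h, tapeEquiv_of_lt h hi⟩
  · exact .inr ⟨h, tapeEquiv_of_ge h hi⟩

/-- The store with blank scratch tapes and the given contents of the input tapes. -/
def initStore (P i₁ i₂ i₃ : Set Ordinal.{u}) : Store.{u} (Fin 5 ⊕ W) G where
  hd _ := 0
  tp
    | .inl 0 => P
    | .inl 1 => i₁
    | .inl 2 => i₂
    | .inl 3 => i₃
    | _ => ∅

variable {grp}

theorem Exec.outputs {c : Cmd (Fin 5 ⊕ W) G} {P i₁ i₂ i₃ : Set Ordinal.{u}}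
    {L σ : Store.{u} (Fin 5 ⊕ W) G} (h : Exec grp c L (initStore P i₁ i₂ i₃) σ) :
    (c.toProgram grp).Outputs (Tape.ofSet P) ![Tape.ofSet i₁, Tape.ofSet i₂, Tape.ofSet i₃]
      (Tape.ofSet (σ.tp (.inl 4))) := by
  obtain ⟨e, hc, hh, he⟩ := c.exists_equiv grp
  obtain ⟨t, -, ht, -⟩ := h (c.toProgram grp) e 0 c.size hc
  have e0 : (c.toProgram grp).init (Tape.ofSet P)
      ![Tape.ofSet i₁, Tape.ofSet i₂, Tape.ofSet i₃] =
      conf grp e 0 (initStore P i₁ i₂ i₃) := by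
    have eb : (fun _ => false : Tape.{u}) = Tape.ofSet ∅ := by
      funext ξ
      simp [Tape.ofSet]
    refine Config.mk.injEq .. ▸ ⟨rfl, rfl, ?_⟩
    funext ⟨i, hi⟩
    rcases he i hi with ⟨h5, hw⟩ | ⟨h5, w, hw⟩
    · rw [hw]
      interval_cases i
      · rfl
      · rfl
      · rfl
      · rfl
      · exact eb
    · rw [hw]
      simp only
      rw [if_neg (by omega), dif_neg (by omega)]
      exact eb
  refine ⟨t, ?_, ?_⟩
  · rw [e0, ht, hh]
    rfl
  · rw [e0, ht]
    change Tape.ofSet (σ.tp (e ⟨4, _⟩)) = _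
    obtain ⟨h5, hw⟩ | ⟨h5, -⟩ := he 4 (by omega)
    · rw [hw]
      rfl
    · omega

end Compile

/-! ### Gödel's pairing function -/

theorem godelKey_lt {a b c d : Ordinal.{u}} : godelKey (a, b) < godelKey (c, d) ↔
    max a b < max c d ∨ max a b = max c d ∧ (a < c ∨ a = c ∧ b < d) := by
  simp only [godelKey, Prod.Lex.toLex_lt_toLex]

theorem godelKey_injective : Function.Injective godelKey.{u} := by
  intro p q h
  have := congrArg (fun k => ofLex (ofLex k).2) h
  exact this

/-- Pairs with a smaller key have both components at most the maximum of `p`. Smallness makes the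
supremum in `godelPair` a genuine upper bound. -/
instance small_godelKey_lt (p : Ordinal.{u} × Ordinal.{u}) :
    Small.{u} {q : Ordinal.{u} × Ordinal.{u} // godelKey q < godelKey p} := by
  refine small_of_injective (β := Set.Iic (max p.1 p.2) × Set.Iic (max p.1 p.2))
    (f := fun q => (⟨q.1.1, ?_⟩, ⟨q.1.2, ?_⟩)) ?_
  · rcases godelKey_lt.1 q.2 with h | h
    · exact (le_max_left _ _).trans h.le
    · exact (le_max_left _ _).trans h.1.le
  · rcases godelKey_lt.1 q.2 with h | h
    · exact (le_max_right _ _).trans h.le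
    · exact (le_max_right _ _).trans h.1.le
  · intro q q' h
    simp only [Prod.mk.injEq, Subtype.mk.injEq] at h
    exact Subtype.ext (Prod.ext h.1 h.2)

theorem godelPair_lt_of_key {p q : Ordinal.{u} × Ordinal.{u}} (h : godelKey q < godelKey p) :
    godelPair q < godelPair p := by
  rw [godelPair.eq_1 p, ← succ_le_iff]
  exact Ordinal.le_iSup (fun q : {q : Ordinal.{u} × Ordinal.{u} // godelKey q < godelKey p} =>
    succ (godelPair q.1)) ⟨q, h⟩

theorem godelPair_lt_iff {p q : Ordinal.{u} × Ordinal.{u}} :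
    godelPair q < godelPair p ↔ godelKey q < godelKey p := by
  refine ⟨fun h => ?_, godelPair_lt_of_key⟩
  rcases lt_trichotomy (godelKey q) (godelKey p) with h' | h' | h'
  · exact h'
  · rw [godelKey_injective h'] at h
    exact absurd h (lt_irrefl _)
  · exact absurd h (godelPair_lt_of_key h').not_gt

theorem godelPair_injective : Function.Injective godelPair.{u} := by
  intro p q h
  apply godelKey_injective
  by_contra hne
  rcases lt_or_gt_of_ne hne with h' | h'
  · exact (godelPair_lt_of_key h').ne h
  · exact (godelPair_lt_of_key h').ne' h

theorem godelPair_eq {p : Ordinal.{u} × Ordinal.{u}} {a : Ordinal.{u}}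
    (h₁ : ∀ q, godelKey q < godelKey p → godelPair q < a)
    (h₂ : ∀ b < a, ∃ q, godelKey q < godelKey p ∧ b ≤ godelPair q) : godelPair p = a := by
  apply le_antisymm
  · rw [godelPair.eq_1 p]
    exact Ordinal.iSup_le fun q => succ_le_of_lt (h₁ q.1 q.2)
  · by_contra! hc
    obtain ⟨q, hq, hb⟩ := h₂ _ hc
    exact absurd (godelPair_lt_of_key hq) (not_lt.2 hb)

theorem exists_of_lt_godelPair {p : Ordinal.{u} × Ordinal.{u}} {b : Ordinal.{u}}
    (h : b < godelPair p) : ∃ q, godelKey q < godelKey p ∧ b ≤ godelPair q := by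
  by_contra! hc
  have : godelPair p ≤ b := by
    rw [godelPair.eq_1 p]
    exact Ordinal.iSup_le fun q => succ_le_of_lt (hc q.1 q.2)
  exact absurd h (not_lt.2 this)

/-- The position of the first pair with maximum `m`. -/
def godelBase (m : Ordinal.{u}) : Ordinal.{u} := godelPair (0, m)

/-- Maxima are compared first, and `(0, m)` is the first pair with maximum `m`, so the positions
before it are those of the pairs in the square `m × m`. -/
theorem lt_godelBase_iff {x y m : Ordinal.{u}} :
    godelPair (x, y) < godelBase m ↔ x < m ∧ y < m := by
  rw [godelBase, godelPair_lt_iff, godelKey_lt, max_eq_right (zero_le (a := m)), max_lt_iff]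
  constructor
  · rintro (h | ⟨h, h' | ⟨rfl, h'⟩⟩)
    · exact h
    · exact absurd h' not_lt_zero
    · rw [max_eq_right zero_le] at h
      exact absurd h h'.ne
  · exact .inl

theorem exists_of_lt_add {a b x : Ordinal.{u}} (h : b < a + x) : b < a ∨ ∃ y < x, b = a + y := by
  rcases lt_or_ge b a with h' | h'
  · exact .inl h'
  · refine .inr ⟨b - a, ?_, (Ordinal.add_sub_cancel_of_le h').symm⟩
    rwa [← add_lt_add_iff_left a, Ordinal.add_sub_cancel_of_le h']

/-- Among the pairs with maximum `m`, ordered by first component, the pairs `(x, m)` with `x < m`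
come first, in the order of `x`. After these `m` positions follow the pairs `(m, y)` with `y ≤ m`.
The walk of the machines through all pairs imitates this order. -/
theorem godelPair_of_lt {x m : Ordinal.{u}} (h : x < m) :
    godelPair (x, m) = godelBase m + x := by
  induction x using WellFoundedLT.induction with
  | ind x ih =>
    apply godelPair_eq
    · rintro ⟨a, b⟩ hab
      rw [godelKey_lt, max_eq_right h.le] at hab
      rcases hab with hab | ⟨hm, hab | ⟨rfl, hb⟩⟩
      · exact (lt_godelBase_iff.2 (max_lt_iff.1 hab)).trans_le le_self_add
      · have hb : b = m := by
          rcases max_cases a b with h' | h'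
          · rw [h'.1] at hm
            exact absurd (hm ▸ hab) h.not_gt
          · exact h'.1.symm.trans hm
        subst hb
        rw [ih a hab (hab.trans h)]
        exact add_lt_add_right hab _
      · exact absurd hm (max_lt h hb).ne
    · intro b hb
      rcases exists_of_lt_add hb with hb | ⟨y, hy, rfl⟩
      · obtain ⟨⟨c, d⟩, hq, hb⟩ := exists_of_lt_godelPair hb
        refine ⟨_, ?_, hb⟩
        have := lt_godelBase_iff.1 (godelPair_lt_iff.2 hq)
        rw [godelKey_lt, max_eq_right h.le]
        exact .inl (max_lt this.1 this.2)
      · refine ⟨(y, m), ?_, (ih y hy (hy.trans h)).ge⟩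
        rw [godelKey_lt, max_eq_right h.le, max_eq_right (hy.trans h).le]
        exact .inr ⟨rfl, .inl hy⟩

theorem godelPair_of_le {y m : Ordinal.{u}} (h : y ≤ m) :
    godelPair (m, y) = godelBase m + m + y := by
  induction y using WellFoundedLT.induction with
  | ind y ih =>
    apply godelPair_eq
    · rintro ⟨a, b⟩ hab
      rw [godelKey_lt, max_eq_left h] at hab
      rcases hab with hab | ⟨hm, hab | ⟨rfl, hb⟩⟩
      · exact (lt_godelBase_iff.2 (max_lt_iff.1 hab)).trans_le (le_self_add.trans le_self_add)
      · have hb : b = m := by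
          rcases max_cases a b with h' | h'
          · exact absurd (h'.1 ▸ hm) hab.ne
          · exact h'.1.symm.trans hm
        subst hb
        rw [godelPair_of_lt hab]
        exact (add_lt_add_right hab _).trans_le le_self_add
      · rw [ih b hb (hb.le.trans h)]
        exact add_lt_add_right hb _
    · intro b hb
      rcases exists_of_lt_add hb with hb | ⟨z, hz, rfl⟩
      · rcases exists_of_lt_add hb with hb | ⟨x, hx, rfl⟩
        · obtain ⟨⟨c, d⟩, hq, hb⟩ := exists_of_lt_godelPair hb
          refine ⟨_, ?_, hb⟩
          have := lt_godelBase_iff.1 (godelPair_lt_iff.2 hq)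
          rw [godelKey_lt, max_eq_left h]
          exact .inl (max_lt this.1 this.2)
        · refine ⟨(x, m), ?_, (godelPair_of_lt hx).ge⟩
          rw [godelKey_lt, max_eq_left h, max_eq_right hx.le]
          exact .inr ⟨rfl, .inl hx⟩
      · refine ⟨(m, z), ?_, (ih z hz (hz.le.trans h)).ge⟩
        rw [godelKey_lt, max_eq_left h, max_eq_left (hz.le.trans h)]
        exact .inr ⟨rfl, .inr ⟨rfl, hz⟩⟩

/-- `(m, m)` is the last pair with maximum `m`, so the next square begins right after it. -/
theorem godelBase_add_one (m : Ordinal.{u}) :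
    godelBase (m + 1) = godelBase m + m + m + 1 := by
  rw [← godelPair_of_le le_rfl]
  have hm : m < m + 1 := lt_add_one m
  apply godelPair_eq
  · rintro ⟨a, b⟩ h
    have := lt_godelBase_iff.1 (godelPair_lt_iff.2 h)
    rw [Order.lt_add_one_iff, Order.lt_add_one_iff] at this
    rw [Order.lt_add_one_iff]
    by_contra! hc
    rw [godelPair_lt_iff, godelKey_lt, max_self] at hc
    rcases hc with hc | ⟨h₁, h₂ | ⟨h₂, h₃⟩⟩
    · exact absurd (max_le this.1 this.2) (not_le.2 hc)
    · exact absurd this.1 (not_le.2 h₂)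
    · exact absurd this.2 (not_le.2 h₃)
  · intro b hb
    exact ⟨(m, m), godelPair_lt_iff.1 (lt_godelBase_iff.2 ⟨hm, hm⟩), Order.lt_add_one_iff.1 hb⟩

theorem godelBase_zero : godelBase (0 : Ordinal.{u}) = 0 := by
  refine godelPair_eq (fun q h => ?_) fun b hb => absurd hb not_lt_zero
  have := lt_godelBase_iff.1 (godelPair_lt_iff.2 h)
  exact absurd this.1 not_lt_zero

theorem godelBase_isNormal : IsNormal godelBase.{u} := by
  refine isNormal_iff.2 ⟨fun a b h => lt_godelBase_iff.2 ⟨zero_le.trans_lt h, h⟩,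
    fun o ho a h => ?_⟩
  by_contra! hc
  obtain ⟨⟨x, y⟩, hq, hb⟩ := exists_of_lt_godelPair hc
  obtain ⟨hx, hy⟩ := lt_godelBase_iff.1 (godelPair_lt_iff.2 hq)
  have hm := ho.add_one_lt (max_lt hx hy)
  have : godelPair (x, y) < godelBase (max x y + 1) := lt_godelBase_iff.2
    ⟨Order.lt_add_one_iff.2 (le_max_left _ _), Order.lt_add_one_iff.2 (le_max_right _ _)⟩
  exact absurd (this.trans_le (h _ hm)) (not_lt.2 hb)

/-! ### Arithmetic -/

/-- Uniqueness of division with remainder. It separates even from odd cells, and the rows of length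
`N + 1` of a matrix written on a tape. -/
theorem mul_add_inj {a x y r s : Ordinal.{u}} (hr : r < a) (hs : s < a) :
    a * x + r = a * y + s ↔ x = y ∧ r = s := by
  refine ⟨fun h => ?_, fun ⟨h, h'⟩ => by rw [h, h']⟩
  have ha : a ≠ 0 := (zero_le.trans_lt hr).ne'
  have h₁ := congrArg (· / a) h
  have h₂ := congrArg (· % a) h
  simp only [Ordinal.mul_add_div _ ha, Ordinal.div_eq_zero_of_lt hr,
    Ordinal.div_eq_zero_of_lt hs, add_zero] at h₁
  simp only [Ordinal.mul_add_mod_self, Ordinal.mod_eq_of_lt hr, Ordinal.mod_eq_of_lt hs] at h₂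
  exact ⟨h₁, h₂⟩

theorem mul_isNormal {a : Ordinal.{u}} (h : 0 < a) : IsNormal (a * ·) :=
  Ordinal.isNormal_mul_right h

theorem add_isNormal (a : Ordinal.{u}) : IsNormal (a + ·) := Ordinal.isNormal_add_right a

/-! ### Tapes and basic routines of the machines -/

/-- The groups of tapes; the tapes of a group share one head position. -/
inductive Grp where
  | par | in1 | in2 | in3 | out | sc | q | h1 | h2 | h3 | e | f
  deriving DecidableEq

instance : Fintype Grp :=
  ⟨{.par, .in1, .in2, .in3, .out, .sc, .q, .h1, .h2, .h3, .e, .f}, fun g => by cases g <;> simp⟩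

/-- The scratch tapes. -/
inductive Scratch where
  -- Only cell `0` is marked, so that the heads of the group can recognise it.
  | z (g : Grp)
  -- The script: `mark` delimits the blocks, `bit` holds their contents.
  | mark | bit
  -- The set of ordinals of the code `k` (`false` for the first code, `true` for the second), and a
  -- marker at its bound.
  | qb (k : Bool) | qe (k : Bool)
  -- `s` collects the ordinals that denote elements of the current set, `pr` the first components of
  -- the pairs in the code; `rho` marks the representative, `r` the ordinal from the third input
  -- tape. `jk` takes up bits that are not needed. `u1` and `u3` on the head group `h3` are unary
  -- copies of the current maximum in the walk.
  | s (k : Bool) | pr (k : Bool) | rho (k : Bool) | r | jk | u1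
  -- The ordinals `b` that fail to denote the current set because of a pair `(a, b)` with `a < b`;
  -- `b3` records the failures with `b ≤ a`. There are two tapes because different heads stand on
  -- `b` in the two cases.
  | b1 (k : Bool)
  | b3 (k : Bool) | u3 | eta
  -- A matrix whose row `j` lists the ordinals denoting the set number `j`, with a last column for
  -- non-emptiness; `em` marks the last column.
  | ee (k : Bool) | em
  -- Flags, stored in cell `0`.
  | reached (k : Bool) | poison (k : Bool) | found (k : Bool) | hit
  deriving DecidableEq, Fintype

/-- The tapes of the machines. -/
abbrev Tp : Type := Fin 5 ⊕ Scratch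

/-- The group of a tape. -/
def tapeGrp : Tp → Grp
  | .inl 0 => .par
  | .inl 1 => .in1
  | .inl 2 => .in2
  | .inl 3 => .in3
  | .inl 4 => .out
  | .inr (.z g) => g
  | .inr .mark | .inr .bit => .sc
  | .inr (.qb _) | .inr (.qe _) => .q
  | .inr (.s _) | .inr (.pr _) | .inr (.rho _) | .inr .r | .inr .jk | .inr .u1 => .h1
  | .inr (.b1 _) => .h2
  | .inr (.b3 _) | .inr .u3 | .inr .eta => .h3
  | .inr (.ee _) | .inr .em => .e
  | .inr (.reached _) | .inr (.poison _) | .inr (.found _) | .inr .hit => .f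

@[simp] theorem tapeGrp_par : tapeGrp (.inl 0) = .par := rfl
@[simp] theorem tapeGrp_in1 : tapeGrp (.inl 1) = .in1 := rfl
@[simp] theorem tapeGrp_in2 : tapeGrp (.inl 2) = .in2 := rfl
@[simp] theorem tapeGrp_in3 : tapeGrp (.inl 3) = .in3 := rfl
@[simp] theorem tapeGrp_out : tapeGrp (.inl 4) = .out := rfl
@[simp] theorem tapeGrp_z (g : Grp) : tapeGrp (.inr (.z g)) = g := rfl
@[simp] theorem tapeGrp_mark : tapeGrp (.inr .mark) = .sc := rfl
@[simp] theorem tapeGrp_bit : tapeGrp (.inr .bit) = .sc := rfl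
@[simp] theorem tapeGrp_qb (k : Bool) : tapeGrp (.inr (.qb k)) = .q := rfl
@[simp] theorem tapeGrp_qe (k : Bool) : tapeGrp (.inr (.qe k)) = .q := rfl
@[simp] theorem tapeGrp_s (k : Bool) : tapeGrp (.inr (.s k)) = .h1 := rfl
@[simp] theorem tapeGrp_pr (k : Bool) : tapeGrp (.inr (.pr k)) = .h1 := rfl
@[simp] theorem tapeGrp_rho (k : Bool) : tapeGrp (.inr (.rho k)) = .h1 := rfl
@[simp] theorem tapeGrp_r : tapeGrp (.inr .r) = .h1 := rfl
@[simp] theorem tapeGrp_jk : tapeGrp (.inr .jk) = .h1 := rfl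
@[simp] theorem tapeGrp_u1 : tapeGrp (.inr .u1) = .h1 := rfl
@[simp] theorem tapeGrp_b1 (k : Bool) : tapeGrp (.inr (.b1 k)) = .h2 := rfl
@[simp] theorem tapeGrp_b3 (k : Bool) : tapeGrp (.inr (.b3 k)) = .h3 := rfl
@[simp] theorem tapeGrp_u3 : tapeGrp (.inr .u3) = .h3 := rfl
@[simp] theorem tapeGrp_eta : tapeGrp (.inr .eta) = .h3 := rfl
@[simp] theorem tapeGrp_ee (k : Bool) : tapeGrp (.inr (.ee k)) = .e := rfl
@[simp] theorem tapeGrp_em : tapeGrp (.inr .em) = .e := rfl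
@[simp] theorem tapeGrp_reached (k : Bool) : tapeGrp (.inr (.reached k)) = .f := rfl
@[simp] theorem tapeGrp_poison (k : Bool) : tapeGrp (.inr (.poison k)) = .f := rfl
@[simp] theorem tapeGrp_found (k : Bool) : tapeGrp (.inr (.found k)) = .f := rfl
@[simp] theorem tapeGrp_hit : tapeGrp (.inr .hit) = .f := rfl

/-- The stores of the machines. -/
abbrev St : Type (u + 1) := Store.{u} Tp Grp

/-- The commands of the machines. -/
abbrev Com : Type := Cmd Tp Grp

/-- Executions of the machines. -/
abbrev Ex (c : Com) (L σ σ' : St.{u}) : Prop := Exec tapeGrp c L σ σ'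

/-! ### Effects of single instructions and further rules for loops. -/

section Act

variable {T G : Type} {grp : T → G} {σ : Store.{u} T G} {w : T → Prop} {m : G → Move} {t : T}

theorem Store.act_tp_eq (h : w t ↔ σ.rd grp t) : (σ.act grp w m).tp t = σ.tp t := by
  ext ξ
  by_cases hξ : ξ = σ.hd (grp t)
  · subst hξ
    simp only [act, Set.mem_ofPred_eq, h, rd]
    tauto
  · simp [act, hξ]

theorem Store.act_tp_or {P : Prop} (h : w t ↔ σ.rd grp t ∨ P) :
    (σ.act grp w m).tp t = {ξ | ξ ∈ σ.tp t ∨ ξ = σ.hd (grp t) ∧ P} := by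
  ext ξ
  by_cases hξ : ξ = σ.hd (grp t)
  · subst hξ
    simp only [act, Set.mem_ofPred_eq, h, rd]
    tauto
  · simp [act, hξ]

theorem Store.act_tp_false (h : ¬ w t) : (σ.act grp w m).tp t = σ.tp t \ {σ.hd (grp t)} := by
  ext ξ
  simp only [act, Set.mem_ofPred_eq, h, and_false, false_or, Set.mem_sdiff, Set.mem_singleton_iff]
  tauto

theorem Store.below_act (hw : ∀ t, σ.rd grp t → w t) (hm : ∀ g, m g ≠ .left) :
    σ.Below (σ.act grp w m) := by
  refine ⟨fun g => ?_, fun t ξ hξ => ?_⟩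
  · have := hm g
    simp only [act]
    cases h : m g with
    | stay => exact le_rfl
    | right => exact (lt_add_one _).le
    | left => exact absurd h this
  · by_cases h : ξ = σ.hd (grp t)
    · subst h
      exact .inl ⟨rfl, hw t hξ⟩
    · exact .inr ⟨h, hξ⟩

/-- Move a head. -/
def Store.setHd [DecidableEq G] (σ : Store.{u} T G) (g : G) (x : Ordinal.{u}) : Store.{u} T G :=
  { σ with hd := Function.update σ.hd g x }

variable {L σ₁ σ' : Store.{u} T G} {b : (T → Prop) → Prop} {c : Cmd T G}

theorem Exec.loop_done (hL : L.Below σ) (hb : ¬ b (σ.rd grp)) :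
    Exec grp (.loop b c) L σ σ :=
  Exec.loop (fun _ => σ) 0 (fun _ h => absurd h not_lt_zero) hb
    (fun _ h => absurd h not_lt_zero)
    (fun _ ho hl => absurd (le_antisymm ho zero_le) hl.ne_bot) fun _ _ => hL

theorem Exec.loop_step (hL : L.Below σ) (hb : b (σ.rd grp)) (h : Exec grp c L σ σ₁)
    (h' : Exec grp (.loop b c) L σ₁ σ') : Exec grp (.loop b c) L σ σ' := by
  intro p e base exit hc
  obtain ⟨t, ht, r, i⟩ := exec_step (grp := grp) (p := p) (e := e) (exit := base) (σ' := σ₁)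
    (size := (Cmd.loop b c).size) (base := base) hL
    (Cmd.size_pos _) (Nat.le_add_right base 1) (size' := c.size) (by rw [Cmd.size]; omega)
    (by rw [hc base le_rfl (by rw [Cmd.size]; omega), Cmd.instr, if_pos rfl,
      if_pos hb, Store.act_stay])
    (h p e (base + 1) base fun s hs hs' τ => by
      rw [hc s (by omega) (by rw [Cmd.size]; omega) τ, Cmd.instr, if_neg (by omega)])
  obtain ⟨t', -, r', i'⟩ := h' p e base exit hc
  exact ⟨t + t', ht.trans_le le_self_add, run_comp (A := fun C => ∃ q ρ, C = conf grp e q ρ ∧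
    base ≤ q ∧ q < base + (Cmd.loop b c).size ∧ L.Below ρ) r i r' i'⟩

/-- The rule for loops with a single instruction as body. -/
theorem Exec.loop_act {f : (T → Prop) → T → Prop} {m : (T → Prop) → G → Move}
    (K : Ordinal.{u} → Store.{u} T G) (θ : Ordinal.{u})
    (hb : ∀ i < θ, b ((K i).rd grp)) (hθ : ¬ b ((K θ).rd grp))
    (hK : ∀ i < θ, (K i).act grp (f ((K i).rd grp)) (m ((K i).rd grp)) = K (i + 1))
    (hlim : ∀ o ≤ θ, IsSuccLimit o → StoreLim K o) (hL : ∀ i ≤ θ, L.Below (K i)) :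
    Exec grp (.loop b (.act f m)) L (K 0) (K θ) :=
  Exec.loop K θ hb hθ (fun i hi => .act f m (.refl _) (hK i hi)) hlim hL

theorem StoreLim.congr {K N : Ordinal.{u} → Store.{u} T G} {o : Ordinal.{u}}
    (h : ∀ j ≤ o, K j = N j) (hN : StoreLim N o) : StoreLim K o := by
  refine ⟨fun g => ⟨fun a ha => ?_, fun i hi => ?_⟩, fun t ξ => ⟨fun hξ => ?_, fun hξ i hi => ?_⟩⟩
  · rw [h o le_rfl] at ha
    obtain ⟨i, hi, h'⟩ := (hN.1 g).1 a ha
    exact ⟨i, hi, fun j hj hjo => by simpa only [h j hjo.le] using h' j hj hjo⟩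
  · obtain ⟨j, hj, hjo, h'⟩ := (hN.1 g).2 i hi
    exact ⟨j, hj, hjo, by simpa only [h j hjo.le, h o le_rfl] using h'⟩
  · rw [h o le_rfl] at hξ
    obtain ⟨i, hi, h'⟩ := (hN.2 t ξ).1 hξ
    exact ⟨i, hi, fun j hj hjo => by simpa only [h j hjo.le] using h' j hj hjo⟩
  · rw [h o le_rfl] at hξ
    obtain ⟨j, hj, hjo, h'⟩ := (hN.2 t ξ).2 hξ i hi
    exact ⟨j, hj, hjo, by simpa only [h j hjo.le] using h'⟩

end Act

theorem Move.apply_left_lt {x : Ordinal.{u}} (h : x ≠ 0) : Move.left.apply x < x := by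
  rw [Move.apply]
  split_ifs with hl
  · exact pos_iff_ne_zero.2 h
  · exact Ordinal.pred_lt_iff_not_isSuccPrelimit.2 hl

theorem Move.apply_left_add_one (x : Ordinal.{u}) : Move.left.apply (x + 1) = x := by
  rw [Move.apply, if_neg]
  · exact Ordinal.pred_add_one x
  · intro h
    exact Order.not_isSuccPrelimit_succ x h

/-- Move the head of the group `g` to cell `0`, the only one marked on the tape `z g`. -/
def reset (g : Grp) : Com :=
  .loop (fun r => ¬ r (.inr (.z g)))
    (.act (fun r => r) fun _ g' => if g' = g then .left else .stay)

theorem setHd_self (σ : St.{u}) (g : Grp) : σ.setHd g (σ.hd g) = σ := by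
  simp [Store.setHd]

/-- A left move strictly decreases the position, and from a limit cell it leads to `0` at once. So
the loop is handled by well-founded induction on the position, without limit stages. -/
theorem ex_reset {σ L : St.{u}} {g : Grp} (hz : σ.tp (.inr (.z g)) = {0})
    (hL : L.Below (σ.setHd g 0)) : Ex (reset g) L σ (σ.setHd g 0) := by
  suffices H : ∀ x, Ex (reset g) (σ.setHd g 0) (σ.setHd g x) (σ.setHd g 0) by
    have := H (σ.hd g)
    rw [setHd_self] at this
    exact Exec.mono this hL
  intro x
  induction x using WellFoundedLT.induction with
  | ind x ih =>
    have hrd : (σ.setHd g x).rd tapeGrp (.inr (.z g)) ↔ x = 0 := by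
      simp [Store.rd, Store.setHd, tapeGrp, hz]
    have hB : (σ.setHd g 0).Below (σ.setHd g x) := by
      refine ⟨fun g' => ?_, fun _ => subset_rfl⟩
      by_cases h : g' = g
      · subst h; simp [Store.setHd]
      · simp [Store.setHd, h]
    by_cases hx : x = 0
    · subst hx
      exact Exec.loop_done (.refl _) (not_not.2 (hrd.2 rfl))
    · refine Exec.loop_step (σ₁ := σ.setHd g (Move.left.apply x)) hB (mt hrd.1 hx)
        (.act _ _ hB ?_) (ih _ (Move.apply_left_lt hx))
      ext g'
      · by_cases h : g' = g
        · subst h; simp [Store.setHd, Store.act]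
        · simp [Store.setHd, Store.act, h, Move.apply]
      · rw [Store.act_tp_eq Iff.rfl]
        rfl

/-! ### Reading the inputs -/

/-- Copy the bits of a low-level code from the tape `src` to the tape `db`. -/
def copyBits (src db : Tp) : Com :=
  .loop (fun r => ¬ r src) <| .seq
    (.act (fun r => r) fun _ g => if g = tapeGrp src then .right else .stay)
    (.act (fun r t => if t = db then r src else r t)
      fun _ g => if g = tapeGrp src ∨ g = tapeGrp db then .right else .stay)

/-- The store after `copyBits src db` has copied `x` bits. -/
def copied (σ : St.{u}) (src db : Tp) (x : Ordinal.{u}) : St.{u} where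
  hd := Function.update (Function.update σ.hd (tapeGrp db) x) (tapeGrp src) (2 * x)
  tp := Function.update σ.tp db {ξ | ξ < x ∧ 2 * ξ + 1 ∈ σ.tp src}

theorem two_mul_add_one' (x : Ordinal.{u}) : 2 * (x + 1) = 2 * x + 1 + 1 := by
  rw [mul_add, mul_one, add_assoc, one_add_one_eq_two]

/-- Data bits sit in the odd cells of the low-level code, and the even cells before the terminator
are `0`. So the loop tests the even cells and copies the odd ones until the first even cell with a
one. -/
theorem ex_copyBits {σ L : St.{u}} {src db : Tp} (hg : tapeGrp src ≠ tapeGrp db)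
    (hs : σ.hd (tapeGrp src) = 0) (hd : σ.hd (tapeGrp db) = 0) (hb : σ.tp db = ∅)
    {n : Ordinal.{u}} (hn : 2 * n ∈ σ.tp src) (hlt : ∀ x < n, 2 * x ∉ σ.tp src)
    (hL : L.Below σ) : Ex (copyBits src db) L σ (copied σ src db n) := by
  have hne : src ≠ db := fun h => hg (congrArg _ h)
  have h0 : copied σ src db 0 = σ := by
    refine Store.ext (funext fun g => ?_) (funext fun t => ?_)
    · by_cases h : g = tapeGrp src
      · subst h; simp [copied, hs]
      · by_cases h' : g = tapeGrp db
        · subst h'; simp [copied, hd, h]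
        · simp [copied, h, h']
    · by_cases h : t = db
      · subst h; simp [copied, hb]
      · simp [copied, h]
  have hσ : ∀ x, σ.Below (copied σ src db x) := by
    refine fun x => ⟨fun g => ?_, fun t => ?_⟩
    · by_cases h : g = tapeGrp src
      · subst h; simp [hs]
      · by_cases h' : g = tapeGrp db
        · subst h'; simp [hd]
        · simp [copied, h, h']
    · by_cases h : t = db
      · subst h; simp [hb]
      · simp [copied, h]
  have hrd : ∀ x, (copied σ src db x).rd tapeGrp src ↔ 2 * x ∈ σ.tp src := by
    intro x
    simp [Store.rd, copied, hne]
  have := Exec.loop (b := fun r => ¬ r src) (L := L) (grp := tapeGrp) (c := .seq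
    (.act (fun r => r) fun _ g => if g = tapeGrp src then .right else .stay)
    (.act (fun r t => if t = db then r src else r t)
      fun _ g => if g = tapeGrp src ∨ g = tapeGrp db then .right else .stay))
    (copied σ src db) n (fun i hi => mt (hrd i).1 (hlt i hi)) (not_not.2 ((hrd n).2 hn))
    (fun i hi => ?_) (fun o ho hl => ⟨fun g => ?_, fun t => ?_⟩)
    (fun i _ => hL.trans (hσ i))
  · rw [h0] at this
    exact this
  · refine Exec.seq (.act _ _ (.refl _) rfl) (.act _ _ (Store.below_act (fun _ h => h) fun g => ?_) ?_)
    · split_ifs <;> simp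
    · have e₁ : ∀ t, ((copied σ src db i).act tapeGrp ((copied σ src db i).rd tapeGrp)
          fun g => if g = tapeGrp src then .right else .stay).tp t = (copied σ src db i).tp t :=
        fun t => Store.act_tp_eq Iff.rfl
      refine Store.ext (funext fun g => ?_) (funext fun t => ?_)
      · by_cases h : g = tapeGrp src
        · subst h
          simp [copied, Store.act, Move.apply, two_mul_add_one']
        · by_cases h' : g = tapeGrp db
          · subst h'
            simp [copied, Store.act, h, Move.apply]
          · simp [copied, Store.act, h, h', Move.apply]
      · by_cases h : t = db
        · subst h
          rw [Store.act_tp_or (P := 2 * i + 1 ∈ σ.tp src), e₁]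
          · ext ξ
            simp only [copied, Store.act, hg.symm, Move.apply, Function.update_self, ne_eq,
              not_false_eq_true, Function.update_of_ne, if_false, Set.mem_ofPred_eq,
              Order.lt_add_one_iff, le_iff_lt_or_eq]
            constructor
            · rintro (h | ⟨rfl, h⟩)
              · exact ⟨.inl h.1, h.2⟩
              · exact ⟨.inr rfl, h⟩
            · rintro ⟨h | rfl, h'⟩
              · exact .inl ⟨h, h'⟩
              · exact .inr ⟨rfl, h'⟩
          · simp only [if_true, Store.rd, e₁]
            simp [copied, Store.act, hg.symm, hne, Move.apply]
        · rw [Store.act_tp_eq, e₁]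
          · simp [copied, h]
          · simp [h]
  · by_cases h : g = tapeGrp src
    · subst h
      simpa [copied] using HeadLim.of_isNormal (mul_isNormal (a := 2) (by simp)) hl
    · by_cases h' : g = tapeGrp db
      · subst h'
        simpa [copied, h] using! HeadLim.of_isNormal IsNormal.id hl
      · simpa [copied, h, h'] using HeadLim.const hl _
  · by_cases h : t = db
    · subst h
      simp only [copied, Function.update_self]
      refine .of_mono hl (fun j hj ξ hξ => ⟨hξ.1.trans hj, hξ.2⟩) fun ξ hξ => ?_
      exact ⟨ξ + 1, hl.add_one_lt hξ.1, fun j hj _ => ⟨Order.add_one_le_iff.1 hj, hξ.2⟩⟩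
    · simpa [copied, h] using TapeLim.const hl _

/-! ### The bit pattern of low-level codes. -/

namespace OrdPair

variable (a : OrdPair.{u})

theorem lt_bound {a : OrdPair.{u}} {γ : Ordinal.{u}} (h : γ ∈ a.2.1) : γ < a.2.bound := by
  rw [OrdSet.bound, ← succ_le_iff]
  refine le_csSup ?_ ⟨γ, h, rfl⟩
  obtain ⟨b, hb⟩ := a.2.2
  exact ⟨succ b, by rintro _ ⟨x, hx, rfl⟩; exact succ_le_succ (hb hx)⟩

theorem bound_le {X : OrdSet.{u}} {b : Ordinal.{u}} (h : ∀ γ ∈ X.1, γ < b) : X.bound ≤ b := by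
  rw [OrdSet.bound]
  refine csSup_le' ?_
  rintro _ ⟨x, hx, rfl⟩
  exact succ_le_of_lt (h x hx)

theorem two_mul_add_two (b : Ordinal.{u}) : 2 * b + 2 = 2 * (b + 1) := by
  rw [mul_add, mul_one]

theorem two_mul_add_three (b : Ordinal.{u}) : 2 * b + 3 = 2 * (b + 1) + 1 := by
  rw [← two_mul_add_two, add_assoc, two_add_one_eq_three]

theorem mem_ones {ξ : Ordinal.{u}} : ξ ∈ a.ones ↔ (∃ γ ∈ a.2.1, ξ = 2 * γ + 1) ∨
    ξ = 2 * a.2.bound + 1 ∨ ξ = 2 * a.2.bound + 2 ∨ ξ = 2 * a.2.bound + 3 + a.1 := Iff.rfl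

theorem even_mem_ones : 2 * (a.2.bound + 1) ∈ a.ones :=
  a.mem_ones.2 (.inr (.inr (.inl (two_mul_add_two _).symm)))

theorem two_mul_ne (x y : Ordinal.{u}) : 2 * x ≠ 2 * y + 1 := by
  intro h
  rw [← add_zero (2 * x), mul_add_inj (by simp) (by exact_mod_cast one_lt_two)] at h
  exact zero_ne_one h.2

theorem two_mul_add_one_inj {x y : Ordinal.{u}} : 2 * x + 1 = 2 * y + 1 ↔ x = y := by
  rw [mul_add_inj (by exact_mod_cast one_lt_two) (by exact_mod_cast one_lt_two)]
  simp

theorem two_mul_lt {x y : Ordinal.{u}} : 2 * x < 2 * y ↔ x < y :=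
  (mul_isNormal (by simp)).strictMono.lt_iff_lt

/-- Together with `even_mem_ones`: the first even cell that contains a one is number `2 * (bound +
1)`, the second one of the block `011`. This is how machines recognise the end of the data bits. -/
theorem even_notMem_ones {x : Ordinal.{u}} (h : x < a.2.bound + 1) : 2 * x ∉ a.ones := by
  rw [mem_ones]
  rintro (⟨γ, -, h'⟩ | h' | h' | h')
  · exact two_mul_ne _ _ h'
  · exact two_mul_ne _ _ h'
  · rw [two_mul_add_two] at h'
    exact (two_mul_lt.2 h).ne h'
  · rw [two_mul_add_three] at h'
    have := two_mul_lt.2 h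
    rw [h'] at this
    exact absurd this (not_lt.2 (le_self_add.trans le_self_add))

theorem odd_mem_ones {x : Ordinal.{u}} (h : x < a.2.bound) : 2 * x + 1 ∈ a.ones ↔ x ∈ a.2.1 := by
  rw [mem_ones]
  constructor
  · rintro (⟨γ, hγ, h'⟩ | h' | h' | h')
    · rwa [two_mul_add_one_inj.1 h']
    · exact absurd (two_mul_add_one_inj.1 h') h.ne
    · rw [two_mul_add_two] at h'
      exact absurd h'.symm (two_mul_ne _ _)
    · have := two_mul_lt.2 (h.trans (lt_add_one _))
      have h₂ : 2 * (a.2.bound + 1) + 1 ≤ 2 * x + 1 := by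
        rw [h', two_mul_add_three]
        exact le_self_add
      exact absurd this (not_lt.2 (Order.succ_le_succ_iff.1 h₂))
  · exact fun h => .inl ⟨x, h, rfl⟩

/-- After the block `011` the next one is the final one, so the number of zeros before it is the
ordinal component. -/
theorem tail_mem_ones {x : Ordinal.{u}} : 2 * a.2.bound + 3 + x ∈ a.ones ↔ x = a.1 := by
  rw [mem_ones]
  constructor
  · have key : ∀ y, 2 * a.2.bound + 3 + x = y → 2 * a.2.bound + 3 ≤ y := by
      rintro y rfl
      exact le_self_add
    rintro (⟨γ, hγ, h'⟩ | h' | h' | h')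
    · have := key _ h'
      rw [two_mul_add_three] at this
      exact absurd (two_mul_lt.2 ((lt_bound hγ).trans (lt_add_one _)))
        (not_lt.2 (Order.succ_le_succ_iff.1 this))
    · have := key _ h'
      exact absurd ((add_le_add_iff_left _).1 this) (by norm_num)
    · have := key _ h'
      exact absurd ((add_le_add_iff_left _).1 this) (by norm_num)
    · exact add_left_cancel h'
  · rintro rfl
    exact .inr (.inr (.inr rfl))

end OrdPair

/-- The store with the tape `t` replaced. -/
def Store.setTp {T G : Type} [DecidableEq T] (σ : Store.{u} T G) (t : T) (A : Set Ordinal.{u}) :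
    Store.{u} T G :=
  { σ with tp := Function.update σ.tp t A }

/-- Decode the set of ordinals on the tape `src`: its elements are marked on the tape `db`, the bound
on the tape `de`. -/
def decodeSet (src db de : Tp) : Com :=
  .seq (copyBits src db) <| .seq
    (.act (fun r => r) fun _ g => if g = tapeGrp db then .left else .stay)
    (.act (fun r t => if t = db then False else if t = de then True else r t)
      fun _ g => if g = tapeGrp src then .right else .stay)

/-- `copyBits` runs one bit too far: the first one of the terminator `011` lies in the odd cell `2 *
bound + 1` and is copied to position `bound`. One step back, that spurious bit is erased and the
position is recorded as the bound, while the head on `src` moves on to the block of zeros. -/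
theorem ex_decodeSet {σ : St.{u}} {src db de : Tp} {a : OrdPair.{u}}
    (hg : tapeGrp src ≠ tapeGrp db) (hde : tapeGrp de = tapeGrp db) (hne : db ≠ de)
    (hs : σ.hd (tapeGrp src) = 0) (hd : σ.hd (tapeGrp db) = 0) (hb : σ.tp db = ∅)
    (he : σ.tp de = ∅) (ha : σ.tp src = a.ones) :
    Ex (decodeSet src db de) .bot σ (((((σ.setHd (tapeGrp db) a.2.bound).setHd (tapeGrp src)
      (2 * a.2.bound + 3))).setTp db a.2.1).setTp de {a.2.bound}) := by
  refine Exec.seq (ex_copyBits hg hs hd hb (n := a.2.bound + 1) (by rw [ha]; exact a.even_mem_ones)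
    (fun x hx => by rw [ha]; exact a.even_notMem_ones hx) (Store.bot_below _)) ?_
  refine Exec.seq (.act _ _ (Store.bot_below _) rfl) (.act _ _ (Store.bot_below _) ?_)
  have e₁ : ∀ t, ((copied σ src db (a.2.bound + 1)).act tapeGrp
      ((copied σ src db (a.2.bound + 1)).rd tapeGrp)
      fun g => if g = tapeGrp db then .left else .stay).tp t =
        (copied σ src db (a.2.bound + 1)).tp t := fun t => Store.act_tp_eq Iff.rfl
  have hsb : src ≠ db := fun h => hg (congrArg _ h)
  refine Store.ext (funext fun g => ?_) (funext fun t => ?_)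
  · by_cases h : g = tapeGrp src
    · subst h
      simp only [Store.act, copied, if_true, Function.update_self, hg, if_false, Store.setHd,
        Store.setTp]
      simp only [Move.apply]
      rw [← OrdPair.two_mul_add_two, add_assoc, two_add_one_eq_three]
    · by_cases h' : g = tapeGrp db
      · subst h'
        simp only [Store.act, copied, if_true, Function.update_self, Function.update_of_ne h,
          hg.symm, if_false, Store.setHd, Store.setTp, Move.apply_left_add_one]
        rfl
      · simp [Store.act, copied, h, h', Store.setHd, Store.setTp, Move.apply]
  · by_cases h : t = db
    · subst h
      rw [Store.act_tp_false (by simp), e₁]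
      simp only [copied, Function.update_self, Store.setHd, Store.setTp, Function.update_of_ne hne,
        ha, Store.act, Function.update_of_ne hg.symm, if_true, Move.apply_left_add_one]
      ext ξ
      simp only [Set.mem_sdiff, Set.mem_ofPred_eq, Order.lt_add_one_iff, Set.mem_singleton_iff]
      constructor
      · rintro ⟨⟨h₁, h₂⟩, h₃⟩
        exact (a.odd_mem_ones (lt_of_le_of_ne h₁ h₃)).1 h₂
      · intro hξ
        have := OrdPair.lt_bound hξ
        exact ⟨⟨this.le, (a.odd_mem_ones this).2 hξ⟩, this.ne⟩
    · by_cases h' : t = de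
      · subst h'
        rw [Store.act_tp_or (P := True) (by simp [h]), e₁]
        simp [copied, Store.setHd, Store.setTp, h, Store.act, hde, hg.symm, he,
          Move.apply_left_add_one]
      · rw [Store.act_tp_eq (by simp [h, h']), e₁]
        simp [copied, Store.setHd, Store.setTp, h, h']

/-- Decode the ordinal component of a pair on the tape `src`, marking it on the tape `t`. -/
def decodeOrd (src t : Tp) : Com :=
  .seq
    (.loop (fun r => ¬ r src) (.act (fun r => r)
      fun _ g => if g = tapeGrp src ∨ g = tapeGrp t then .right else .stay))
    (.act (fun r t' => if t' = t then True else r t') fun _ _ => .stay)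

theorem ex_decodeOrd {σ : St.{u}} {src t : Tp} {a : OrdPair.{u}}
    (hg : tapeGrp src ≠ tapeGrp t) (hs : σ.hd (tapeGrp src) = 2 * a.2.bound + 3)
    (hd : σ.hd (tapeGrp t) = 0) (ht : σ.tp t = ∅) (ha : σ.tp src = a.ones) :
    Ex (decodeOrd src t) .bot σ (((σ.setHd (tapeGrp t) a.1).setHd (tapeGrp src)
      (2 * a.2.bound + 3 + a.1)).setTp t {a.1}) := by
  have hl := Exec.loop_act (grp := tapeGrp) (b := fun r => ¬ r src) (L := .bot) (f := fun r => r)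
    (m := fun _ g => if g = tapeGrp src ∨ g = tapeGrp t then .right else .stay)
    (fun x => (σ.setHd (tapeGrp t) x).setHd (tapeGrp src) (2 * a.2.bound + 3 + x)) a.1
    (fun i hi => by
      simp only [Store.rd, Store.setHd, Function.update_self, ha]
      rw [OrdPair.tail_mem_ones]
      exact hi.ne)
    (by
      simp only [Store.rd, Store.setHd, Function.update_self, ha]
      rw [OrdPair.tail_mem_ones]
      exact not_not.2 rfl)
    (fun i _ => by
      refine Store.ext (funext fun g => ?_) (funext fun t' => ?_)
      · by_cases h : g = tapeGrp src
        · subst h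
          simp [Store.act, Store.setHd, Move.apply, add_assoc]
        · by_cases h' : g = tapeGrp t
          · subst h'
            simp [Store.act, Store.setHd, Move.apply, h]
          · simp [Store.act, Store.setHd, Move.apply, h, h']
      · exact Store.act_tp_eq Iff.rfl)
    (fun o _ hl => ⟨fun g => by
      by_cases h : g = tapeGrp src
      · subst h
        simpa [Store.setHd] using HeadLim.of_isNormal (add_isNormal _) hl
      · by_cases h' : g = tapeGrp t
        · subst h'
          simpa [Store.setHd, h] using! HeadLim.of_isNormal IsNormal.id hl
        · simpa [Store.setHd, h, h'] using HeadLim.const hl _, fun t' => TapeLim.const hl _⟩)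
    (fun i _ => Store.bot_below _)
  have h0 : (σ.setHd (tapeGrp t) 0).setHd (tapeGrp src) (2 * a.2.bound + 3 + 0) = σ := by
    rw [add_zero, ← hs, ← hd, setHd_self, setHd_self]
  rw [h0] at hl
  refine Exec.seq hl (.act _ _ (Store.bot_below _) ?_)
  refine Store.ext (funext fun g => rfl) (funext fun t' => ?_)
  by_cases h : t' = t
  · subst h
    rw [Store.act_tp_or (P := True) (by simp)]
    simp [Store.setHd, Store.setTp, ht, hg.symm]
  · rw [Store.act_tp_eq (by simp [h])]
    simp [Store.setHd, Store.setTp, h]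

/-- Read the code on the tape `src`. -/
def readCode (src : Tp) (k : Bool) : Com :=
  .seq (decodeSet src (.inr (.qb k)) (.inr (.qe k))) <| .seq (decodeOrd src (.inr (.rho k))) <|
    .seq (reset .q) <| .seq (reset .h1) (reset (tapeGrp src))

theorem setHd_of_eq {σ : St.{u}} {g : Grp} {x : Ordinal.{u}} (h : σ.hd g = x) :
    σ.setHd g x = σ := by
  rw [← h, setHd_self]

theorem ex_readCode {σ : St.{u}} {src : Tp} {k : Bool} {a : OrdPair.{u}}
    (hq : tapeGrp src ≠ .q) (hh : tapeGrp src ≠ .h1)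
    (hz : ∀ g, σ.tp (.inr (.z g)) = {0}) (hs : σ.hd (tapeGrp src) = 0) (hdq : σ.hd .q = 0)
    (hd1 : σ.hd .h1 = 0) (hb : σ.tp (.inr (.qb k)) = ∅) (he : σ.tp (.inr (.qe k)) = ∅)
    (hr : σ.tp (.inr (.rho k)) = ∅) (ha : σ.tp src = a.ones) :
    Ex (readCode src k) .bot σ (((σ.setTp (.inr (.qb k)) a.2.1).setTp (.inr (.qe k))
      {a.2.bound}).setTp (.inr (.rho k)) {a.1}) := by
  have n₁ : src ≠ .inr (.qb k) := by rintro rfl; exact hq rfl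
  have n₂ : src ≠ .inr (.qe k) := by rintro rfl; exact hq rfl
  refine Exec.seq (ex_decodeSet (a := a) hq rfl (by simp) hs hdq hb he ha) ?_
  refine Exec.seq (ex_decodeOrd (a := a) hh ?_ ?_ ?_ ?_) ?_
  · simp [Store.setTp, Store.setHd]
  · simp [Store.setTp, Store.setHd, hh.symm, hd1]
  · simp [Store.setTp, Store.setHd, hr]
  · simp [Store.setTp, Store.setHd, n₁, n₂, ha]
  refine Exec.seq (ex_reset (by simp [Store.setTp, Store.setHd, hz]) (Store.bot_below _)) ?_
  refine Exec.seq (ex_reset (by simp [Store.setTp, Store.setHd, hz]) (Store.bot_below _)) ?_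
  refine cast (congrArg _ ?_) (ex_reset (g := tapeGrp src)
    (by simp [Store.setTp, Store.setHd, hz]) (Store.bot_below _))
  refine Store.ext (funext fun g => ?_) rfl
  by_cases h : g = tapeGrp src
  · subst h; simp [Store.setTp, Store.setHd, hs]
  · by_cases h' : g = .h1
    · subst h'; simp [Store.setTp, Store.setHd, h, hd1]
    · by_cases h'' : g = .q
      · subst h''; simp [Store.setTp, Store.setHd, h, hdq]
      · simp [Store.setTp, Store.setHd, h, h', h'']

/-- Read the ordinal on the third input tape. -/
def readOrd : Com :=
  .seq (decodeSet (.inl 3) (.inr .jk) (.inr .r)) <| .seq (reset .h1) (reset .in3)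

/-- An ordinal is presented as the set of its predecessors, whose bound is the ordinal itself. So
the marker left by `decodeSet` is the ordinal. -/
theorem bound_Iio (ξ : Ordinal.{u}) : (ordPair ξ).2.bound = ξ := by
  apply le_antisymm
  · exact OrdPair.bound_le fun γ h => h
  · by_contra! h
    exact lt_irrefl _ (OrdPair.lt_bound (a := ordPair ξ) (γ := (ordPair ξ).2.bound) h)

theorem ex_readOrd {σ : St.{u}} {ξ : Ordinal.{u}}
    (hz : ∀ g, σ.tp (.inr (.z g)) = {0}) (hs : σ.hd .in3 = 0) (hd1 : σ.hd .h1 = 0)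
    (hb : σ.tp (.inr .jk) = ∅) (hr : σ.tp (.inr .r) = ∅) (ha : σ.tp (.inl 3) = (ordPair ξ).ones) :
    Ex readOrd .bot σ ((σ.setTp (.inr .jk) (Set.Iio ξ)).setTp (.inr .r) {ξ}) := by
  refine Exec.seq (ex_decodeSet (a := ordPair ξ) (by simp [tapeGrp]) rfl (by simp) hs hd1 hb hr ha)
    ?_
  refine Exec.seq (ex_reset (by simp [Store.setTp, Store.setHd, hz]) (Store.bot_below _)) ?_
  refine cast (congrArg _ ?_) (ex_reset (g := .in3)
    (by simp [Store.setTp, Store.setHd, hz]) (Store.bot_below _))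
  refine Store.ext (funext fun g => ?_) ?_
  · by_cases h : g = .in3
    · subst h; simp [Store.setTp, Store.setHd, hs]
    · by_cases h' : g = .h1
      · subst h'; simp [Store.setTp, Store.setHd, hd1]
      · simp [Store.setTp, Store.setHd, h, h', tapeGrp]
  · rw [bound_Iio]
    rfl

/-! ### The script -/

theorem Store.act_move {T G : Type} {grp : T → G} (σ : Store.{u} T G) (m : G → Move) :
    σ.act grp (σ.rd grp) m = ⟨fun g => (m g).apply (σ.hd g), σ.tp⟩ :=
  Store.ext rfl (funext fun _ => Store.act_tp_eq Iff.rfl)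

/-- Split the bits on the parameter tape into two tapes. -/
def readScript : Com :=
  .seq
    (.loop (fun r => ¬ r (.inl 0)) <| .seq
      (.act (fun r => r) fun _ g => if g = .par then .right else .stay) <| .seq
      (.act (fun r t => if t = .inr .mark then r (.inl 0) else r t)
        fun _ g => if g = .par then .right else .stay) <| .seq
      (.act (fun r => r) fun _ g => if g = .par then .right else .stay)
      (.act (fun r t => if t = .inr .bit then r (.inl 0) else r t)
        fun _ g => if g = .par ∨ g = .sc then .right else .stay)) <|
  .seq (reset .sc) (reset .par)

/-- The two script tapes are interleaved in the parameter, whose low-level code in turn alternates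
test cells with data cells. So every script cell takes four cells of the parameter tape: data in `4
* ξ + 1` and `4 * ξ + 3`, the loop test in `4 * ξ`. -/
theorem ex_readScript {σ : St.{u}} (hz : ∀ g, σ.tp (.inr (.z g)) = {0}) (hp : σ.hd .par = 0)
    (hs : σ.hd .sc = 0) (hm : σ.tp (.inr .mark) = ∅) (hb : σ.tp (.inr .bit) = ∅)
    {n : Ordinal.{u}} (hn : 4 * n ∈ σ.tp (.inl 0)) (hlt : ∀ x < n, 4 * x ∉ σ.tp (.inl 0)) :
    Ex readScript .bot σ ((σ.setTp (.inr .mark) {ξ | ξ < n ∧ 4 * ξ + 1 ∈ σ.tp (.inl 0)}).setTp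
      (.inr .bit) {ξ | ξ < n ∧ 4 * ξ + 3 ∈ σ.tp (.inl 0)}) := by
  let K : Ordinal.{u} → St.{u} := fun x => (((σ.setHd .par (4 * x)).setHd .sc x).setTp (.inr .mark)
    {ξ | ξ < x ∧ 4 * ξ + 1 ∈ σ.tp (.inl 0)}).setTp
      (.inr .bit) {ξ | ξ < x ∧ 4 * ξ + 3 ∈ σ.tp (.inl 0)}
  have h0 : K 0 = σ := by
    refine Store.ext (funext fun g => ?_) (funext fun t => ?_)
    · by_cases h : g = .sc
      · subst h; simp [K, Store.setHd, Store.setTp, hs]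
      · by_cases h' : g = .par
        · subst h'; simp [K, Store.setHd, Store.setTp, hp]
        · simp [K, Store.setHd, Store.setTp, h, h']
    · by_cases h : t = .inr .bit
      · subst h; simp [K, Store.setHd, Store.setTp, hb]
      · by_cases h' : t = .inr .mark
        · subst h'; simp [K, Store.setHd, Store.setTp, hm]
        · simp [K, Store.setHd, Store.setTp, h, h']
  have hrd : ∀ x, (K x).rd tapeGrp (.inl 0) ↔ 4 * x ∈ σ.tp (.inl 0) := by
    intro x
    simp [K, Store.rd, Store.setHd, Store.setTp]
  have e4 : ∀ x : Ordinal.{u}, 4 * (x + 1) = 4 * x + 1 + 1 + 1 + 1 := by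
    intro x
    rw [mul_add, mul_one, add_assoc, add_assoc, add_assoc]
    norm_num
  have e3 : ∀ x : Ordinal.{u}, 4 * x + 1 + 1 + 1 = 4 * x + 3 := by
    intro x
    rw [add_assoc, add_assoc]
    norm_num
  have hgr : ∀ (p q : Grp → Prop) [DecidablePred p], ∀ g,
      (if p g then Move.right else Move.stay) ≠ .left := by
    intro p _ _ g
    split_ifs <;> simp
  refine Exec.seq (σ₁ := K n) ?_ ?_
  · rw [← h0]
    refine Exec.loop K n (fun i hi => mt (hrd i).1 (hlt i hi)) (not_not.2 ((hrd n).2 hn))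
      (fun i hi => ?_) (fun o _ hl => ⟨fun g => ?_, fun t => ?_⟩) (fun _ _ => Store.bot_below _)
    · refine .seq (σ₁ := (K i).setHd .par (4 * i + 1)) (.act _ _ (.refl _) ?_) <|
        .seq (σ₁ := ((K i).setHd .par (4 * i + 1 + 1)).setTp (.inr .mark)
          {ξ | ξ < i + 1 ∧ 4 * ξ + 1 ∈ σ.tp (.inl 0)}) (.act _ _ ?_ ?_) <|
        .seq (σ₁ := ((K i).setHd .par (4 * i + 1 + 1 + 1)).setTp (.inr .mark)
          {ξ | ξ < i + 1 ∧ 4 * ξ + 1 ∈ σ.tp (.inl 0)}) (.act _ _ ?_ ?_) <|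
        .act _ _ ?_ ?_
      · rw [Store.act_move]
        refine Store.ext (funext fun g => ?_) rfl
        by_cases h : g = .par
        · subst h; simp [K, Store.setHd, Store.setTp, Move.apply]
        · simp [K, Store.setHd, Store.setTp, Move.apply, h]
      · refine ⟨fun g => ?_, fun t => subset_rfl⟩
        by_cases h : g = .par
        · subst h; simp [K, Store.setHd, Store.setTp]
        · simp [K, Store.setHd, Store.setTp, h]
      · refine Store.ext (funext fun g => ?_) (funext fun t => ?_)
        · by_cases h : g = .par
          · subst h; simp [K, Store.setHd, Store.setTp, Move.apply, Store.act]
          · simp [K, Store.setHd, Store.setTp, Move.apply, h, Store.act]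
        · by_cases h : t = .inr .mark
          · subst h
            rw [Store.act_tp_or (P := 4 * i + 1 ∈ σ.tp (.inl 0))]
            · ext ξ
              simp [K, Store.setHd, Store.setTp, le_iff_lt_or_eq]
              constructor
              · rintro (h | ⟨rfl, h⟩)
                · exact ⟨.inl h.1, h.2⟩
                · exact ⟨.inr rfl, h⟩
              · rintro ⟨h | rfl, h'⟩
                · exact .inl ⟨h, h'⟩
                · exact .inr ⟨rfl, h'⟩
            · simp [K, Store.setHd, Store.setTp, Store.rd]
          · rw [Store.act_tp_eq (by simp [h])]
            simp [K, Store.setHd, Store.setTp, h]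
      · refine ⟨fun g => ?_, fun t => ?_⟩
        · by_cases h : g = .par
          · subst h
            simp only [K, Store.setHd, Store.setTp, Function.update_self]
            simp [add_assoc]
          · simp [K, Store.setHd, Store.setTp, h]
        · by_cases h : t = .inr .mark
          · subst h
            simp only [K, Store.setHd, Store.setTp, Function.update_self]
            exact fun ξ hξ => ⟨hξ.1.trans (lt_add_one _), hξ.2⟩
          · simp [K, Store.setHd, Store.setTp, h]
      · rw [Store.act_move]
        refine Store.ext (funext fun g => ?_) rfl
        by_cases h : g = .par
        · subst h; simp [K, Store.setHd, Store.setTp, Move.apply]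
        · simp [K, Store.setHd, Store.setTp, Move.apply, h]
      · refine ⟨fun g => ?_, fun t => ?_⟩
        · by_cases h : g = .par
          · subst h
            simp only [K, Store.setHd, Store.setTp, Function.update_self]
            simp [add_assoc]
          · simp [K, Store.setHd, Store.setTp, h]
        · by_cases h : t = .inr .mark
          · subst h
            simp only [K, Store.setHd, Store.setTp, Function.update_self]
            exact fun ξ hξ => ⟨hξ.1.trans (lt_add_one _), hξ.2⟩
          · simp [K, Store.setHd, Store.setTp, h]
      · refine Store.ext (funext fun g => ?_) (funext fun t => ?_)
        · by_cases h : g = .par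
          · subst h; simp [K, Store.setHd, Store.setTp, Move.apply, Store.act, e4]
          · by_cases h' : g = .sc
            · subst h'; simp [K, Store.setHd, Store.setTp, Move.apply, Store.act]
            · simp [K, Store.setHd, Store.setTp, Move.apply, h, h', Store.act]
        · by_cases h : t = .inr .bit
          · subst h
            rw [Store.act_tp_or (P := 4 * i + 3 ∈ σ.tp (.inl 0))]
            · ext ξ
              simp [K, Store.setHd, Store.setTp, le_iff_lt_or_eq]
              constructor
              · rintro (h | ⟨rfl, h⟩)
                · exact ⟨.inl h.1, h.2⟩
                · exact ⟨.inr rfl, h⟩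
              · rintro ⟨h | rfl, h'⟩
                · exact .inl ⟨h, h'⟩
                · exact .inr ⟨rfl, h'⟩
            · simp [K, Store.setHd, Store.setTp, Store.rd, e3]
          · rw [Store.act_tp_eq (by simp [h])]
            by_cases h' : t = .inr .mark
            · subst h'; simp [K, Store.setHd, Store.setTp]
            · simp [K, Store.setHd, Store.setTp, h, h']
    · by_cases h : g = .sc
      · subst h; simpa [K, Store.setHd, Store.setTp] using! HeadLim.of_isNormal IsNormal.id hl
      · by_cases h' : g = .par
        · subst h'
          simpa [K, Store.setHd, Store.setTp] using!
            HeadLim.of_isNormal (mul_isNormal (a := 4) (by simp)) hl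
        · simpa [K, Store.setHd, Store.setTp, h, h'] using HeadLim.const hl _
    · have key : ∀ A : Set Ordinal.{u}, TapeLim (fun j => {ξ | ξ < j ∧ ξ ∈ A}) o
          {ξ | ξ < o ∧ ξ ∈ A} := by
        refine fun A => .of_mono hl (fun j hj ξ hξ => ⟨hξ.1.trans hj, hξ.2⟩) fun ξ hξ => ?_
        exact ⟨ξ + 1, hl.add_one_lt hξ.1, fun j hj _ => ⟨Order.add_one_le_iff.1 hj, hξ.2⟩⟩
      by_cases h : t = .inr .bit
      · subst h
        simpa [K, Store.setHd, Store.setTp] using! key {ξ | 4 * ξ + 3 ∈ σ.tp (.inl 0)}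
      · by_cases h' : t = .inr .mark
        · subst h'
          simpa [K, Store.setHd, Store.setTp] using! key {ξ | 4 * ξ + 1 ∈ σ.tp (.inl 0)}
        · simpa [K, Store.setHd, Store.setTp, h, h'] using TapeLim.const hl _
  · refine Exec.seq (ex_reset (by simp [K, Store.setTp, Store.setHd, hz]) (Store.bot_below _)) ?_
    refine cast (congrArg _ ?_) (ex_reset (g := .par)
      (by simp [K, Store.setTp, Store.setHd, hz]) (Store.bot_below _))
    refine Store.ext (funext fun g => ?_) rfl
    by_cases h : g = .par
    · subst h; simp [Store.setTp, Store.setHd, hp]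
    · by_cases h' : g = .sc
      · subst h'; simp [Store.setTp, Store.setHd, hs]
      · simp [K, Store.setTp, Store.setHd, h, h']

/-- Skip a block of data in the script. -/
def skipData : Com :=
  .seq (.loop (fun r => r (.inr .mark)) (.act (fun r => r)
      fun _ g => if g = .sc then .right else .stay))
    (.act (fun r => r) fun _ g => if g = .sc then .right else .stay)

theorem below_setHd {σ : St.{u}} {g : Grp} {x : Ordinal.{u}} (h : σ.hd g ≤ x) :
    σ.Below (σ.setHd g x) := by
  refine ⟨fun g' => ?_, fun _ => subset_rfl⟩
  by_cases h' : g' = g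
  · subst h'; simpa [Store.setHd] using h
  · simp [Store.setHd, h']

theorem act_setHd_right (σ : St.{u}) (g : Grp) (x : Ordinal.{u}) :
    (σ.setHd g x).act tapeGrp ((σ.setHd g x).rd tapeGrp)
      (fun g' => if g' = g then .right else .stay) = σ.setHd g (x + 1) := by
  rw [Store.act_move]
  refine Store.ext (funext fun g' => ?_) rfl
  by_cases h : g' = g
  · subst h; simp [Store.setHd, Move.apply]
  · simp [Store.setHd, Move.apply, h]

/-- The lower bound is the initial store itself, because skipping is part of the bodies of loops. -/
theorem ex_skipData {σ : St.{u}} {p l : Ordinal.{u}} (hp : σ.hd .sc = p)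
    (h₁ : ∀ ξ < l, p + ξ ∈ σ.tp (.inr .mark)) (h₂ : p + l ∉ σ.tp (.inr .mark)) :
    Ex skipData σ σ (σ.setHd .sc (p + l + 1)) := by
  have hl := Exec.loop_act (grp := tapeGrp) (b := fun r => r (.inr .mark)) (L := σ)
    (f := fun r => r) (m := fun _ g => if g = .sc then .right else .stay)
    (fun x => σ.setHd .sc (p + x)) l
    (fun i hi => by simpa [Store.rd, Store.setHd] using h₁ i hi)
    (by simpa [Store.rd, Store.setHd] using h₂)
    (fun i _ => by rw [act_setHd_right, add_assoc])
    (fun o _ hl => ⟨fun g => by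
      by_cases h : g = .sc
      · subst h
        simpa [Store.setHd] using HeadLim.of_isNormal (add_isNormal _) hl
      · simpa [Store.setHd, h] using HeadLim.const hl _, fun t' => TapeLim.const hl _⟩)
    (fun i _ => below_setHd (by rw [hp]; exact le_self_add))
  simp only [add_zero] at hl
  rw [setHd_of_eq hp] at hl
  refine Exec.seq hl (.act _ _ (below_setHd (by rw [hp]; exact le_self_add)) ?_)
  exact act_setHd_right _ _ _

/-- Copy a block of data in the script to the output tape. -/
def copyData : Com :=
  .loop (fun r => r (.inr .mark)) (.act (fun r t => if t = .inl 4 then r (.inr .bit) else r t)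
      fun _ g => if g = .sc ∨ g = .out then .right else .stay)

theorem ex_copyData {σ : St.{u}} {p l o : Ordinal.{u}} (hp : σ.hd .sc = p) (ho : σ.hd .out = o)
    (h₁ : ∀ ξ < l, p + ξ ∈ σ.tp (.inr .mark)) (h₂ : p + l ∉ σ.tp (.inr .mark))
    (hb : ∀ ξ ∈ σ.tp (.inl 4), ξ < o) :
    Ex copyData .bot σ (((σ.setHd .sc (p + l)).setHd .out (o + l)).setTp (.inl 4)
      (σ.tp (.inl 4) ∪ {ξ | ∃ x < l, p + x ∈ σ.tp (.inr .bit) ∧ ξ = o + x})) := by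
  let K : Ordinal.{u} → St.{u} := fun y =>
    ((σ.setHd .sc (p + y)).setHd .out (o + y)).setTp (.inl 4)
      (σ.tp (.inl 4) ∪ {ξ | ∃ x < y, p + x ∈ σ.tp (.inr .bit) ∧ ξ = o + x})
  have h0 : K 0 = σ := by
    simp only [K, add_zero]
    rw [setHd_of_eq hp, setHd_of_eq ho]
    simp [Store.setTp]
  have hl := Exec.loop_act (grp := tapeGrp) (b := fun r => r (.inr .mark)) (L := .bot)
    (f := fun r t => if t = .inl 4 then r (.inr .bit) else r t)
    (m := fun _ g => if g = .sc ∨ g = .out then .right else .stay) K l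
    (fun i hi => by simpa [K, Store.rd, Store.setHd, Store.setTp] using h₁ i hi)
    (by simpa [K, Store.rd, Store.setHd, Store.setTp] using h₂)
    (fun i _ => by
      refine Store.ext (funext fun g => ?_) (funext fun t => ?_)
      · by_cases h : g = .sc
        · subst h; simp [K, Store.act, Store.setHd, Store.setTp, Move.apply, add_assoc]
        · by_cases h' : g = .out
          · subst h'; simp [K, Store.act, Store.setHd, Store.setTp, Move.apply, add_assoc]
          · simp [K, Store.act, Store.setHd, Store.setTp, Move.apply, h, h']
      · by_cases h : t = .inl 4
        · subst h
          rw [Store.act_tp_or (P := p + i ∈ σ.tp (.inr .bit))]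
          · ext ξ
            simp only [K, Store.setHd, Store.setTp, Function.update_self, Set.mem_union,
              Set.mem_ofPred_eq, tapeGrp_out, Order.lt_add_one_iff, or_assoc]
            refine or_congr Iff.rfl ⟨?_, ?_⟩
            · rintro (⟨x, hx, h, h'⟩ | ⟨h, h'⟩)
              · exact ⟨x, hx.le, h, h'⟩
              · exact ⟨i, le_rfl, h', h⟩
            · rintro ⟨x, hx, h, h'⟩
              rcases hx.lt_or_eq with hx | rfl
              · exact .inl ⟨x, hx, h, h'⟩
              · exact .inr ⟨h', h⟩
          -- Copying overwrites the output cell; as the cell was blank, this is the same as adding a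
          -- bit.
          · have : o + i ∉ σ.tp (.inl 4) := fun h => absurd (hb _ h) (not_lt.2 le_self_add)
            simp [K, Store.rd, Store.setHd, Store.setTp, this]
        · rw [Store.act_tp_eq (by simp [h])]
          simp [K, Store.setHd, Store.setTp, h])
    (fun o _ hl => ⟨fun g => by
      by_cases h : g = .sc
      · subst h
        simpa [K, Store.setHd, Store.setTp] using HeadLim.of_isNormal (add_isNormal _) hl
      · by_cases h' : g = .out
        · subst h'
          simpa [K, Store.setHd, Store.setTp] using HeadLim.of_isNormal (add_isNormal _) hl
        · simpa [K, Store.setHd, Store.setTp, h, h'] using HeadLim.const hl _, fun t => by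
      by_cases h : t = .inl 4
      · subst h
        simp only [K, Store.setHd, Store.setTp, Function.update_self]
        refine .of_mono hl (fun j hj => Set.union_subset_union_right _ ?_) fun ξ hξ => ?_
        · rintro ξ ⟨x, hx, h⟩
          exact ⟨x, hx.trans hj, h⟩
        · rcases hξ with hξ | ⟨x, hx, h⟩
          · exact ⟨0, hl.bot_lt, fun _ _ _ => .inl hξ⟩
          · exact ⟨x + 1, hl.add_one_lt hx, fun j hj _ => .inr ⟨x, Order.add_one_le_iff.1 hj, h⟩⟩
      · simpa [K, Store.setHd, Store.setTp, h] using TapeLim.const hl _⟩)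
    (fun i _ => Store.bot_below _)
  rw [h0] at hl
  exact hl

/-! ### The walk through all pairs of ordinals -/

/-- What is written when a pair of ordinals is visited. -/
def visitWrite (first last : Prop) (r : Tp → Prop) : Tp → Prop
  | .inr (.b1 k) => r (.inr (.b1 k)) ∨ first ∧ ¬ (r (.inr (.qb k)) ↔ r (.inr (.s k)))
  | .inr (.b3 k) => r (.inr (.b3 k)) ∨ ¬ first ∧ ¬ (r (.inr (.qb k)) ↔ r (.inr (.s k)))
  | .inr (.pr k) => r (.inr (.pr k)) ∨ r (.inr (.qb k))
  | .inr (.reached k) => r (.inr (.reached k)) ∨ r (.inr (.qe k))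
  | .inr .u1 => r (.inr .u1) ∨ last
  | .inr .u3 => r (.inr .u3) ∨ last
  | t => r t

/-- Visit the pairs with maximum `m` (the position of the head `h2`). -/
def walkRound : Com :=
  .seq (.loop (fun r => r (.inr .u1)) (.act (visitWrite True False)
    fun _ g => match g with | .q => .right | .h1 => .right | _ => .stay)) <|
  .seq (.loop (fun r => r (.inr .u3)) (.act (visitWrite False False)
    fun _ g => match g with | .q => .right | .h3 => .right | _ => .stay)) <|
  .seq (.act (visitWrite False True)
    fun _ g => match g with | .q => .right | .h2 => .right | _ => .stay) <|
  .seq (reset .h1) (reset .h3)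

/-- Visit all pairs of ordinals, until the ends of both codes are reached. -/
def walk : Com := .loop (fun r => ¬ ∀ k, r (.inr (.reached k))) walkRound

/-- The store after visiting all the pairs at positions below `p`. -/
def walkStore (σ : St.{u}) (p m x y : Ordinal.{u}) : St.{u} where
  hd
    | .q => p
    | .h1 => x
    | .h2 => m
    | .h3 => y
    | g => σ.hd g
  tp
    | .inr (.b1 k) => {b | ∃ a < b, godelPair (a, b) < p ∧
        ¬ (godelPair (a, b) ∈ σ.tp (.inr (.qb k)) ↔ a ∈ σ.tp (.inr (.s k)))}
    | .inr (.b3 k) => {b | ∃ a, b ≤ a ∧ godelPair (a, b) < p ∧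
        ¬ (godelPair (a, b) ∈ σ.tp (.inr (.qb k)) ↔ a ∈ σ.tp (.inr (.s k)))}
    | .inr (.pr k) => {a | ∃ b, godelPair (a, b) < p ∧ godelPair (a, b) ∈ σ.tp (.inr (.qb k))}
    | .inr (.reached k) => {ξ | ξ = 0 ∧ ∃ c ∈ σ.tp (.inr (.qe k)), c < p}
    | .inr .u1 => Set.Iio m
    | .inr .u3 => Set.Iio m
    | t => σ.tp t

theorem walkStore_below (σ : St.{u}) {p m x y p' m' x' y' : Ordinal.{u}} (hp : p ≤ p')
    (hm : m ≤ m') (hx : x ≤ x') (hy : y ≤ y') :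
    (walkStore σ p m x y).Below (walkStore σ p' m' x' y') := by
  refine ⟨fun g => ?_, fun t => ?_⟩
  · cases g <;> first | exact le_rfl | assumption
  · rcases t with i | w
    · exact subset_rfl
    · cases w with
      | b1 k => exact fun b ⟨a, h, h', h''⟩ => ⟨a, h, h'.trans_le hp, h''⟩
      | b3 k => exact fun b ⟨a, h, h', h''⟩ => ⟨a, h, h'.trans_le hp, h''⟩
      | pr k => exact fun a ⟨b, h, h'⟩ => ⟨b, h.trans_le hp, h'⟩
      | reached k => exact fun ξ ⟨h, c, h', h''⟩ => ⟨h, c, h', h''.trans_le hp⟩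
      | u1 => exact Set.Iio_subset_Iio hm
      | u3 => exact Set.Iio_subset_Iio hm
      | _ => exact subset_rfl

theorem below_walkStore {σ : St.{u}} (hq : σ.hd .q = 0) (h1 : σ.hd .h1 = 0) (h2 : σ.hd .h2 = 0)
    (h3 : σ.hd .h3 = 0) (hb1 : ∀ k, σ.tp (.inr (.b1 k)) = ∅) (hb3 : ∀ k, σ.tp (.inr (.b3 k)) = ∅)
    (hpr : ∀ k, σ.tp (.inr (.pr k)) = ∅) (hst : ∀ k, σ.tp (.inr (.reached k)) = ∅)
    (hu1 : σ.tp (.inr .u1) = ∅) (hu3 : σ.tp (.inr .u3) = ∅) : walkStore σ 0 0 0 0 = σ := by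
  refine Store.ext (funext fun g => ?_) (funext fun t => ?_)
  · cases g <;> first | rfl | (symm; assumption)
  · rcases t with i | w
    · rfl
    · cases w <;> first
        | rfl
        | (rw [hb1]; simp [walkStore])
        | (rw [hb3]; simp [walkStore])
        | (rw [hpr]; simp [walkStore])
        | (rw [hst]; simp [walkStore])
        | (rw [hu1]; simp [walkStore])
        | (rw [hu3]; simp [walkStore])

/-- If the contents `S` increase with a counter and every element of `S x` appears for good before
the counter reaches `x`, then the tape converges along with the counter. -/
theorem HeadLim.isTapeLim {f : Ordinal.{u} → Ordinal.{u}} {o : Ordinal.{u}} (ho : IsSuccLimit o)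
    (hf : Monotone f) (h : HeadLim f o (f o)) {S : Ordinal.{u} → Set Ordinal.{u}}
    (hS : ∀ x y, x ≤ y → S x ⊆ S y) (hS' : ∀ x, ∀ ξ ∈ S x, ∃ y < x, ∀ z, y < z → ξ ∈ S z) :
    TapeLim (fun j => S (f j)) o (S (f o)) := by
  refine .of_mono ho (fun j hj => hS _ _ (hf hj.le)) fun ξ hξ => ?_
  obtain ⟨y, hy, h'⟩ := hS' _ ξ hξ
  obtain ⟨i, hi, h⟩ := h.1 y hy
  exact ⟨i, hi, fun j hij hj => h' _ (h j hij hj)⟩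

theorem walkStore_lim (σ : St.{u}) {p m x y : Ordinal.{u} → Ordinal.{u}} {o : Ordinal.{u}}
    (ho : IsSuccLimit o) (hp : Monotone p) (hm : Monotone m) (lp : HeadLim p o (p o))
    (lm : HeadLim m o (m o)) (lx : HeadLim x o (x o)) (ly : HeadLim y o (y o)) :
    StoreLim (fun j => walkStore σ (p j) (m j) (x j) (y j)) o := by
  refine ⟨fun g => ?_, fun t => ?_⟩
  · cases g <;> first | assumption | exact HeadLim.const ho _
  · rcases t with i | w
    · exact TapeLim.const ho _
    · cases w with
      | b1 k =>
        refine HeadLim.isTapeLim ho hp lp (S := fun p => {b | ∃ a < b, godelPair (a, b) < p ∧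
          ¬ (godelPair (a, b) ∈ σ.tp (.inr (.qb k)) ↔ a ∈ σ.tp (.inr (.s k)))}) ?_ ?_
        · exact fun x y hxy b ⟨a, h, h', h''⟩ => ⟨a, h, h'.trans_le hxy, h''⟩
        · exact fun x b ⟨a, h, h', h''⟩ => ⟨_, h', fun z hz => ⟨a, h, hz, h''⟩⟩
      | b3 k =>
        refine HeadLim.isTapeLim ho hp lp (S := fun p => {b | ∃ a, b ≤ a ∧ godelPair (a, b) < p ∧
          ¬ (godelPair (a, b) ∈ σ.tp (.inr (.qb k)) ↔ a ∈ σ.tp (.inr (.s k)))}) ?_ ?_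
        · exact fun x y hxy b ⟨a, h, h', h''⟩ => ⟨a, h, h'.trans_le hxy, h''⟩
        · exact fun x b ⟨a, h, h', h''⟩ => ⟨_, h', fun z hz => ⟨a, h, hz, h''⟩⟩
      | pr k =>
        refine HeadLim.isTapeLim ho hp lp
          (S := fun p => {a | ∃ b, godelPair (a, b) < p ∧ godelPair (a, b) ∈ σ.tp (.inr (.qb k))})
          ?_ ?_
        · exact fun x y hxy b ⟨a, h, h'⟩ => ⟨a, h.trans_le hxy, h'⟩
        · exact fun x b ⟨a, h, h'⟩ => ⟨_, h, fun z hz => ⟨a, hz, h'⟩⟩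
      | reached k =>
        refine HeadLim.isTapeLim ho hp lp
          (S := fun p => {ξ | ξ = 0 ∧ ∃ c ∈ σ.tp (.inr (.qe k)), c < p}) ?_ ?_
        · exact fun x y hxy b ⟨h, c, h', h''⟩ => ⟨h, c, h', h''.trans_le hxy⟩
        · exact fun x b ⟨h, c, h', h''⟩ => ⟨_, h'', fun z hz => ⟨h, c, h', hz⟩⟩
      | u1 =>
        refine HeadLim.isTapeLim ho hm lm (S := Set.Iio) ?_ ?_
        · exact fun x y h => Set.Iio_subset_Iio h
        · exact fun x ξ h => ⟨ξ, h, fun z hz => hz⟩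
      | u3 =>
        refine HeadLim.isTapeLim ho hm lm (S := Set.Iio) ?_ ?_
        · exact fun x y h => Set.Iio_subset_Iio h
        · exact fun x ξ h => ⟨ξ, h, fun z hz => hz⟩
      | _ => exact TapeLim.const ho _

theorem godelPair_lt_add_one_iff {p x y a b : Ordinal.{u}} (h : godelPair (x, y) = p) :
    godelPair (a, b) < p + 1 ↔ godelPair (a, b) < p ∨ a = x ∧ b = y := by
  rw [Order.lt_add_one_iff, le_iff_lt_or_eq, ← h, godelPair_injective.eq_iff, Prod.mk.injEq]

/-- The effect of visiting a pair. -/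
theorem walkStore_act (σ : St.{u}) {p m x y x' y' m' a b : Ordinal.{u}} {first last : Prop}
    {mv : Grp → Move} (hf : σ.hd .f = 0) (hg : godelPair (a, b) = p)
    (ha : x = a) (hA : first → a < b ∧ b = m) (hB : ¬ first → b ≤ a ∧ b = y)
    (hlast : last → x = m ∧ y = m ∧ m' = m + 1) (hnl : ¬ last → m' = m)
    (hmq : mv .q = .right) (hm1 : (mv .h1).apply x = x') (hm2 : (mv .h2).apply m = m')
    (hm3 : (mv .h3).apply y = y')
    (hmv : ∀ g, g ≠ .q → g ≠ .h1 → g ≠ .h2 → g ≠ .h3 → mv g = .stay) :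
    (walkStore σ p m x y).act tapeGrp
      (visitWrite first last ((walkStore σ p m x y).rd tapeGrp)) mv =
      walkStore σ (p + 1) m' x' y' := by
  subst ha
  have key := fun a b => godelPair_lt_add_one_iff (a := a) (b := b) hg
  refine Store.ext (funext fun g => ?_) (funext fun t => ?_)
  · cases g with
    | q => simp [Store.act, hmq, walkStore, Move.apply]
    | h1 => exact hm1
    | h2 => exact hm2
    | h3 => exact hm3
    | _ =>
      simp only [Store.act]
      rw [hmv _ (by simp) (by simp) (by simp) (by simp)]
      rfl
  · rcases t with i | w
    · exact Store.act_tp_eq Iff.rfl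
    · cases w with
      | b1 k =>
        refine (Store.act_tp_or
          (P := first ∧ ¬ ((walkStore σ p m x y).rd tapeGrp (.inr (.qb k)) ↔ (walkStore σ p m x y).rd tapeGrp (.inr (.s k))))
          (by exact Iff.rfl)).trans ?_
        ext ξ
        simp only [Store.rd, walkStore, tapeGrp_b1, tapeGrp_qb, tapeGrp_s, Set.mem_ofPred_eq, key]
        constructor
        · rintro (⟨c, h₁, h₂, h₃⟩ | ⟨rfl, h₁, h₂⟩)
          · exact ⟨c, h₁, .inl h₂, h₃⟩
          · obtain ⟨h₃, rfl⟩ := hA h₁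
            exact ⟨x, h₃, .inr ⟨rfl, rfl⟩, by rwa [hg]⟩
        · rintro ⟨c, h₁, h₂ | ⟨rfl, rfl⟩, h₃⟩
          · exact .inl ⟨c, h₁, h₂, h₃⟩
          · by_cases h : first
            · exact .inr ⟨(hA h).2, h, by rwa [hg] at h₃⟩
            · exact absurd h₁ (not_lt.2 (hB h).1)
      | b3 k =>
        refine (Store.act_tp_or
          (P := ¬ first ∧ ¬ ((walkStore σ p m x y).rd tapeGrp (.inr (.qb k)) ↔ (walkStore σ p m x y).rd tapeGrp (.inr (.s k))))
          (by exact Iff.rfl)).trans ?_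
        ext ξ
        simp only [Store.rd, walkStore, tapeGrp_b3, tapeGrp_qb, tapeGrp_s, Set.mem_ofPred_eq, key]
        constructor
        · rintro (⟨c, h₁, h₂, h₃⟩ | ⟨rfl, h₁, h₂⟩)
          · exact ⟨c, h₁, .inl h₂, h₃⟩
          · obtain ⟨h₃, rfl⟩ := hB h₁
            exact ⟨x, h₃, .inr ⟨rfl, rfl⟩, by rwa [hg]⟩
        · rintro ⟨c, h₁, h₂ | ⟨rfl, rfl⟩, h₃⟩
          · exact .inl ⟨c, h₁, h₂, h₃⟩
          · by_cases h : first
            · exact absurd h₁ (not_le.2 (hA h).1)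
            · exact .inr ⟨(hB h).2, h, by rwa [hg] at h₃⟩
      | pr k =>
        refine (Store.act_tp_or
          (P := (walkStore σ p m x y).rd tapeGrp (.inr (.qb k)))
          (by exact Iff.rfl)).trans ?_
        ext ξ
        simp only [Store.rd, walkStore, tapeGrp_pr, tapeGrp_qb, Set.mem_ofPred_eq, key]
        constructor
        · rintro (⟨c, h₂, h₃⟩ | ⟨rfl, h₁⟩)
          · exact ⟨c, .inl h₂, h₃⟩
          · exact ⟨b, .inr ⟨rfl, rfl⟩, by rwa [hg]⟩
        · rintro ⟨c, h₂ | ⟨rfl, rfl⟩, h₃⟩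
          · exact .inl ⟨c, h₂, h₃⟩
          · exact .inr ⟨rfl, by rwa [hg] at h₃⟩
      | reached k =>
        refine (Store.act_tp_or
          (P := (walkStore σ p m x y).rd tapeGrp (.inr (.qe k)))
          (by exact Iff.rfl)).trans ?_
        ext ξ
        simp only [Store.rd, walkStore, tapeGrp_reached, tapeGrp_qe, Set.mem_ofPred_eq, hf,
          Order.lt_add_one_iff, le_iff_lt_or_eq]
        constructor
        · rintro (⟨rfl, c, h₁, h₂⟩ | ⟨rfl, h⟩)
          · exact ⟨rfl, c, h₁, .inl h₂⟩
          · exact ⟨rfl, p, h, .inr rfl⟩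
        · rintro ⟨rfl, c, h₁, h₂ | rfl⟩
          · exact .inl ⟨rfl, c, h₁, h₂⟩
          · exact .inr ⟨rfl, h₁⟩
      | u1 =>
        refine (Store.act_tp_or
          (P := last)
          (by exact Iff.rfl)).trans ?_
        by_cases h : last
        · obtain ⟨rfl, rfl, rfl⟩ := hlast h
          ext ξ
          simp [walkStore, h, le_iff_lt_or_eq]
        · rw [hnl h]
          ext ξ
          simp [walkStore, h]
      | u3 =>
        refine (Store.act_tp_or
          (P := last)
          (by exact Iff.rfl)).trans ?_
        by_cases h : last
        · obtain ⟨rfl, rfl, rfl⟩ := hlast h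
          ext ξ
          simp [walkStore, h, le_iff_lt_or_eq]
        · rw [hnl h]
          ext ξ
          simp [walkStore, h]
      | _ => exact Store.act_tp_eq Iff.rfl

theorem walkStore_setHd_h1 (σ : St.{u}) (p m x y z : Ordinal.{u}) :
    (walkStore σ p m x y).setHd .h1 z = walkStore σ p m z y := by
  refine Store.ext (funext fun g => ?_) rfl
  cases g <;> simp [Store.setHd, walkStore]

theorem walkStore_setHd_h3 (σ : St.{u}) (p m x y z : Ordinal.{u}) :
    (walkStore σ p m x y).setHd .h3 z = walkStore σ p m x z := by
  refine Store.ext (funext fun g => ?_) rfl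
  cases g <;> simp [Store.setHd, walkStore]

/-- The pairs with maximum `m` are visited in Gödel's order: first `(x, m)` for `x < m` with the
heads `h1` and `h2`, then `(m, y)` for `y < m` with `h1` and `h3`, finally `(m, m)`. The head `q`
moves right by one at each visit and thus stays on the Gödel code of the current pair. The unary
copies of `m` on `u1` and `u3` stop the two loops, and the last visit lengthens them by one. -/
theorem ex_walkRound (σ : St.{u}) (m : Ordinal.{u}) (hf : σ.hd .f = 0)
    (hz : ∀ g, σ.tp (.inr (.z g)) = {0}) :
    Ex walkRound (walkStore σ (godelBase m) m 0 0) (walkStore σ (godelBase m) m 0 0)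
      (walkStore σ (godelBase (m + 1)) (m + 1) 0 0) := by
  have hA := Exec.loop_act (grp := tapeGrp) (b := fun r => r (.inr .u1))
    (L := walkStore σ (godelBase m) m 0 0) (f := visitWrite True False)
    (m := fun _ g => match g with | .q => .right | .h1 => .right | _ => .stay)
    (fun x => walkStore σ (godelBase m + x) m x 0) m
    (fun i hi => hi) (lt_irrefl m)
    (fun i hi => by
      rw [← add_assoc]
      exact walkStore_act σ hf (godelPair_of_lt hi) rfl (fun _ => ⟨hi, rfl⟩)
        (fun h => absurd trivial h) (fun h => h.elim) (fun _ => rfl) rfl rfl rfl rfl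
        (fun g h₁ h₂ h₃ h₄ => by cases g <;> first | rfl | contradiction))
    (fun o _ ho => walkStore_lim σ ho (add_isNormal _).monotone monotone_const
      (.of_isNormal (add_isNormal _) ho) (.const ho _) (.of_isNormal .id ho) (.const ho _))
    (fun i _ => walkStore_below σ le_self_add le_rfl zero_le le_rfl)
  have hB := Exec.loop_act (grp := tapeGrp) (b := fun r => r (.inr .u3))
    (L := walkStore σ (godelBase m) m 0 0) (f := visitWrite False False)
    (m := fun _ g => match g with | .q => .right | .h3 => .right | _ => .stay)
    (fun y => walkStore σ (godelBase m + m + y) m m y) m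
    (fun i hi => hi) (lt_irrefl m)
    (fun i hi => by
      rw [← add_assoc]
      exact walkStore_act σ hf (godelPair_of_le hi.le) rfl (fun h => h.elim)
        (fun _ => ⟨hi.le, rfl⟩) (fun h => h.elim) (fun _ => rfl) rfl rfl rfl rfl
        (fun g h₁ h₂ h₃ h₄ => by cases g <;> first | rfl | contradiction))
    (fun o _ ho => walkStore_lim σ ho (add_isNormal _).monotone monotone_const
      (.of_isNormal (add_isNormal _) ho) (.const ho _) (.const ho _) (.of_isNormal .id ho))
    (fun i _ => walkStore_below σ (le_self_add.trans le_self_add) le_rfl zero_le zero_le)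
  simp only [add_zero] at hA hB
  have hlt : godelBase m ≤ godelBase (m + 1) :=
    godelBase_isNormal.monotone (lt_add_one m).le
  refine Exec.seq hA (Exec.seq hB (Exec.seq (σ₁ := walkStore σ (godelBase (m + 1)) (m + 1) m m)
    (.act _ _ ?_ ?_) (Exec.seq (σ₁ := walkStore σ (godelBase (m + 1)) (m + 1) 0 m) ?_ ?_)))
  · exact walkStore_below σ (le_self_add.trans le_self_add) le_rfl zero_le zero_le
  · rw [godelBase_add_one]
    exact walkStore_act σ hf (godelPair_of_le le_rfl) rfl (fun h => h.elim)
        (fun _ => ⟨le_rfl, rfl⟩) (fun _ => ⟨rfl, rfl, rfl⟩) (fun h => absurd trivial h) rfl rfl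
        rfl rfl (fun g h₁ h₂ h₃ h₄ => by cases g <;> first | rfl | contradiction)
  · have := ex_reset (L := walkStore σ (godelBase m) m 0 0)
      (σ := walkStore σ (godelBase (m + 1)) (m + 1) m m) (hz .h1)
    rw [walkStore_setHd_h1] at this
    exact this (walkStore_below σ hlt (lt_add_one m).le le_rfl zero_le)
  · have := ex_reset (L := walkStore σ (godelBase m) m 0 0)
      (σ := walkStore σ (godelBase (m + 1)) (m + 1) 0 m) (hz .h3)
    rw [walkStore_setHd_h3] at this
    exact this (walkStore_below σ hlt (lt_add_one m).le le_rfl le_rfl)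

/-- At limit rounds all positions are right because `godelBase` is normal. The walk ends at the
first `N` for which the square `N × N` has passed the bounds of both codes. -/
theorem ex_walk {σ : St.{u}} {N : Ordinal.{u}} (hf : σ.hd .f = 0)
    (hz : ∀ g, σ.tp (.inr (.z g)) = {0}) (hσ : walkStore σ 0 0 0 0 = σ)
    (hN : ∀ k, ∃ c ∈ σ.tp (.inr (.qe k)), c < godelBase N)
    (hmin : ∀ m < N, ¬ ∀ k, ∃ c ∈ σ.tp (.inr (.qe k)), c < godelBase m) :
    Ex walk σ σ (walkStore σ (godelBase N) N 0 0) := by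
  have hrd : ∀ m, (∀ k, (walkStore σ (godelBase m) m 0 0).rd tapeGrp (.inr (.reached k))) ↔
      ∀ k, ∃ c ∈ σ.tp (.inr (.qe k)), c < godelBase m := by
    intro m
    simp [Store.rd, walkStore, hf]
  have hb := fun m => walkStore_below σ (zero_le (a := godelBase m)) (zero_le (a := m))
    (le_refl 0) (le_refl 0)
  simp only [hσ] at hb
  have := Exec.loop (grp := tapeGrp) (b := fun r => ¬ ∀ k, r (.inr (.reached k))) (L := σ)
    (c := walkRound) (fun m => walkStore σ (godelBase m) m 0 0) N
    (fun i hi => mt (hrd i).1 (hmin i hi)) (not_not.2 ((hrd N).2 hN))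
    (fun i _ => ex_walkRound σ i hf hz)
    (fun o _ ho => walkStore_lim σ ho godelBase_isNormal.monotone monotone_id
      (.of_isNormal godelBase_isNormal ho) (.of_isNormal .id ho) (.const ho _) (.const ho _))
    (fun i _ => hb i)
  simp only [godelBase_zero, hσ] at this
  exact this

/-! ### Growing tapes -/

/-- The set `A` together with the sets `R ξ`, for `ξ < x`. -/
def grow (A : Set Ordinal.{u}) (R : Ordinal.{u} → Set Ordinal.{u}) (x : Ordinal.{u}) :
    Set Ordinal.{u} :=
  {z | z ∈ A ∨ ∃ ξ < x, z ∈ R ξ}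

theorem grow_zero (A : Set Ordinal.{u}) (R : Ordinal.{u} → Set Ordinal.{u}) : grow A R 0 = A := by
  ext z
  simp [grow]

theorem mem_grow_empty {R : Ordinal.{u} → Set Ordinal.{u}} {x z : Ordinal.{u}} :
    z ∈ grow ∅ R x ↔ ∃ ξ < x, z ∈ R ξ := by
  simp [grow]

theorem grow_mono (A : Set Ordinal.{u}) (R : Ordinal.{u} → Set Ordinal.{u}) {x y : Ordinal.{u}}
    (h : x ≤ y) : grow A R x ⊆ grow A R y := by
  rintro z (hz | ⟨ξ, hξ, hz⟩)
  · exact .inl hz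
  · exact .inr ⟨ξ, hξ.trans_le h, hz⟩

theorem subset_grow (A : Set Ordinal.{u}) (R : Ordinal.{u} → Set Ordinal.{u}) (x : Ordinal.{u}) :
    A ⊆ grow A R x := fun _ => .inl

theorem grow_add_one (A : Set Ordinal.{u}) (R : Ordinal.{u} → Set Ordinal.{u}) (x : Ordinal.{u}) :
    grow A R (x + 1) = {z | z ∈ grow A R x ∨ z ∈ R x} := by
  ext z
  simp only [grow, Set.mem_ofPred_eq, Order.lt_add_one_iff, or_assoc]
  refine or_congr Iff.rfl ⟨?_, ?_⟩
  · rintro ⟨ξ, hξ, h⟩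
    rcases hξ.lt_or_eq with hξ | rfl
    · exact .inl ⟨ξ, hξ, h⟩
    · exact .inr h
  · rintro (⟨ξ, hξ, h⟩ | h)
    · exact ⟨ξ, hξ.le, h⟩
    · exact ⟨x, le_rfl, h⟩

theorem TapeLim.grow {o : Ordinal.{u}} (ho : IsSuccLimit o) (A : Set Ordinal.{u})
    (R : Ordinal.{u} → Set Ordinal.{u}) :
    TapeLim (fun j => grow A R j) o (OTMRealisability.grow A R o) := by
  refine .of_mono ho (fun j hj => grow_mono A R hj.le) ?_
  rintro z (hz | ⟨ξ, hξ, hz⟩)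
  · exact ⟨0, ho.bot_lt, fun _ _ _ => .inl hz⟩
  · exact ⟨ξ + 1, ho.add_one_lt hξ, fun j hj _ => .inr ⟨ξ, Order.add_one_le_iff.1 hj, hz⟩⟩

theorem Store.act_tp_grow {T G : Type} {grp : T → G} {σ : Store.{u} T G} {w : T → Prop}
    {m : G → Move} {t : T} (P : Prop) {A : Set Ordinal.{u}} {R : Ordinal.{u} → Set Ordinal.{u}}
    {x : Ordinal.{u}} (h : w t ↔ σ.rd grp t ∨ P) (ht : σ.tp t = OTMRealisability.grow A R x)
    (hR : ∀ z, z ∈ R x ↔ z = σ.hd (grp t) ∧ P) :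
    (σ.act grp w m).tp t = OTMRealisability.grow A R (x + 1) := by
  rw [Store.act_tp_or h, grow_add_one, ht]
  ext z
  simp [hR]

/-- The state of the store before and after a segment of the script is worked through. -/
structure Store.Ready (σ : St.{u}) : Prop where
  z : ∀ g, σ.tp (.inr (.z g)) = {0}
  q : σ.hd .q = 0
  h1 : σ.hd .h1 = 0
  h2 : σ.hd .h2 = 0
  h3 : σ.hd .h3 = 0
  e : σ.hd .e = 0
  f : σ.hd .f = 0
  s : ∀ k, σ.tp (.inr (.s k)) = ∅
  pr : ∀ k, σ.tp (.inr (.pr k)) = ∅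
  b1 : ∀ k, σ.tp (.inr (.b1 k)) = ∅
  b3 : ∀ k, σ.tp (.inr (.b3 k)) = ∅
  reached : ∀ k, σ.tp (.inr (.reached k)) = ∅
  poison : ∀ k, σ.tp (.inr (.poison k)) = ∅
  found : ∀ k, σ.tp (.inr (.found k)) = ∅
  u1 : σ.tp (.inr .u1) = ∅
  u3 : σ.tp (.inr .u3) = ∅
  eta : σ.tp (.inr .eta) = ∅
  hit : σ.tp (.inr .hit) = ∅

/-! ### Gathering the codes of the elements of a set -/

/-- Go through a row of the matrix on the tapes `ee k`. -/
def gatherRow : Com :=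
  .loop (fun r => ¬ r (.inr .em)) <| .act
    (fun r t => match t with
      | .inr (.s k) => r (.inr (.s k)) ∨ r (.inr .bit) ∧ r (.inr (.ee k))
      | t => r t)
    fun _ g => match g with | .h1 => .right | .e => .right | _ => .stay

/-- Go through the rows of the matrix that belong to the elements of the current set. -/
def gather : Com :=
  .loop (fun r => r (.inr .mark)) <| .seq gatherRow <| .seq
    (.act (fun r t => match t with
        | .inr (.poison k) => r (.inr (.poison k)) ∨ r (.inr .bit) ∧ ¬ r (.inr (.ee k))
        | t => r t)
      fun _ g => match g with | .sc => .right | .e => .right | _ => .stay)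
    (reset .h1)

/-- The stores that occur in `gather`. -/
def gatherStore (σ : St.{u}) (sc e x : Ordinal.{u}) (S P : Bool → Set Ordinal.{u}) : St.{u} where
  hd
    | .sc => sc
    | .e => e
    | .h1 => x
    | g => σ.hd g
  tp
    | .inr (.s k) => S k
    | .inr (.poison k) => P k
    | t => σ.tp t

theorem gatherStore_below (σ : St.{u}) {sc e x sc' e' x' : Ordinal.{u}}
    {S P S' P' : Bool → Set Ordinal.{u}} (hsc : sc ≤ sc') (he : e ≤ e') (hx : x ≤ x')
    (hS : ∀ k, S k ⊆ S' k) (hP : ∀ k, P k ⊆ P' k) :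
    (gatherStore σ sc e x S P).Below (gatherStore σ sc' e' x' S' P') := by
  refine ⟨fun g => ?_, fun t => ?_⟩
  · cases g <;> first | exact le_rfl | assumption
  · rcases t with i | w
    · exact subset_rfl
    · cases w <;> first | exact subset_rfl | exact hS _ | exact hP _

theorem gatherStore_lim (σ : St.{u}) {sc e x : Ordinal.{u} → Ordinal.{u}}
    {S P : Ordinal.{u} → Bool → Set Ordinal.{u}} {o : Ordinal.{u}} (ho : IsSuccLimit o)
    (hsc : HeadLim sc o (sc o)) (he : HeadLim e o (e o)) (hx : HeadLim x o (x o))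
    (hS : ∀ k, TapeLim (fun j => S j k) o (S o k)) (hP : ∀ k, TapeLim (fun j => P j k) o (P o k)) :
    StoreLim (fun j => gatherStore σ (sc j) (e j) (x j) (S j) (P j)) o := by
  refine ⟨fun g => ?_, fun t => ?_⟩
  · cases g <;> first | assumption | exact HeadLim.const ho _
  · rcases t with i | w
    · exact TapeLim.const ho _
    · cases w <;> first | exact hS _ | exact hP _ | exact TapeLim.const ho _

theorem gatherStore_setHd (σ : St.{u}) (sc e x y : Ordinal.{u}) (S P : Bool → Set Ordinal.{u}) :
    (gatherStore σ sc e x S P).setHd .h1 y = gatherStore σ sc e y S P := by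
  refine Store.ext (funext fun g => ?_) rfl
  cases g <;> simp [Store.setHd, gatherStore]

theorem gatherStore_self {σ : St.{u}} (h : σ.Ready) :
    gatherStore σ (σ.hd .sc) 0 0 (fun _ => ∅) (fun _ => ∅) = σ := by
  refine Store.ext (funext fun g => ?_) (funext fun t => ?_)
  · cases g <;> first | rfl | exact h.e.symm | exact h.h1.symm
  · rcases t with i | w
    · rfl
    · cases w <;> first | rfl | exact (h.s _).symm | exact (h.poison _).symm

theorem ex_gatherRow (σ : St.{u}) (sc e N : Ordinal.{u}) (S P : Bool → Set Ordinal.{u})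
    (h₁ : ∀ x < N, e + x ∉ σ.tp (.inr .em)) (h₂ : e + N ∈ σ.tp (.inr .em)) :
    Ex gatherRow (gatherStore σ sc e 0 S P) (gatherStore σ sc e 0 S P)
      (gatherStore σ sc (e + N) N (fun k => grow (S k)
        (fun ξ => {z | z = ξ ∧ sc ∈ σ.tp (.inr .bit) ∧ e + ξ ∈ σ.tp (.inr (.ee k))}) N) P) := by
  have := Exec.loop_act (grp := tapeGrp) (b := fun r => ¬ r (.inr .em))
    (L := gatherStore σ sc e 0 S P)
    (f := fun r t => match t with
      | .inr (.s k) => r (.inr (.s k)) ∨ r (.inr .bit) ∧ r (.inr (.ee k))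
      | t => r t)
    (m := fun _ g => match g with | .h1 => .right | .e => .right | _ => .stay)
    (fun x => gatherStore σ sc (e + x) x (fun k => grow (S k)
        (fun ξ => {z | z = ξ ∧ sc ∈ σ.tp (.inr .bit) ∧ e + ξ ∈ σ.tp (.inr (.ee k))}) x) P) N
    h₁ (not_not.2 h₂) ?_
    (fun o _ ho => gatherStore_lim σ ho (.const ho _) (.of_isNormal (add_isNormal _) ho)
      (.of_isNormal .id ho) (fun k => .grow ho _ _) (fun k => .const ho _))
    (fun i _ => gatherStore_below σ le_rfl le_self_add zero_le (fun k => subset_grow _ _ _)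
      fun _ => subset_rfl)
  · simp only [add_zero, grow_zero] at this
    exact this
  · refine fun i hi => Store.ext (funext fun g => ?_) (funext fun t => ?_)
    · cases g <;> first | rfl | exact add_assoc _ _ _
    · rcases t with j | w
      · exact Store.act_tp_eq Iff.rfl
      · cases w with
        | s k =>
          exact Store.act_tp_grow (sc ∈ σ.tp (.inr .bit) ∧ e + i ∈ σ.tp (.inr (.ee k)))
            Iff.rfl rfl fun z => Iff.rfl
        | _ => exact Store.act_tp_eq Iff.rfl

/-- The codes gathered from the first `i` rows. -/
def gathered (σ : St.{u}) (N p : Ordinal.{u}) (i : Ordinal.{u}) (k : Bool) : Set Ordinal.{u} :=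
  grow ∅ (fun j => {z | z < N ∧ p + j ∈ σ.tp (.inr .bit) ∧
    (N + 1) * j + z ∈ σ.tp (.inr (.ee k))}) i

/-- The failures to find a code in the first `i` rows. -/
def poisoned (σ : St.{u}) (N p : Ordinal.{u}) (i : Ordinal.{u}) (k : Bool) : Set Ordinal.{u} :=
  grow ∅ (fun j => {z | z = 0 ∧ p + j ∈ σ.tp (.inr .bit) ∧
    (N + 1) * j + N ∉ σ.tp (.inr (.ee k))}) i

/-- The rows of the matrix have length `N + 1`, so the head `e` is at `(N + 1) * j` when row `j`
begins, while the script head reads whether set `j` belongs to the current set. If it does, its row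
is added to `s k`, and an unset last column, meaning that the set is not present in the code `k`,
raises the flag `poison k`. -/
theorem ex_gather {σ : St.{u}} (hσ : σ.Ready) {N p i : Ordinal.{u}} (hp : σ.hd .sc = p)
    (hm : ∀ j < i, p + j ∈ σ.tp (.inr .mark)) (hm' : p + i ∉ σ.tp (.inr .mark))
    (h₁ : ∀ j < i, ∀ x < N, (N + 1) * j + x ∉ σ.tp (.inr .em))
    (h₂ : ∀ j < i, (N + 1) * j + N ∈ σ.tp (.inr .em)) :
    Ex gather σ σ (gatherStore σ (p + i) ((N + 1) * i) 0 (gathered σ N p i)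
      (poisoned σ N p i)) := by
  have hz : ∀ sc e x S P g, (gatherStore σ sc e x S P).tp (.inr (.z g)) = {0} :=
    fun _ _ _ _ _ g => hσ.z g
  have := Exec.loop (grp := tapeGrp) (b := fun r => r (.inr .mark)) (L := σ)
    (c := .seq gatherRow <| .seq
    (.act (fun r t => match t with
        | .inr (.poison k) => r (.inr (.poison k)) ∨ r (.inr .bit) ∧ ¬ r (.inr (.ee k))
        | t => r t)
      fun _ g => match g with | .sc => .right | .e => .right | _ => .stay)
    (reset .h1))
    (fun j => gatherStore σ (p + j) ((N + 1) * j) 0 (gathered σ N p j) (poisoned σ N p j)) i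
    hm hm' ?_
    (fun o _ ho => gatherStore_lim σ ho (.of_isNormal (add_isNormal _) ho)
      (.of_isNormal (mul_isNormal (by simp)) ho) (.const ho _)
      (fun k => .grow ho _ _) (fun k => .grow ho _ _))
    (fun j _ => ?_)
  · have h0 : gatherStore σ (p + 0) ((N + 1) * 0) 0 (gathered σ N p 0) (poisoned σ N p 0) = σ := by
      rw [add_zero, mul_zero, show gathered σ N p 0 = fun _ => ∅ from funext fun _ => grow_zero _ _,
        show poisoned σ N p 0 = fun _ => ∅ from funext fun _ => grow_zero _ _, ← hp,
        gatherStore_self hσ]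
    rw [h0] at this
    exact this
  · intro j hj
    refine .seq (ex_gatherRow σ _ _ N _ _ (h₁ j hj) (h₂ j hj)) ?_
    -- Adding one row cell by cell up to `N` amounts to one stage of `gathered`.
    have hS : (fun k => grow (gathered σ N p j k) (fun ξ => {z | z = ξ ∧
        p + j ∈ σ.tp (.inr .bit) ∧ (N + 1) * j + ξ ∈ σ.tp (.inr (.ee k))}) N) =
        gathered σ N p (j + 1) := by
      funext k
      rw [gathered, gathered, grow_add_one]
      ext z
      rw [grow]
      refine or_congr Iff.rfl ?_
      simp
    rw [hS]
    refine .seq (σ₁ := gatherStore σ (p + (j + 1)) ((N + 1) * (j + 1)) N (gathered σ N p (j + 1))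
      (poisoned σ N p (j + 1))) (.act _ _ ?_ ?_) ?_
    · exact gatherStore_below σ le_rfl le_self_add zero_le
        (fun k => grow_mono _ _ (lt_add_one j).le) fun k => subset_rfl
    · refine Store.ext (funext fun g => ?_) (funext fun t => ?_)
      · cases g with
        | sc => exact add_assoc _ _ _
        | e =>
          show (N + 1) * j + N + 1 = (N + 1) * (j + 1)
          rw [mul_add, mul_one, add_assoc]
        | _ => rfl
      · rcases t with j | w
        · exact Store.act_tp_eq Iff.rfl
        · cases w with
          | poison k =>
            refine Store.act_tp_grow (p + j ∈ σ.tp (.inr .bit) ∧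
              (N + 1) * j + N ∉ σ.tp (.inr (.ee k))) Iff.rfl rfl fun z => ?_
            show _ ↔ z = σ.hd .f ∧ _
            rw [hσ.f]
            rfl
          | _ => exact Store.act_tp_eq Iff.rfl
    · have := ex_reset (g := .h1) (L := gatherStore σ (p + j) ((N + 1) * j) 0 (gathered σ N p j)
        (poisoned σ N p j)) (hz (p + (j + 1)) ((N + 1) * (j + 1)) N (gathered σ N p (j + 1))
        (poisoned σ N p (j + 1)) .h1)
      rw [gatherStore_setHd] at this
      exact this (gatherStore_below σ ((add_isNormal p).monotone (lt_add_one j).le)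
        ((mul_isNormal (by simp)).monotone (lt_add_one j).le) le_rfl
        (fun k => grow_mono _ _ (lt_add_one j).le) fun k => grow_mono _ _ (lt_add_one j).le)
  · conv_lhs => rw [← gatherStore_self hσ, hp]
    exact gatherStore_below σ le_self_add zero_le le_rfl (fun k => Set.empty_subset _)
      fun k => Set.empty_subset _

/-! ### One segment of the script -/

/-- Move the heads of several groups to cell `0`. -/
def resets : List Grp → Com
  | [] => .act (fun r => r) fun _ _ => .stay
  | g :: l => .seq (reset g) (resets l)

/-- The store with the heads in `l` on cell `0`. -/
def Store.zeroHds (σ : St.{u}) (l : List Grp) : St.{u} :=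
  { σ with hd := fun g => if g ∈ l then 0 else σ.hd g }

theorem zeroHds_below (σ : St.{u}) (l : List Grp) : (σ.zeroHds l).Below σ := by
  refine ⟨fun g => ?_, fun _ => subset_rfl⟩
  simp only [Store.zeroHds]
  split_ifs
  · exact zero_le
  · exact le_rfl

theorem ex_resets {σ L : St.{u}} (hz : ∀ g, σ.tp (.inr (.z g)) = {0}) (l : List Grp)
    (hL : L.Below (σ.zeroHds l)) : Ex (resets l) L σ (σ.zeroHds l) := by
  induction l generalizing σ with
  | nil =>
    refine .act _ _ (hL.trans (zeroHds_below σ _)) ?_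
    rw [Store.act_stay]
    simp [Store.zeroHds]
  | cons g l ih =>
    have h : (σ.setHd g 0).zeroHds l = σ.zeroHds (g :: l) := by
      refine Store.ext (funext fun g' => ?_) rfl
      by_cases h : g' = g
      · subst h; simp [Store.zeroHds, Store.setHd]
      · simp [Store.zeroHds, Store.setHd, h]
    refine .seq (ex_reset (hz g) ?_) ?_
    · rw [← h] at hL
      exact hL.trans (zeroHds_below _ _)
    · rw [← h] at hL ⊢
      exact ih hz hL

/-- The codes that match the current set. -/
def candidate (k : Bool) (r : Tp → Prop) : Prop :=
  ¬ r (.inr (.poison k)) ∧ (r (.inr (.pr k)) ∨ r (.inr (.rho k))) ∧ ¬ r (.inr (.b1 k)) ∧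
    ¬ r (.inr (.b3 k))

/-- The tape with the codes to look for. -/
def target : Bool → Tp
  | true => .inr .r
  | false => .inr (.rho false)

/-- Write the next row of the matrix. -/
def sweep (m : Bool) : Com :=
  .loop (fun r => r (.inr .u1)) <| .act
    (fun r t => match t with
      | .inr (.ee k) => r (.inr (.ee k)) ∨ candidate k r
      | .inr .eta => r (.inr .eta) ∨ candidate true r
      | .inr .hit => r (.inr .hit) ∨ r (.inr .bit) ∧ candidate false r ∧ r (target m)
      | .inr (.found k) => r (.inr (.found k)) ∨ candidate k r
      | t => r t)
    fun _ g => match g with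
      | .h1 => .right
      | .h2 => .right
      | .h3 => .right
      | .e => .right
      | _ => .stay

/-- The stores that occur in `sweep`. -/
def sweepStore (ω : St.{u}) (x e : Ordinal.{u}) (E Fo : Bool → Set Ordinal.{u})
    (Eta Hit : Set Ordinal.{u}) : St.{u} where
  hd
    | .h1 => x
    | .h2 => x
    | .h3 => x
    | .e => e
    | g => ω.hd g
  tp
    | .inr (.ee k) => E k
    | .inr (.found k) => Fo k
    | .inr .eta => Eta
    | .inr .hit => Hit
    | t => ω.tp t

/-- The candidates for the codes of the current set. -/
def candidates (ω : St.{u}) (k : Bool) : Set Ordinal.{u} :=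
  {ξ | 0 ∉ ω.tp (.inr (.poison k)) ∧ (ξ ∈ ω.tp (.inr (.pr k)) ∨ ξ ∈ ω.tp (.inr (.rho k))) ∧
    ξ ∉ ω.tp (.inr (.b1 k)) ∧ ξ ∉ ω.tp (.inr (.b3 k))}

theorem sweepStore_below (ω : St.{u}) {x e x' e' : Ordinal.{u}}
    {E Fo E' Fo' : Bool → Set Ordinal.{u}} {Eta Hit Eta' Hit' : Set Ordinal.{u}} (hx : x ≤ x')
    (he : e ≤ e') (hE : ∀ k, E k ⊆ E' k) (hF : ∀ k, Fo k ⊆ Fo' k) (hη : Eta ⊆ Eta')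
    (hh : Hit ⊆ Hit') :
    (sweepStore ω x e E Fo Eta Hit).Below (sweepStore ω x' e' E' Fo' Eta' Hit') := by
  refine ⟨fun g => ?_, fun t => ?_⟩
  · cases g <;> first | exact le_rfl | assumption
  · rcases t with i | w
    · exact subset_rfl
    · cases w <;> first | exact subset_rfl | exact hE _ | exact hF _ | assumption

theorem sweepStore_lim (ω : St.{u}) {x e : Ordinal.{u} → Ordinal.{u}}
    {E Fo : Ordinal.{u} → Bool → Set Ordinal.{u}} {Eta Hit : Ordinal.{u} → Set Ordinal.{u}}
    {o : Ordinal.{u}} (ho : IsSuccLimit o)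
    (hx : HeadLim x o (x o)) (he : HeadLim e o (e o))
    (hE : ∀ k, TapeLim (fun j => E j k) o (E o k))
    (hF : ∀ k, TapeLim (fun j => Fo j k) o (Fo o k))
    (hη : TapeLim Eta o (Eta o)) (hh : TapeLim Hit o (Hit o)) :
    StoreLim (fun j => sweepStore ω (x j) (e j) (E j) (Fo j) (Eta j) (Hit j)) o := by
  refine ⟨fun g => ?_, fun t => ?_⟩
  · cases g <;> first | assumption | exact HeadLim.const ho _
  · rcases t with i | w
    · exact TapeLim.const ho _
    · cases w <;> first | exact hE _ | exact hF _ | assumption | exact TapeLim.const ho _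

theorem sweepStore_self {ω : St.{u}} (h1 : ω.hd .h1 = 0) (h2 : ω.hd .h2 = 0) (h3 : ω.hd .h3 = 0) :
    sweepStore ω 0 (ω.hd .e) (fun k => ω.tp (.inr (.ee k))) (fun k => ω.tp (.inr (.found k)))
      (ω.tp (.inr .eta)) (ω.tp (.inr .hit)) = ω := by
  refine Store.ext (funext fun g => ?_) (funext fun t => ?_)
  · cases g <;> first | rfl | (symm; assumption)
  · rcases t with i | w
    · rfl
    · cases w <;> rfl

/-- The three heads `h1`, `h2`, `h3` run in parallel from `0`, so both mismatch tapes can be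
consulted for the same ordinal `ξ`, although different heads wrote them. The head `e` writes the new
row of the matrix at the same time. -/
theorem ex_sweep {ω : St.{u}} (m : Bool) (h1 : ω.hd .h1 = 0) (h2 : ω.hd .h2 = 0)
    (h3 : ω.hd .h3 = 0) (hf : ω.hd .f = 0) {N : Ordinal.{u}}
    (hu : ω.tp (.inr .u1) = Set.Iio N) :
    Ex (sweep m) ω ω (sweepStore ω N (ω.hd .e + N)
      (fun k => grow (ω.tp (.inr (.ee k)))
        (fun ξ => {z | z = ω.hd .e + ξ ∧ ξ ∈ candidates ω k}) N)
      (fun k => grow (ω.tp (.inr (.found k))) (fun ξ => {z | z = 0 ∧ ξ ∈ candidates ω k}) N)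
      (grow (ω.tp (.inr .eta)) (fun ξ => {z | z = ξ ∧ ξ ∈ candidates ω true}) N)
      (grow (ω.tp (.inr .hit)) (fun ξ => {z | z = 0 ∧ ω.hd .sc ∈ ω.tp (.inr .bit) ∧
        ξ ∈ candidates ω false ∧ ξ ∈ ω.tp (target m)}) N)) := by
  let K : Ordinal.{u} → St.{u} := fun x => sweepStore ω x (ω.hd .e + x)
      (fun k => grow (ω.tp (.inr (.ee k)))
        (fun ξ => {z | z = ω.hd .e + ξ ∧ ξ ∈ candidates ω k}) x)
      (fun k => grow (ω.tp (.inr (.found k))) (fun ξ => {z | z = 0 ∧ ξ ∈ candidates ω k}) x)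
      (grow (ω.tp (.inr .eta)) (fun ξ => {z | z = ξ ∧ ξ ∈ candidates ω true}) x)
      (grow (ω.tp (.inr .hit)) (fun ξ => {z | z = 0 ∧ ω.hd .sc ∈ ω.tp (.inr .bit) ∧
        ξ ∈ candidates ω false ∧ ξ ∈ ω.tp (target m)}) x)
  have h0 : K 0 = ω := by
    simp only [K, grow_zero, add_zero]
    exact sweepStore_self h1 h2 h3
  have hc : ∀ x k, candidate k ((K x).rd tapeGrp) ↔ x ∈ candidates ω k := by
    intro x k
    show (ω.hd .f ∉ ω.tp (.inr (.poison k)) ∧ _) ↔ _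
    rw [hf]
    rfl
  have ht : ∀ x, (K x).rd tapeGrp (target m) ↔ x ∈ ω.tp (target m) := by
    intro x
    cases m <;> rfl
  have hK : ∀ x, ω.Below (K x) := by
    intro x
    conv_lhs => rw [← h0]
    exact sweepStore_below ω zero_le (add_le_add_right zero_le _)
      (fun k => grow_mono _ _ zero_le) (fun k => grow_mono _ _ zero_le)
      (grow_mono _ _ zero_le) (grow_mono _ _ zero_le)
  have := Exec.loop_act (grp := tapeGrp) (b := fun r => r (.inr .u1)) (L := ω)
    (f := fun r t => match t with
      | .inr (.ee k) => r (.inr (.ee k)) ∨ candidate k r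
      | .inr .eta => r (.inr .eta) ∨ candidate true r
      | .inr .hit => r (.inr .hit) ∨ r (.inr .bit) ∧ candidate false r ∧ r (target m)
      | .inr (.found k) => r (.inr (.found k)) ∨ candidate k r
      | t => r t)
    (m := fun _ g => match g with
      | .h1 => .right
      | .h2 => .right
      | .h3 => .right
      | .e => .right
      | _ => .stay) K N ?_ ?_ ?_
    (fun o _ ho => sweepStore_lim ω ho (.of_isNormal .id ho) (.of_isNormal (add_isNormal _) ho)
      (fun k => .grow ho _ _) (fun k => .grow ho _ _) (.grow ho _ _) (.grow ho _ _))
    (fun x _ => hK x)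
  · rw [h0] at this
    exact this
  · intro i hi
    show i ∈ ω.tp (.inr .u1)
    rwa [hu]
  · show N ∉ ω.tp (.inr .u1)
    rw [hu]
    exact lt_irrefl N
  · refine fun i hi => Store.ext (funext fun g => ?_) (funext fun t => ?_)
    · cases g <;> first | rfl | exact add_assoc _ _ _
    · rcases t with j | w
      · exact Store.act_tp_eq Iff.rfl
      · cases w with
        | ee k =>
          exact Store.act_tp_grow (i ∈ candidates ω k) (or_congr Iff.rfl (hc i k)) rfl
            fun z => Iff.rfl
        | eta =>
          exact Store.act_tp_grow (i ∈ candidates ω true) (or_congr Iff.rfl (hc i true)) rfl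
            fun z => Iff.rfl
        | hit =>
          refine Store.act_tp_grow (ω.hd .sc ∈ ω.tp (.inr .bit) ∧
            i ∈ candidates ω false ∧ i ∈ ω.tp (target m))
            (or_congr Iff.rfl (and_congr Iff.rfl (and_congr (hc i false) (ht i)))) rfl fun z => ?_
          show _ ↔ z = ω.hd .f ∧ _
          rw [hf]
          rfl
        | found k =>
          refine Store.act_tp_grow (i ∈ candidates ω k) (or_congr Iff.rfl (hc i k)) rfl
            fun z => ?_
          show _ ↔ z = ω.hd .f ∧ _
          rw [hf]
          rfl
        | _ => exact Store.act_tp_eq Iff.rfl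

/-- Clear the tapes that were used for the current set. -/
def clear : Com :=
  .loop (fun r => r (.inr .u1)) <| .act
    (fun r t => match t with
      | .inr (.s _) => False
      | .inr (.pr _) => False
      | .inr (.b1 _) => False
      | .inr (.b3 _) => False
      | .inr .u1 => False
      | .inr .u3 => False
      | .inr .eta => r (.inr .eta) ∧ r (.inr .hit)
      | t => r t)
    fun _ g => match g with
      | .h1 => .right
      | .h2 => .right
      | .h3 => .right
      | _ => .stay

/-- The stores that occur in `clear`. -/
def clearStore (σ : St.{u}) (x : Ordinal.{u}) : St.{u} where
  hd
    | .h1 => x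
    | .h2 => x
    | .h3 => x
    | g => σ.hd g
  tp
    | .inr (.s k) => {z ∈ σ.tp (.inr (.s k)) | x ≤ z}
    | .inr (.pr k) => {z ∈ σ.tp (.inr (.pr k)) | x ≤ z}
    | .inr (.b1 k) => {z ∈ σ.tp (.inr (.b1 k)) | x ≤ z}
    | .inr (.b3 k) => {z ∈ σ.tp (.inr (.b3 k)) | x ≤ z}
    | .inr .u1 => {z ∈ σ.tp (.inr .u1) | x ≤ z}
    | .inr .u3 => {z ∈ σ.tp (.inr .u3) | x ≤ z}
    | .inr .eta => {z ∈ σ.tp (.inr .eta) | x ≤ z ∨ 0 ∈ σ.tp (.inr .hit)}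
    | t => σ.tp t

/-- Erasing makes tapes shrink, so the monotone criterion does not apply; but each cell settles as
soon as the eraser has passed it. -/
theorem TapeLim.remove {o : Ordinal.{u}} (ho : IsSuccLimit o) (A : Set Ordinal.{u}) (P : Prop) :
    TapeLim (fun j => {z ∈ A | j ≤ z ∨ P}) o {z ∈ A | o ≤ z ∨ P} := by
  refine .of_eventually fun ξ => ?_
  by_cases h : ξ < o
  · refine ⟨ξ + 1, ho.add_one_lt h, fun j hj _ => ?_⟩
    simp [not_le.2 h, not_le.2 (Order.add_one_le_iff.1 hj)]
  · refine ⟨0, ho.bot_lt, fun j _ hj => ?_⟩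
    simp [not_lt.1 h, (hj.trans_le (not_lt.1 h)).le]

/-- Erasing falls below the store it starts from, so a lower bound has to be supplied from outside.
In a segment it is the store at the beginning, where the tapes to be cleared are empty. -/
theorem ex_clear {σ L : St.{u}} (h1 : σ.hd .h1 = 0) (h2 : σ.hd .h2 = 0) (h3 : σ.hd .h3 = 0)
    (hf : σ.hd .f = 0) {N : Ordinal.{u}} (hu : σ.tp (.inr .u1) = Set.Iio N)
    (hL : ∀ x, L.Below (clearStore σ x)) : Ex clear L σ (clearStore σ N) := by
  have h0 : clearStore σ 0 = σ := by
    refine Store.ext (funext fun g => ?_) (funext fun t => ?_)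
    · cases g <;> first | rfl | (symm; assumption)
    · rcases t with i | w
      · rfl
      · cases w <;> first | rfl | (simp [clearStore])
  have := Exec.loop_act (grp := tapeGrp) (b := fun r => r (.inr .u1)) (L := L)
    (f := fun r t => match t with
      | .inr (.s _) => False
      | .inr (.pr _) => False
      | .inr (.b1 _) => False
      | .inr (.b3 _) => False
      | .inr .u1 => False
      | .inr .u3 => False
      | .inr .eta => r (.inr .eta) ∧ r (.inr .hit)
      | t => r t)
    (m := fun _ g => match g with
      | .h1 => .right
      | .h2 => .right
      | .h3 => .right
      | _ => .stay) (clearStore σ) N ?_ ?_ ?_ ?_ (fun x _ => hL x)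
  · rw [h0] at this
    exact this
  · intro i hi
    show i ∈ σ.tp (.inr .u1) ∧ i ≤ i
    rw [hu]
    exact ⟨hi, le_rfl⟩
  · show ¬ (N ∈ σ.tp (.inr .u1) ∧ _)
    rw [hu]
    exact fun h => lt_irrefl N h.1
  · have key : ∀ i (A : Set Ordinal.{u}), {z ∈ A | i ≤ z} \ {i} = {z ∈ A | i + 1 ≤ z} := by
      intro i A
      ext z
      simp only [Set.mem_sdiff, Set.mem_ofPred_eq, Set.mem_singleton_iff, Order.add_one_le_iff,
        lt_iff_le_and_ne, ne_comm (a := i), and_assoc, ne_eq]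
    refine fun i hi => Store.ext (funext fun g => ?_) (funext fun t => ?_)
    · cases g <;> rfl
    · rcases t with j | w
      · exact Store.act_tp_eq Iff.rfl
      · cases w with
        | s k => exact (Store.act_tp_false (fun h => h)).trans (key i _)
        | pr k => exact (Store.act_tp_false (fun h => h)).trans (key i _)
        | b1 k => exact (Store.act_tp_false (fun h => h)).trans (key i _)
        | b3 k => exact (Store.act_tp_false (fun h => h)).trans (key i _)
        | u1 => exact (Store.act_tp_false (fun h => h)).trans (key i _)
        | u3 => exact (Store.act_tp_false (fun h => h)).trans (key i _)
        | eta =>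
          have hr : (clearStore σ i).rd tapeGrp (.inr .hit) ↔ 0 ∈ σ.tp (.inr .hit) := by
            show σ.hd .f ∈ _ ↔ _
            rw [hf]
            rfl
          by_cases h : 0 ∈ σ.tp (.inr .hit)
          · refine (Store.act_tp_eq (by exact and_iff_left (hr.2 h))).trans ?_
            simp [clearStore, h]
          · refine (Store.act_tp_false (by exact mt And.right (mt hr.1 h))).trans ?_
            simpa [clearStore, h] using key i _
        | _ => exact Store.act_tp_eq Iff.rfl
  · refine fun o _ ho => ⟨fun g => ?_, fun t => ?_⟩
    · cases g <;> first | exact HeadLim.of_isNormal .id ho | exact HeadLim.const ho _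
    · have key : ∀ (A : Set Ordinal.{u}), TapeLim (fun j => {z ∈ A | j ≤ z}) o {z ∈ A | o ≤ z} := by
        intro A
        simpa using TapeLim.remove ho A False
      rcases t with j | w
      · exact TapeLim.const ho _
      · cases w <;> first | exact key _ | exact TapeLim.remove ho _ _ | exact TapeLim.const ho _

/-- The tapes that are never changed in the main loop. -/
def fixedTape : Tp → Prop
  | .inl _ => True
  | .inr (.z _) => True
  | .inr .mark => True
  | .inr .bit => True
  | .inr (.qb _) => True
  | .inr (.qe _) => True
  | .inr (.rho _) => True
  | .inr .r => True
  | .inr .jk => True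
  | _ => False

/-- The heads that are never moved in the main loop. -/
def fixedHead : Grp → Prop
  | .par => True
  | .in1 => True
  | .in2 => True
  | .in3 => True
  | .out => True
  | _ => False

/-- In a ready store everything that may decrease during a segment is already empty or zero. So such
a store bounds from below every store that keeps the fixed parts, does not move the script head back
and does not shrink the matrix. -/
theorem Store.Ready.below {σ ρ : St.{u}} (hσ : σ.Ready) (hsc : σ.hd .sc ≤ ρ.hd .sc)
    (hh : ∀ g, fixedHead g → ρ.hd g = σ.hd g) (ht : ∀ t, fixedTape t → ρ.tp t = σ.tp t)
    (hE : ∀ k, σ.tp (.inr (.ee k)) ⊆ ρ.tp (.inr (.ee k)))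
    (hM : σ.tp (.inr .em) ⊆ ρ.tp (.inr .em)) : σ.Below ρ := by
  refine ⟨fun g => ?_, fun t => ?_⟩
  · cases g <;> first
      | exact (hh _ (by trivial)).ge
      | assumption
      | exact hσ.q.le.trans zero_le
      | exact hσ.h1.le.trans zero_le
      | exact hσ.h2.le.trans zero_le
      | exact hσ.h3.le.trans zero_le
      | exact hσ.e.le.trans zero_le
      | exact hσ.f.le.trans zero_le
  · rcases t with i | w
    · exact (ht _ (by trivial)).ge
    · cases w <;> first
        | exact (ht _ (by trivial)).ge
        | exact hE _
        | assumption
        | exact (hσ.s _).le.trans (Set.empty_subset _)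
        | exact (hσ.pr _).le.trans (Set.empty_subset _)
        | exact (hσ.b1 _).le.trans (Set.empty_subset _)
        | exact (hσ.b3 _).le.trans (Set.empty_subset _)
        | exact (hσ.reached _).le.trans (Set.empty_subset _)
        | exact (hσ.poison _).le.trans (Set.empty_subset _)
        | exact (hσ.found _).le.trans (Set.empty_subset _)
        | exact (hσ.u1).le.trans (Set.empty_subset _)
        | exact (hσ.u3).le.trans (Set.empty_subset _)
        | exact (hσ.eta).le.trans (Set.empty_subset _)
        | exact (hσ.hit).le.trans (Set.empty_subset _)

/-- The instruction after the sweep. -/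
def closeRow : Com :=
  .seq (.act (fun r => r) fun _ g => if g = .sc then .right else .stay) <|
  .act (fun r t => match t with
      | .inr .em => True
      | .inr (.ee k) => r (.inr (.ee k)) ∨ r (.inr (.found k))
      | .inr .hit => r (.inr .hit) ∨ r (.inr .bit)
      | .inr (.found _) => False
      | .inr (.poison _) => False
      | .inr (.reached _) => False
      | t => r t)
    fun _ g => match g with | .sc => .right | _ => .stay

/-- Work through the part of a segment of the script that describes a set. -/
def segment (m : Bool) : Com :=
  .seq gather <| .seq walk <| .seq (resets [.h2]) <| .seq (sweep m) <| .seq closeRow <|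
  .seq (resets [.h1, .h2, .h3]) <| .seq clear <| resets [.h1, .h2, .h3, .q, .e]

/-- The store after a segment. -/
def segmentStore (σ : St.{u}) (sc : Ordinal.{u}) (E : Bool → Set Ordinal.{u})
    (M Eta Hit : Set Ordinal.{u}) : St.{u} where
  hd
    | .sc => sc
    | g => σ.hd g
  tp
    | .inr (.ee k) => E k
    | .inr .em => M
    | .inr .eta => Eta
    | .inr .hit => Hit
    | t => σ.tp t

/-- The segment starts at script cell `p`: `i` bits for the elements of the current set, then the
cell `p + i`, whose bit allows a hit by the search, then the cell `p + i + 1`, whose bit forces one.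
`R k` is the new row of the matrix, and `H` says that there is a hit. The tape `eta` keeps the
ordinals in the second code only in case of a hit. -/
theorem ex_segment {σ : St.{u}} (hσ : σ.Ready) (m : Bool) {N p i : Ordinal.{u}}
    (hp : σ.hd .sc = p)
    (hN : ∀ k, ∃ c ∈ σ.tp (.inr (.qe k)), c < godelBase N)
    (hmin : ∀ m < N, ¬ ∀ k, ∃ c ∈ σ.tp (.inr (.qe k)), c < godelBase m)
    (hq : ∀ k, ∀ c ∈ σ.tp (.inr (.qb k)), c < godelBase N)
    (hm : ∀ j < i, p + j ∈ σ.tp (.inr .mark)) (hm' : p + i ∉ σ.tp (.inr .mark))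
    (h₁ : ∀ j < i, ∀ x < N, (N + 1) * j + x ∉ σ.tp (.inr .em))
    (h₂ : ∀ j < i, (N + 1) * j + N ∈ σ.tp (.inr .em)) {R : Bool → Set Ordinal.{u}}
    (hR : ∀ k, R k = {η | η < N ∧
      (∀ j < i, p + j ∈ σ.tp (.inr .bit) → (N + 1) * j + N ∈ σ.tp (.inr (.ee k))) ∧
      ((∃ y, godelPair (η, y) ∈ σ.tp (.inr (.qb k))) ∨ η ∈ σ.tp (.inr (.rho k))) ∧
      ∀ a < N, (godelPair (a, η) ∈ σ.tp (.inr (.qb k)) ↔ ∃ j < i, p + j ∈ σ.tp (.inr .bit) ∧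
        (N + 1) * j + a ∈ σ.tp (.inr (.ee k)))}) {H : Prop}
    (hH : H ↔ (p + i ∈ σ.tp (.inr .bit) ∧ ∃ η ∈ R false, η ∈ σ.tp (target m)) ∨
      p + i + 1 ∈ σ.tp (.inr .bit)) :
    Ex (segment m) σ σ (segmentStore σ (p + i + 2)
      (fun k => {z | z ∈ σ.tp (.inr (.ee k)) ∨ (∃ η ∈ R k, z = (N + 1) * i + η) ∨
        z = (N + 1) * i + N ∧ (R k).Nonempty})
      {z | z ∈ σ.tp (.inr .em) ∨ z = (N + 1) * i + N} {η | η ∈ R true ∧ H} {z | z = 0 ∧ H}) := by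
  set S := gathered σ N p i with hS
  set Po := poisoned σ N p i with hPo
  set τ := gatherStore σ (p + i) ((N + 1) * i) 0 S Po with hτ
  have hτ0 : walkStore τ 0 0 0 0 = τ := below_walkStore hσ.q rfl hσ.h2 hσ.h3 hσ.b1 hσ.b3 hσ.pr
    hσ.reached hσ.u1 hσ.u3
  set ω₁ := walkStore τ (godelBase N) N 0 0 with hω₁
  set ω := ω₁.zeroHds [.h2] with hω
  have hωe : ω.hd .e = (N + 1) * i := rfl
  have hωs : ω.hd .sc = p + i := rfl
  -- the candidates
  have hSm : ∀ k a, a ∈ S k ↔ a < N ∧ ∃ j < i, p + j ∈ σ.tp (.inr .bit) ∧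
      (N + 1) * j + a ∈ σ.tp (.inr (.ee k)) := by
    intro k a
    rw [hS, gathered, mem_grow_empty]
    constructor
    · rintro ⟨j, hj, h, h', h''⟩
      exact ⟨h, j, hj, h', h''⟩
    · rintro ⟨h, j, hj, h', h''⟩
      exact ⟨j, hj, h, h', h''⟩
  have hqN : ∀ k a b, godelPair (a, b) ∈ σ.tp (.inr (.qb k)) → a < N ∧ b < N :=
    fun k a b h => lt_godelBase_iff.1 (hq k _ h)
  -- Below `N` the tests of the machine amount to the defining conditions of `R k`, because the walk
  -- has compared all pairs in the square `N × N`.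
  have hcand : ∀ k ξ, ξ < N → (ξ ∈ candidates ω k ↔ ξ ∈ R k) := by
    intro k ξ hξ
    rw [hR]
    refine ⟨fun ⟨c₁, c₂, c₃, c₄⟩ => ⟨hξ, fun j hj hb => ?_, ?_, fun a ha => ?_⟩,
      fun ⟨_, c₁, c₂, c₃⟩ => ⟨?_, ?_, ?_, ?_⟩⟩
    · by_contra hc
      exact c₁ (mem_grow_empty.2 ⟨j, hj, rfl, hb, hc⟩)
    · refine c₂.imp ?_ fun h => h
      rintro ⟨b, -, h⟩
      exact ⟨b, h⟩
    · have hg : godelPair (a, ξ) < godelBase N := lt_godelBase_iff.2 ⟨ha, hξ⟩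
      -- A disagreement would have been recorded on `b1` or on `b3`, according to the order of `a`
      -- and `ξ`.
      have : godelPair (a, ξ) ∈ σ.tp (.inr (.qb k)) ↔ a ∈ S k := by
        by_contra hc
        rcases lt_or_ge a ξ with h | h
        · exact c₃ ⟨a, h, hg, hc⟩
        · exact c₄ ⟨a, h, hg, hc⟩
      rw [this, hSm]
      exact and_iff_right ha
    · intro h
      obtain ⟨j, hj, -, hb, hc⟩ := mem_grow_empty.1 h
      exact hc (c₁ j hj hb)
    · refine c₂.imp ?_ fun h => h
      rintro ⟨b, h⟩
      exact ⟨b, hq k _ h, h⟩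
    · rintro ⟨a, -, hg, hc⟩
      have ha := (lt_godelBase_iff.1 hg).1
      exact hc ((c₃ a ha).trans ((hSm k a).trans (and_iff_right ha)).symm)
    · rintro ⟨a, -, hg, hc⟩
      have ha := (lt_godelBase_iff.1 hg).1
      exact hc ((c₃ a ha).trans ((hSm k a).trans (and_iff_right ha)).symm)
  have hRN : ∀ k, ∀ ξ ∈ R k, ξ < N := by
    intro k ξ h
    rw [hR] at h
    exact h.1
  set E : Bool → Set Ordinal.{u} := fun k => grow (ω.tp (.inr (.ee k)))
    (fun ξ => {z | z = ω.hd .e + ξ ∧ ξ ∈ candidates ω k}) N with hE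
  set Fo : Bool → Set Ordinal.{u} := fun k => grow (ω.tp (.inr (.found k)))
    (fun ξ => {z | z = 0 ∧ ξ ∈ candidates ω k}) N with hFo
  set Eta := grow (ω.tp (.inr .eta)) (fun ξ => {z | z = ξ ∧ ξ ∈ candidates ω true}) N with hEta
  set Hit := grow (ω.tp (.inr .hit)) (fun ξ => {z | z = 0 ∧ ω.hd .sc ∈ ω.tp (.inr .bit) ∧
    ξ ∈ candidates ω false ∧ ξ ∈ ω.tp (target m)}) N with hHit
  set σ₂ := sweepStore ω N (ω.hd .e + N) E Fo Eta Hit with hσ₂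
  have hEm : ∀ k z, z ∈ E k ↔ z ∈ σ.tp (.inr (.ee k)) ∨ ∃ η ∈ R k, z = (N + 1) * i + η := by
    refine fun k z => or_congr Iff.rfl ⟨?_, ?_⟩
    · rintro ⟨ξ, hξ, h, h'⟩
      exact ⟨ξ, (hcand k ξ hξ).1 h', h⟩
    · rintro ⟨ξ, h, h'⟩
      exact ⟨ξ, hRN k ξ h, h', (hcand k ξ (hRN k ξ h)).2 h⟩
  have hFm : ∀ k, 0 ∈ Fo k ↔ (R k).Nonempty := by
    intro k
    refine (or_iff_right ?_).trans ⟨?_, ?_⟩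
    · show 0 ∉ σ.tp (.inr (.found k))
      rw [hσ.found]
      exact Set.notMem_empty _
    · rintro ⟨ξ, hξ, -, h⟩
      exact ⟨ξ, (hcand k ξ hξ).1 h⟩
    · rintro ⟨ξ, h⟩
      exact ⟨ξ, hRN k ξ h, rfl, (hcand k ξ (hRN k ξ h)).2 h⟩
  have hηm : ∀ z, z ∈ Eta ↔ z ∈ R true := by
    refine fun z => (or_iff_right ?_).trans ⟨?_, ?_⟩
    · show z ∉ σ.tp (.inr .eta)
      rw [hσ.eta]
      exact Set.notMem_empty _
    · rintro ⟨ξ, hξ, rfl, h⟩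
      exact (hcand true z hξ).1 h
    · exact fun h => ⟨z, hRN true z h, rfl, (hcand true z (hRN true z h)).2 h⟩
  have htm : ω.tp (target m) = σ.tp (target m) := by cases m <;> rfl
  have hhm : ∀ z, z ∈ Hit ↔ z = 0 ∧ p + i ∈ σ.tp (.inr .bit) ∧
      ∃ η ∈ R false, η ∈ σ.tp (target m) := by
    refine fun z => (or_iff_right ?_).trans ⟨?_, ?_⟩
    · show z ∉ σ.tp (.inr .hit)
      rw [hσ.hit]
      exact Set.notMem_empty _
    · rintro ⟨ξ, hξ, rfl, h, h', h''⟩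
      rw [htm] at h''
      exact ⟨rfl, h, ξ, (hcand false ξ hξ).1 h', h''⟩
    · rintro ⟨rfl, h, ξ, h', h''⟩
      have hξ := hRN false ξ h'
      rw [← htm] at h''
      exact ⟨ξ, hξ, rfl, h, (hcand false ξ hξ).2 h', h''⟩
  -- after closing the row
  set E' : Bool → Set Ordinal.{u} := fun k => {z | z ∈ σ.tp (.inr (.ee k)) ∨
    (∃ η ∈ R k, z = (N + 1) * i + η) ∨ z = (N + 1) * i + N ∧ (R k).Nonempty} with hE'
  set M' : Set Ordinal.{u} := {z | z ∈ σ.tp (.inr .em) ∨ z = (N + 1) * i + N} with hM'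
  set H' : Set Ordinal.{u} := {z | z = 0 ∧ H} with hH'
  let σ₃ : St.{u} :=
    { hd := fun g => match g with
        | .sc => p + i + 2
        | g => σ₂.hd g
      tp := fun t => match t with
        | .inr (.ee k) => E' k
        | .inr .em => M'
        | .inr .hit => H'
        | .inr (.found _) => ∅
        | .inr (.poison _) => ∅
        | .inr (.reached _) => ∅
        | t => σ₂.tp t }
  have hE₁ : ∀ k, σ.tp (.inr (.ee k)) ⊆ E k := fun k z h => (hEm k z).2 (.inl h)
  have hE₂ : ∀ k, σ.tp (.inr (.ee k)) ⊆ E' k := fun k z h => .inl h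
  have hM₁ : σ.tp (.inr .em) ⊆ M' := fun z h => .inl h
  have hsc : σ.hd .sc ≤ p + i := hp.le.trans le_self_add
  have hsc' : σ.hd .sc ≤ p + i + 2 := hsc.trans le_self_add
  have fx : ∀ {ρ : St.{u}}, (∀ g, fixedHead g → ρ.hd g = σ.hd g) ↔ ρ.hd .par = σ.hd .par ∧
      ρ.hd .in1 = σ.hd .in1 ∧ ρ.hd .in2 = σ.hd .in2 ∧ ρ.hd .in3 = σ.hd .in3 ∧
      ρ.hd .out = σ.hd .out := by
    refine fun {ρ} => ⟨fun h => ⟨h _ trivial, h _ trivial, h _ trivial, h _ trivial, h _ trivial⟩,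
      fun h g hg => ?_⟩
    cases g <;> first | exact hg.elim | tauto
  have bτ : σ.Below τ := hσ.below hsc (fx.2 ⟨rfl, rfl, rfl, rfl, rfl⟩)
    (by rintro (_ | w) h; · rfl
        cases w <;> first | rfl | exact h.elim) (fun _ => subset_rfl) subset_rfl
  have bω : σ.Below ω := hσ.below hsc (fx.2 ⟨rfl, rfl, rfl, rfl, rfl⟩)
    (by rintro (_ | w) h; · rfl
        cases w <;> first | rfl | exact h.elim) (fun _ => subset_rfl) subset_rfl
  have b2 : σ.Below σ₂ := hσ.below hsc (fx.2 ⟨rfl, rfl, rfl, rfl, rfl⟩)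
    (by rintro (_ | w) h; · rfl
        cases w <;> first | rfl | exact h.elim) hE₁ subset_rfl
  have hf₂ : σ₂.hd .f = 0 := hσ.f
  have hz : ∀ g, σ.tp (.inr (.z g)) = {0} := hσ.z
  have c₃ : Ex closeRow σ σ₂ σ₃ := by
    refine .seq (σ₁ := σ₂.setHd .sc (p + i + 1)) (.act _ _ b2 ?_) (.act _ _ ?_ ?_)
    · have := act_setHd_right σ₂ .sc (p + i)
      have h : σ₂.setHd .sc (p + i) = σ₂ := setHd_of_eq rfl
      rwa [h] at this
    · exact b2.trans (below_setHd (show p + i ≤ p + i + 1 from le_self_add))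
    · refine Store.ext (funext fun g => ?_) (funext fun t => ?_)
      · cases g <;> first | rfl | skip
        show p + i + 1 + 1 = p + i + 2
        rw [add_assoc, one_add_one_eq_two]
      · rcases t with j | w
        · exact Store.act_tp_eq Iff.rfl
        -- The flags occupy at most cell `0`, where their head stands, so a single write clears
        -- them.
        · have fz : ∀ A : Set Ordinal.{u}, (∀ z ∈ A, z = 0) → A \ {σ₂.hd .f} = ∅ := by
            intro A hA
            rw [hf₂]
            ext z
            simpa using hA z
          cases w with
          | em =>
            refine (Store.act_tp_or (P := True) (by simp)).trans ?_
            ext z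
            refine or_congr Iff.rfl (and_iff_left trivial)
          | ee k =>
            have hF : σ₂.hd .f ∈ Fo k ↔ 0 ∈ Fo k := by rw [hf₂]
            · refine (Store.act_tp_or (P := 0 ∈ Fo k) (by exact or_congr Iff.rfl hF)).trans ?_
              ext z
              show (z ∈ E k ∨ z = (N + 1) * i + N ∧ _) ↔ _
              rw [hEm, hFm, or_assoc]
              rfl
          | hit =>
            refine (Store.act_tp_or (P := p + i + 1 ∈ σ.tp (.inr .bit))
              (by exact Iff.rfl)).trans ?_
            ext z
            show (z ∈ Hit ∨ z = σ₂.hd .f ∧ _) ↔ z = 0 ∧ H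
            rw [hf₂, hhm, hH, ← and_or_left]
          | found k =>
            refine (Store.act_tp_false (fun h => h)).trans (fz _ ?_)
            rintro z (h | ⟨ξ, hξ, h, -⟩)
            · rw [show ω.tp (.inr (.found k)) = ∅ from hσ.found k] at h
              exact h.elim
            · exact h
          | poison k =>
            refine (Store.act_tp_false (fun h => h)).trans (fz _ ?_)
            intro z h
            obtain ⟨ξ, hξ, h, -⟩ := mem_grow_empty.1 h
            exact h
          | reached k => exact (Store.act_tp_false (fun h => h)).trans (fz _ fun z h => h.1)
          | _ => exact Store.act_tp_eq Iff.rfl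
  set σ₄ := σ₃.zeroHds [.h1, .h2, .h3] with hσ₄
  have b4 : σ.Below σ₄ := hσ.below hsc' (fx.2 ⟨rfl, rfl, rfl, rfl, rfl⟩)
    (by rintro (_ | w) h; · rfl
        cases w <;> first | rfl | exact h.elim) hE₂ hM₁
  have c₅ : Ex clear σ σ₄ (clearStore σ₄ N) := ex_clear (σ := σ₄) rfl rfl rfl hσ.f rfl fun x =>
    hσ.below hsc' (fx.2 ⟨rfl, rfl, rfl, rfl, rfl⟩)
      (by rintro (_ | w) h; · rfl
          cases w <;> first | rfl | exact h.elim) hE₂ hM₁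
  have key : (clearStore σ₄ N).zeroHds [.h1, .h2, .h3, .q, .e] =
      segmentStore σ (p + i + 2) E' M' {η | η ∈ R true ∧ H} H' := by
    -- All the working tapes live below `N`, so erasing the cells below `N` empties them and
    -- restores a ready store if there was no hit.
    have cl : ∀ A : Set Ordinal.{u}, (∀ z ∈ A, z < N) → {z ∈ A | N ≤ z} = ∅ := by
      intro A hA
      ext z
      simpa using hA z
    refine Store.ext (funext fun g => ?_) (funext fun t => ?_)
    · cases g <;> first
        | rfl
        | exact hσ.q.symm
        | exact hσ.h1.symm
        | exact hσ.h2.symm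
        | exact hσ.h3.symm
        | exact hσ.e.symm
    · rcases t with j | w
      · rfl
      · cases w with
        | s k => exact (cl _ fun z h => ((hSm k z).1 h).1).trans (hσ.s k).symm
        | pr k =>
          refine (cl _ ?_).trans (hσ.pr k).symm
          rintro z ⟨b, h, -⟩
          exact (lt_godelBase_iff.1 h).1
        | b1 k =>
          refine (cl _ ?_).trans (hσ.b1 k).symm
          rintro z ⟨b, -, h, -⟩
          exact (lt_godelBase_iff.1 h).2
        | b3 k =>
          refine (cl _ ?_).trans (hσ.b3 k).symm
          rintro z ⟨b, -, h, -⟩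
          exact (lt_godelBase_iff.1 h).2
        | u1 => exact (cl _ fun z h => h).trans hσ.u1.symm
        | u3 => exact (cl _ fun z h => h).trans hσ.u3.symm
        | found k => exact (hσ.found k).symm
        | poison k => exact (hσ.poison k).symm
        | reached k => exact (hσ.reached k).symm
        | eta =>
          ext z
          show z ∈ Eta ∧ (N ≤ z ∨ 0 = 0 ∧ H) ↔ _
          rw [hηm]
          refine and_congr_right fun h => ?_
          simp [not_le.2 (hRN true z h)]
        | _ => rfl
  refine .seq (ex_gather hσ hp hm hm' h₁ h₂) <| .seq (Exec.mono (ex_walk hσ.f hz hτ0 hN hmin) bτ) <|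
    .seq (ex_resets (σ := ω₁) hz _ bω) <|
    .seq (Exec.mono (ex_sweep (ω := ω) m rfl rfl rfl hσ.f rfl) bω) <|
    .seq c₃ <| .seq (ex_resets (σ := σ₃) hz _ b4) <| .seq c₅ ?_
  rw [← key]
  refine ex_resets (σ := clearStore σ₄ N) hz _ ?_
  rw [key]
  exact hσ.below hsc' (fx.2 ⟨rfl, rfl, rfl, rfl, rfl⟩)
      (by rintro (_ | w) h; · rfl
          cases w <;> first | rfl | exact h.elim) hE₂ hM₁

/-! ### The main loop -/

/-- The position of the `i`-th segment of a script with data blocks of lengths `len`. -/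
def segPos (len : Ordinal.{u} → Ordinal.{u}) (i : Ordinal.{u}) : Ordinal.{u} :=
  ordSum (fun i => i + 2 + len i + 1) i

/-- Segment `i` consists of `i` membership bits, two control cells, `len i` cells of data and one
unmarked cell that closes the data. -/
theorem segPos_add_one (len : Ordinal.{u} → Ordinal.{u}) (i : Ordinal.{u}) :
    segPos len (i + 1) = segPos len i + i + 2 + len i + 1 := by
  rw [segPos, ordSum_add_one, ← segPos]
  simp only [add_assoc]

theorem segPos_isNormal (len : Ordinal.{u} → Ordinal.{u}) : IsNormal (segPos len) :=
  ordSum_isNormal fun _ => (zero_le).trans_lt (lt_add_one _)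

/-- Work through the segments of the script until a set is found. -/
def mainLoop (m : Bool) : Com :=
  .loop (fun r => ¬ r (.inr .hit)) <| .seq (segment m) <|
    .ite (fun r => r (.inr .hit)) (resets []) skipData

/-- The matrix with the rows `R j`, for `j < i`. -/
def matrix (N : Ordinal.{u}) (R : Ordinal.{u} → Set Ordinal.{u}) (i : Ordinal.{u}) :
    Set Ordinal.{u} :=
  grow ∅ (fun j => {z | (∃ η ∈ R j, z = (N + 1) * j + η) ∨ z = (N + 1) * j + N ∧ (R j).Nonempty}) i

theorem mem_matrix_row {N : Ordinal.{u}} {R : Ordinal.{u} → Set Ordinal.{u}} {i j a : Ordinal.{u}}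
    (hR : ∀ j < i, ∀ η ∈ R j, η < N) (ha : a < N) :
    (N + 1) * j + a ∈ matrix N R i ↔ j < i ∧ a ∈ R j := by
  rw [matrix, mem_grow_empty]
  have ha' := ha.trans (lt_add_one N)
  constructor
  · rintro ⟨ξ, hξ, ⟨η, h, h'⟩ | ⟨h, -⟩⟩
    · obtain ⟨rfl, rfl⟩ := (mul_add_inj ha' ((hR ξ hξ η h).trans (lt_add_one N))).1 h'
      exact ⟨hξ, h⟩
    · exact absurd ((mul_add_inj ha' (lt_add_one N)).1 h).2 ha.ne
  · rintro ⟨hj, h⟩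
    exact ⟨j, hj, .inl ⟨a, h, rfl⟩⟩

theorem mem_matrix_end {N : Ordinal.{u}} {R : Ordinal.{u} → Set Ordinal.{u}} {i j : Ordinal.{u}}
    (hR : ∀ j < i, ∀ η ∈ R j, η < N) :
    (N + 1) * j + N ∈ matrix N R i ↔ j < i ∧ (R j).Nonempty := by
  rw [matrix, mem_grow_empty]
  constructor
  · rintro ⟨ξ, hξ, ⟨η, h, h'⟩ | ⟨h, h'⟩⟩
    · have := hR ξ hξ η h
      exact absurd ((mul_add_inj (lt_add_one N) (this.trans (lt_add_one N))).1 h').2 this.ne'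
    · obtain ⟨rfl, -⟩ := (mul_add_inj (lt_add_one N) (lt_add_one N)).1 h
      exact ⟨hξ, h'⟩
  · rintro ⟨hj, h⟩
    exact ⟨j, hj, .inr ⟨rfl, h⟩⟩

theorem segmentStore_lim (σ : St.{u}) {sc : Ordinal.{u} → Ordinal.{u}}
    {E : Ordinal.{u} → Bool → Set Ordinal.{u}} {M : Ordinal.{u} → Set Ordinal.{u}}
    (Eta Hit : Set Ordinal.{u}) {o : Ordinal.{u}} (ho : IsSuccLimit o)
    (hsc : HeadLim sc o (sc o)) (hE : ∀ k, TapeLim (fun j => E j k) o (E o k))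
    (hM : TapeLim M o (M o)) :
    StoreLim (fun j => segmentStore σ (sc j) (E j) (M j) Eta Hit) o := by
  refine ⟨fun g => ?_, fun t => ?_⟩
  · cases g <;> first | assumption | exact HeadLim.const ho _
  · rcases t with i | w
    · exact TapeLim.const ho _
    · cases w <;> first | exact hE _ | assumption | exact TapeLim.const ho _

theorem segmentStore_below (σ : St.{u}) {sc sc' : Ordinal.{u}} {E E' : Bool → Set Ordinal.{u}}
    {M M' Eta Eta' Hit Hit' : Set Ordinal.{u}} (hsc : sc ≤ sc') (hE : ∀ k, E k ⊆ E' k)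
    (hM : M ⊆ M') (hη : Eta ⊆ Eta') (hh : Hit ⊆ Hit') :
    (segmentStore σ sc E M Eta Hit).Below (segmentStore σ sc' E' M' Eta' Hit') := by
  refine ⟨fun g => ?_, fun t => ?_⟩
  · cases g <;> first | exact le_rfl | assumption
  · rcases t with i | w
    · exact subset_rfl
    · cases w <;> first | exact subset_rfl | exact hE _ | assumption

theorem segmentStore_segmentStore (σ : St.{u}) (sc sc' : Ordinal.{u})
    (E E' : Bool → Set Ordinal.{u}) (M M' Eta Eta' Hit Hit' : Set Ordinal.{u}) :
    segmentStore (segmentStore σ sc E M Eta Hit) sc' E' M' Eta' Hit' =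
      segmentStore σ sc' E' M' Eta' Hit' := by
  refine Store.ext (funext fun g => ?_) (funext fun t => ?_)
  · cases g <;> rfl
  · rcases t with i | w
    · rfl
    · cases w <;> rfl

theorem segmentStore_setHd (σ : St.{u}) (sc sc' : Ordinal.{u}) (E : Bool → Set Ordinal.{u})
    (M Eta Hit : Set Ordinal.{u}) : (segmentStore σ sc E M Eta Hit).setHd .sc sc' =
      segmentStore σ sc' E M Eta Hit := by
  refine Store.ext (funext fun g => ?_) rfl
  cases g <;> simp [Store.setHd, segmentStore]

theorem Store.Ready.segmentStore {σ : St.{u}} (hσ : σ.Ready) (sc : Ordinal.{u})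
    (E : Bool → Set Ordinal.{u}) (M : Set Ordinal.{u}) :
    (segmentStore σ sc E M ∅ ∅).Ready :=
  ⟨hσ.z, hσ.q, hσ.h1, hσ.h2, hσ.h3, hσ.e, hσ.f, hσ.s, hσ.pr, hσ.b1, hσ.b3, hσ.reached, hσ.poison,
    hσ.found, hσ.u1, hσ.u3, rfl, rfl⟩

/-- Before round `i` the matrix holds the rows `R j` for `j < i`, and by `ex_segment` round `i` adds
the row `R i`. The recursion for `R` refers to earlier rows only. At the first hit the data are not
skipped, so the script head is left at the data of segment `h`. -/
theorem ex_mainLoop {σ : St.{u}} (hσ : σ.Ready) (m : Bool) (hsc : σ.hd .sc = 0)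
    (hee : ∀ k, σ.tp (.inr (.ee k)) = ∅) (hem : σ.tp (.inr .em) = ∅) {N h : Ordinal.{u}}
    (hN : ∀ k, ∃ c ∈ σ.tp (.inr (.qe k)), c < godelBase N)
    (hmin : ∀ m < N, ¬ ∀ k, ∃ c ∈ σ.tp (.inr (.qe k)), c < godelBase m)
    (hq : ∀ k, ∀ c ∈ σ.tp (.inr (.qb k)), c < godelBase N) (len : Ordinal.{u} → Ordinal.{u})
    (hm₁ : ∀ i ≤ h, ∀ j < i, segPos len i + j ∈ σ.tp (.inr .mark))
    (hm₂ : ∀ i ≤ h, segPos len i + i ∉ σ.tp (.inr .mark))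
    (hm₃ : ∀ i < h, ∀ x < len i, segPos len i + i + 2 + x ∈ σ.tp (.inr .mark))
    (hm₄ : ∀ i < h, segPos len i + i + 2 + len i ∉ σ.tp (.inr .mark))
    (R : Ordinal.{u} → Bool → Set Ordinal.{u})
    (hR : ∀ i ≤ h, ∀ k, R i k = {η | η < N ∧
      (∀ j < i, segPos len i + j ∈ σ.tp (.inr .bit) → (R j k).Nonempty) ∧
      ((∃ y, godelPair (η, y) ∈ σ.tp (.inr (.qb k))) ∨ η ∈ σ.tp (.inr (.rho k))) ∧
      ∀ a < N, (godelPair (a, η) ∈ σ.tp (.inr (.qb k)) ↔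
        ∃ j < i, segPos len i + j ∈ σ.tp (.inr .bit) ∧ a ∈ R j k)})
    (H : Ordinal.{u} → Prop) (hH : ∀ i ≤ h, H i ↔ (segPos len i + i ∈ σ.tp (.inr .bit) ∧
      ∃ η ∈ R i false, η ∈ σ.tp (target m)) ∨ segPos len i + i + 1 ∈ σ.tp (.inr .bit))
    (hh : H h) (hlt : ∀ i < h, ¬ H i) :
    ∃ E M, Ex (mainLoop m) σ σ (segmentStore σ (segPos len h + h + 2) E M (R h true) {0}) := by
  let E : Ordinal.{u} → Bool → Set Ordinal.{u} := fun i k => matrix N (fun j => R j k) i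
  let M : Ordinal.{u} → Set Ordinal.{u} := grow ∅ fun j => {z | z = (N + 1) * j + N}
  let S : Ordinal.{u} → St.{u} := fun i => segmentStore σ (segPos len i) (E i) (M i) ∅ ∅
  have hRN : ∀ i ≤ h, ∀ k, ∀ η ∈ R i k, η < N := by
    intro i hi k η hη
    rw [hR i hi] at hη
    exact hη.1
  have hEr : ∀ i ≤ h, ∀ j < i, ∀ k, ∀ a < N, (N + 1) * j + a ∈ E i k ↔ a ∈ R j k :=
    fun i hi j hj k a ha =>
      (mem_matrix_row (fun j hj => hRN j (hj.le.trans hi) k) ha).trans (and_iff_right hj)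
  have hEe : ∀ i ≤ h, ∀ j < i, ∀ k, (N + 1) * j + N ∈ E i k ↔ (R j k).Nonempty :=
    fun i hi j hj k =>
      (mem_matrix_end (fun j hj => hRN j (hj.le.trans hi) k)).trans (and_iff_right hj)
  have hEs : ∀ i k, {z | z ∈ E i k ∨ (∃ η ∈ R i k, z = (N + 1) * i + η) ∨
      z = (N + 1) * i + N ∧ (R i k).Nonempty} = E (i + 1) k :=
    fun i k => (grow_add_one _ _ _).symm
  have hMs : ∀ i, {z | z ∈ M i ∨ z = (N + 1) * i + N} = M (i + 1) :=
    fun i => (grow_add_one _ _ _).symm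
  have hS0 : S 0 = σ := by
    refine Store.ext (funext fun g => ?_) (funext fun t => ?_)
    · cases g <;> first | rfl | exact (ordSum_zero _).trans hsc.symm
    · rcases t with i | w
      · rfl
      · cases w <;> first
          | rfl
          | exact (grow_zero _ _).trans (hee _).symm
          | exact (grow_zero _ _).trans hem.symm
          | exact hσ.eta.symm
          | exact hσ.hit.symm
  have hseg : ∀ i ≤ h, Ex (segment m) (S i) (S i) (segmentStore σ (segPos len i + i + 2) (E (i + 1))
      (M (i + 1)) {η | η ∈ R i true ∧ H i} {z | z = 0 ∧ H i}) := by
    intro i hi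
    have := ex_segment (σ := S i) (hσ.segmentStore _ _ _) m (N := N) (p := segPos len i) (i := i) rfl
      hN hmin hq (hm₁ i hi) (hm₂ i hi) ?_ ?_ (R := R i) ?_ (H := H i) ?_
    · rw [segmentStore_segmentStore] at this
      simp only [show ∀ k, (S i).tp (.inr (.ee k)) = E i k from fun _ => rfl,
        show (S i).tp (.inr .em) = M i from rfl, hEs, hMs] at this
      exact this
    · intro j hj x hx hc
      obtain ⟨j', -, h'⟩ := mem_grow_empty.1 hc
      exact absurd ((mul_add_inj (hx.trans (lt_add_one N)) (lt_add_one N)).1 h').2 hx.ne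
    · intro j hj
      exact mem_grow_empty.2 ⟨j, hj, rfl⟩
    · intro k
      rw [hR i hi]
      ext η
      refine and_congr Iff.rfl (and_congr (forall_congr' fun j => forall_congr' fun hj =>
        imp_congr Iff.rfl (hEe i hi j hj k).symm) (and_congr Iff.rfl (forall_congr' fun a =>
        forall_congr' fun ha => iff_congr Iff.rfl (exists_congr fun j => and_congr_right fun hj =>
          and_congr Iff.rfl (hEr i hi j hj k a ha).symm))))
    · have ht : (S i).tp (target m) = σ.tp (target m) := by cases m <;> rfl
      rw [ht]
      exact hH i hi
  have hSm : ∀ i, σ.Below (S i) := by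
    intro i
    conv_lhs => rw [← hS0]
    exact segmentStore_below σ ((segPos_isNormal len).monotone zero_le)
      (fun k => grow_mono _ _ zero_le) (grow_mono _ _ zero_le) subset_rfl subset_rfl
  -- The loop test fails after `h + 1` rounds; the last stage differs from the others since it
  -- contains the hit and lies before the data of segment `h`.
  let Fin : St.{u} := segmentStore σ (segPos len h + h + 2) (E (h + 1)) (M (h + 1)) (R h true) {0}
  open Classical in
  let K : Ordinal.{u} → St.{u} := fun i => if i ≤ h then S i else Fin
  have hK : ∀ i ≤ h, K i = S i := fun i hi => if_pos hi
  have hKf : K (h + 1) = Fin := if_neg (not_le.2 (lt_add_one h))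
  refine ⟨E (h + 1), M (h + 1), ?_⟩
  have hf : σ.hd .f = 0 := hσ.f
  have := Exec.loop (grp := tapeGrp) (b := fun r => ¬ r (.inr .hit)) (L := σ)
    (c := .seq (segment m) <| .ite (fun r => r (.inr .hit)) (resets []) skipData)
    K (h + 1) ?_ ?_ ?_ ?_ ?_
  · rw [hK 0 zero_le, hS0, hKf] at this
    exact this
  · intro i hi
    rw [hK i (Order.lt_add_one_iff.1 hi)]
    exact fun hc => hc
  · rw [hKf]
    exact not_not.2 hf
  · intro i hi
    have hi := Order.lt_add_one_iff.1 hi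
    rw [hK i hi]
    have b : ∀ Eta Hit : Set Ordinal.{u}, (S i).Below (segmentStore σ (segPos len i + i + 2)
        (E (i + 1)) (M (i + 1)) Eta Hit) := fun Eta Hit =>
      segmentStore_below σ (le_self_add.trans le_self_add)
        (fun k => grow_mono _ _ (lt_add_one i).le) (grow_mono _ _ (lt_add_one i).le)
        (Set.empty_subset _) (Set.empty_subset _)
    refine .seq (hseg i hi) ?_
    rcases hi.lt_or_eq with hi' | rfl
    · rw [hK (i + 1) (Order.add_one_le_iff.2 hi')]
      refine Exec.ite_false (b _ _) (fun hc => hlt i hi' hc.2) ?_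
      have e₁ : {η | η ∈ R i true ∧ H i} = ∅ := by
        ext η
        simp [hlt i hi']
      have e₂ : {z : Ordinal.{u} | z = 0 ∧ H i} = ∅ := by
        ext η
        simp [hlt i hi']
      rw [e₁, e₂]
      have := ex_skipData (σ := segmentStore σ (segPos len i + i + 2) (E (i + 1)) (M (i + 1)) ∅ ∅)
        (p := segPos len i + i + 2) (l := len i) rfl (hm₃ i hi') (hm₄ i hi')
      rw [segmentStore_setHd, ← segPos_add_one] at this
      exact Exec.mono this (b _ _)
    · rw [hKf]
      have e₁ : {η | η ∈ R i true ∧ H i} = R i true := by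
        ext η
        simp [hh]
      have e₂ : {z : Ordinal.{u} | z = 0 ∧ H i} = {0} := by
        ext η
        simp [hh]
      rw [e₁, e₂]
      refine Exec.ite_true (b _ _) hf (.act _ _ (b _ _) ?_)
      exact Store.act_stay _ _
  · intro o ho hl
    -- The final stage `h + 1` is a successor, so limit stages only meet the regular stores.
    have ho' : o ≤ h := by
      rcases ho.lt_or_eq with h' | rfl
      · exact Order.lt_add_one_iff.1 h'
      · exact absurd hl (Order.not_isSuccLimit_succ h)
    exact StoreLim.congr (fun j hj => hK j (hj.trans ho')) (segmentStore_lim σ ∅ ∅ hl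
      (.of_isNormal (segPos_isNormal len) hl) (fun k => .grow hl _ _) (.grow hl _ _))
  · intro i hi
    rcases hi.lt_or_eq with h' | rfl
    · rw [hK i (Order.lt_add_one_iff.1 h')]
      exact hSm i
    · rw [hKf]
      refine (hSm h).trans ?_
      exact segmentStore_below σ (le_self_add.trans le_self_add)
        (fun k => grow_mono _ _ (lt_add_one h).le) (grow_mono _ _ (lt_add_one h).le)
        (Set.empty_subset _) (Set.empty_subset _)

/-- Write the code of the least ordinal on the tape `eta`, up to its end marker. -/
def writeOrd : Com :=
  .loop (fun r => ¬ r (.inr .eta)) <| .seq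
    (.act (fun r => r) fun _ g => match g with | .out => .right | _ => .stay)
    (.act (fun r t => match t with | .inl 4 => True | t => r t)
      fun _ g => match g with | .out => .right | .h3 => .right | _ => .stay)

/-- The stores that occur in `writeOrd`. -/
def writeStore (σ : St.{u}) (o x : Ordinal.{u}) (A : Set Ordinal.{u}) : St.{u} where
  hd
    | .out => o
    | .h3 => x
    | g => σ.hd g
  tp
    | .inl 4 => A
    | t => σ.tp t

/-- All the bits of an ordinal `η` as a set of ordinals are ones, so `01` is written `η` times. What
must follow on the output tape comes from the data of the script. -/
theorem ex_writeOrd {σ : St.{u}} (ho : σ.hd .out = 0) (h3 : σ.hd .h3 = 0)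
    (hb : σ.tp (.inl 4) = ∅) {η : Ordinal.{u}} (hη : η ∈ σ.tp (.inr .eta))
    (hlt : ∀ x < η, x ∉ σ.tp (.inr .eta)) :
    Ex writeOrd .bot σ (writeStore σ (2 * η) η {ξ | ∃ x < η, ξ = 2 * x + 1}) := by
  have h0 : writeStore σ (2 * 0) 0 (grow ∅ (fun x => {ξ | ξ = 2 * x + 1}) 0) = σ := by
    refine Store.ext (funext fun g => ?_) (funext fun t => ?_)
    · cases g <;> first | rfl | exact h3.symm | exact (mul_zero _).trans ho.symm
    · rcases t with i | w
      · fin_cases i <;> first | rfl | exact (grow_zero _ _).trans hb.symm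
      · rfl
  have := Exec.loop (grp := tapeGrp) (b := fun r => ¬ r (.inr .eta)) (L := .bot)
    (c := .seq (.act (fun r => r) fun _ g => match g with | .out => .right | _ => .stay)
      (.act (fun r t => match t with | .inl 4 => True | t => r t)
        fun _ g => match g with | .out => .right | .h3 => .right | _ => .stay))
    (fun x => writeStore σ (2 * x) x (grow ∅ (fun x => {ξ | ξ = 2 * x + 1}) x)) η
    hlt (not_not.2 hη) ?_ ?_ (fun _ _ => Store.bot_below _)
  · rw [h0] at this
    rwa [show grow ∅ (fun x => {ξ | ξ = 2 * x + 1}) η = {ξ | ∃ x < η, ξ = 2 * x + 1} from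
      Set.ext fun ξ => mem_grow_empty] at this
  · intro i hi
    refine .seq (σ₁ := writeStore σ (2 * i + 1) i (grow ∅ (fun x => {ξ | ξ = 2 * x + 1}) i))
      (.act _ _ (.refl _) ?_) (.act _ _ ?_ ?_)
    · rw [Store.act_move]
      refine Store.ext (funext fun g => ?_) rfl
      cases g <;> rfl
    · refine ⟨fun g => ?_, fun t => subset_rfl⟩
      cases g <;> first | exact le_rfl | exact (lt_add_one (2 * i)).le
    · refine Store.ext (funext fun g => ?_) (funext fun t => ?_)
      · cases g <;> first | rfl | exact (two_mul_add_one' i).symm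
      · rcases t with j | w
        · fin_cases j
          · exact Store.act_tp_eq Iff.rfl
          · exact Store.act_tp_eq Iff.rfl
          · exact Store.act_tp_eq Iff.rfl
          · exact Store.act_tp_eq Iff.rfl
          · exact Store.act_tp_grow True (by simp) rfl fun z => (and_iff_left trivial).symm
        · exact Store.act_tp_eq Iff.rfl
  · refine fun o _ hl => ⟨fun g => ?_, fun t => ?_⟩
    · cases g <;> first
        | exact HeadLim.of_isNormal (mul_isNormal (a := 2) (by simp)) hl
        | exact HeadLim.of_isNormal .id hl
        | exact HeadLim.const hl _
    · rcases t with j | w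
      · fin_cases j <;> first | exact TapeLim.grow hl _ _ | exact TapeLim.const hl _
      · exact TapeLim.const hl _

/-! ### Codes of sets -/

theorem InTC.rank_le {y x : ZFSet.{u}} (h : InTC y x) : y.rank ≤ x.rank := by
  induction h with
  | refl => exact le_rfl
  | tail _ h ih => exact ih.trans (ZFSet.rank_lt_of_mem h).le

theorem small_mem (x : ZFSet.{u}) : Small.{u} {y | y ∈ x} := ZFSet.small_coe x

/-- Members of the transitive closure do not exceed `x` in rank, so they all lie in one level of the
von Neumann hierarchy. -/
theorem small_inTC (x : ZFSet.{u}) : Small.{u} {y | InTC y x} := by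
  have := small_mem (ZFSet.vonNeumann (x.rank + 1))
  have h : {y | InTC y x} ⊆ {y | y ∈ ZFSet.vonNeumann (x.rank + 1)} := by
    intro y hy
    exact ZFSet.mem_vonNeumann.2 (Order.lt_add_one_iff.2 (InTC.rank_le hy))
  exact small_subset h

/-- Every small type of sets is enumerated by an ordinal. -/
theorem exists_enum (T : Set ZFSet.{u}) [Small.{u} T] :
    ∃ (α : Ordinal.{u}) (d : Set.Iio α → ZFSet.{u}), Function.Injective d ∧ Set.range d = T := by
  let r : Shrink.{u} T → Shrink.{u} T → Prop := WellOrderingRel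
  let e := (Ordinal.enum r).toEquiv.trans (equivShrink T).symm
  refine ⟨Ordinal.type r, fun i => (e i).1, fun i j h => e.injective (Subtype.ext h), ?_⟩
  ext y
  constructor
  · rintro ⟨i, rfl⟩
    exact (e i).2
  · intro h
    exact ⟨e.symm ⟨y, h⟩, by simp⟩

/-! ### What a code determines. -/

variable {C : OrdSet.{u}} {X X' : ZFSet.{u}} {α α' : Ordinal.{u}} {d : Set.Iio α → ZFSet.{u}}
  {d' : Set.Iio α' → ZFSet.{u}}

theorem IsPreCode.inTC (h : IsPreCode C X α d) (i : Set.Iio α) : InTC (d i) X := by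
  have : d i ∈ Set.range d := ⟨i, rfl⟩
  rwa [h.range_eq] at this

theorem IsPreCode.exists_of_inTC (h : IsPreCode C X α d) {y : ZFSet.{u}} (hy : InTC y X) :
    ∃ i, d i = y := by
  have : y ∈ Set.range d := by rwa [h.range_eq]
  exact this

theorem IsPreCode.exists_of_mem (h : IsPreCode C X α d) {i : Set.Iio α} {z : ZFSet.{u}}
    (hz : z ∈ d i) : ∃ j, d j = z :=
  h.exists_of_inTC (.head hz (h.inTC i))

/-- `C` records only the membership pairs, yet it determines `α`. An index that occurs in no pair
can only denote `X` itself, and `X` must then be empty. So there is just one index, namely `0`, and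
any other witness has index `0` as well. -/
theorem IsPreCode.lt_of_lt (h : IsPreCode C X α d) (h' : IsPreCode C X' α' d') {a : Ordinal.{u}}
    (ha : a < α) : a < α' := by
  by_cases hl : ∃ b, godelPair (a, b) ∈ C.1
  · obtain ⟨b, hb⟩ := hl
    exact ((h'.mem_iff a b).1 hb).1
  by_cases hr : ∃ b, godelPair (b, a) ∈ C.1
  · obtain ⟨b, hb⟩ := hr
    exact ((h'.mem_iff b a).1 hb).2.1
  have hX : d ⟨a, ha⟩ = X := by
    rcases (h.inTC ⟨a, ha⟩).cases_head with h₁ | ⟨w, hw, h₂⟩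
    · exact h₁
    · obtain ⟨⟨b, hb⟩, rfl⟩ := h.exists_of_inTC h₂
      exact absurd ⟨b, (h.mem_iff a b).2 ⟨ha, hb, hw⟩⟩ hl
  have h0 : ∀ b (hb : b < α), b = a := by
    intro b hb
    rcases (h.inTC ⟨b, hb⟩).cases_tail with h₁ | ⟨w, h₂, hw⟩
    · exact congrArg Subtype.val (h.injective (h₁.symm.trans hX.symm))
    · obtain ⟨⟨c, hc⟩, rfl⟩ := h.exists_of_inTC (.tail .refl hw)
      rw [← hX] at hw
      exact absurd ⟨c, (h.mem_iff c a).2 ⟨hc, ha, hw⟩⟩ hr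
  obtain ⟨i, -⟩ := h'.exists_of_inTC (y := X') .refl
  rw [← h0 0 ((zero_le).trans_lt ha)]
  exact (zero_le).trans_lt i.2

/-- Uniqueness of the Mostowski collapse, by induction on membership. -/
theorem IsPreCode.eq (h : IsPreCode C X α d) (h' : IsPreCode C X' α' d') : ∀ {a : Ordinal.{u}}
    (ha : a < α) (ha' : a < α'), d ⟨a, ha⟩ = d' ⟨a, ha'⟩ := by
  suffices H : ∀ (x : ZFSet.{u}) {a : Ordinal.{u}} (ha : a < α) (ha' : a < α'),
      d ⟨a, ha⟩ = x → x = d' ⟨a, ha'⟩ from fun {a} ha ha' => H _ ha ha' rfl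
  intro x
  induction x using ZFSet.inductionOn with
  | _ x ih =>
    rintro a ha ha' rfl
    ext z
    constructor
    · intro hz
      obtain ⟨⟨b, hb⟩, rfl⟩ := h.exists_of_mem hz
      obtain ⟨hb', _, hz'⟩ := (h'.mem_iff b a).1 ((h.mem_iff b a).2 ⟨hb, ha, hz⟩)
      rwa [ih _ hz hb hb' rfl]
    · intro hz
      obtain ⟨⟨b, hb'⟩, rfl⟩ := h'.exists_of_mem hz
      obtain ⟨hb, _, hz'⟩ := (h.mem_iff b a).1 ((h'.mem_iff b a).2 ⟨hb', ha', hz⟩)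
      rwa [← ih _ hz' hb hb' rfl]

theorem IsPreCode.isCode_iff (h : IsPreCode C X α d) {a : Ordinal.{u}} {y : ZFSet.{u}} :
    IsCode (a, C) y ↔ ∃ i : Set.Iio α, i.1 = a ∧ d i = y := by
  constructor
  · rintro ⟨X', α', d', h', ha', rfl⟩
    have ha := h'.lt_of_lt h ha'
    exact ⟨⟨a, ha⟩, rfl, h.eq h' ha ha'⟩
  · rintro ⟨⟨a, ha⟩, rfl, rfl⟩
    exact ⟨X, α, d, h, ha, rfl⟩

theorem IsCode.unique {a : OrdPair.{u}} {x y : ZFSet.{u}} (h : IsCode a x) (h' : IsCode a y) :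
    x = y := by
  obtain ⟨X, α, d, hd, ha, rfl⟩ := h
  obtain ⟨i, hi, rfl⟩ := hd.isCode_iff.1 h'
  exact congrArg d (Subtype.ext hi.symm)

theorem exists_isCode (x : ZFSet.{u}) : ∃ a, IsCode a x := by
  have := small_inTC x
  obtain ⟨α, d, hd, hr⟩ := exists_enum {y | InTC y x}
  obtain ⟨⟨ρ, hρ⟩, hx⟩ : x ∈ Set.range d := by
    rw [hr]
    exact Relation.ReflTransGen.refl
  let C : Set Ordinal.{u} := {c | ∃ (β γ : Ordinal.{u}), c = godelPair (β, γ) ∧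
    ∃ (hβ : β < α) (hγ : γ < α), d ⟨β, hβ⟩ ∈ d ⟨γ, hγ⟩}
  have hC : BddAbove C := by
    refine ⟨godelBase α, ?_⟩
    rintro c ⟨β, γ, rfl, hβ, hγ, -⟩
    exact (lt_godelBase_iff.2 ⟨hβ, hγ⟩).le
  refine ⟨(ρ, ⟨C, hC⟩), x, α, d, ⟨hd, hr, fun β γ => ⟨?_, ?_⟩⟩, hρ, hx⟩
  · rintro ⟨β', γ', h, h'⟩
    obtain ⟨rfl, rfl⟩ := Prod.mk.inj (godelPair_injective h)
    exact h'
  · exact fun h => ⟨β, γ, rfl, h⟩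

/-- The codes of `y` in the code `a` that the machines find. -/
def codeRow (a : OrdPair.{u}) (y : ZFSet.{u}) : Set Ordinal.{u} :=
  {η | IsCode (η, a.2) y ∧ ((∃ z, godelPair (η, z) ∈ a.2.1) ∨ η = a.1)}

variable {a : OrdPair.{u}} {x y : ZFSet.{u}}

/-- Either `y = x` is denoted by the representative, or `y` is an element of some set in the
closure, so its index is a first component. The extra condition in `codeRow` thus loses nothing
inside the transitive closure of `{x}`. It is needed because ordinals outside the domain of the code
have no predecessors and would pass for codes of the empty set. -/
theorem exists_codeRow_of_inTC (ha : IsCode a x) (hy : InTC y x) : (codeRow a y).Nonempty := by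
  obtain ⟨X, α, d, hd, hρ, rfl⟩ := ha
  obtain ⟨i, rfl⟩ := hd.exists_of_inTC (hy.trans (hd.inTC _))
  rcases hy.cases_head with h | ⟨w, hw, h⟩
  · exact ⟨a.1, hd.isCode_iff.2 ⟨⟨a.1, hρ⟩, rfl, h.symm⟩, .inr rfl⟩
  · obtain ⟨j, rfl⟩ := hd.exists_of_inTC (h.trans (hd.inTC _))
    exact ⟨i.1, hd.isCode_iff.2 ⟨i, rfl, rfl⟩, .inl ⟨j.1, (hd.mem_iff _ _).2 ⟨i.2, j.2, hw⟩⟩⟩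

theorem mem_codeRow_self (ha : IsCode a x) : a.1 ∈ codeRow a x := ⟨ha, .inr rfl⟩

theorem IsCode.injective (ha : IsCode a x) {η η' : Ordinal.{u}} (h : IsCode (η, a.2) y)
    (h' : IsCode (η', a.2) y) : η = η' := by
  obtain ⟨X, α, d, hd, -⟩ := ha
  obtain ⟨i, rfl, hi⟩ := hd.isCode_iff.1 h
  obtain ⟨j, rfl, hj⟩ := hd.isCode_iff.1 h'
  rw [hd.injective (hi.trans hj.symm)]

/-- The recursion by which the machines find the codes of sets. -/
theorem codeRow_eq (ha : IsCode a x) {N : Ordinal.{u}} (hN : a.2.bound < godelBase N)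
    {c : Ordinal.{u} → ZFSet.{u}} {i : Ordinal.{u}} (hc : ∀ z ∈ c i, ∃ j < i, c j = z) :
    codeRow a (c i) = {η | η < N ∧ (∀ j < i, c j ∈ c i → (codeRow a (c j)).Nonempty) ∧
      ((∃ y, godelPair (η, y) ∈ a.2.1) ∨ η = a.1) ∧
      ∀ b < N, (godelPair (b, η) ∈ a.2.1 ↔ ∃ j < i, c j ∈ c i ∧ b ∈ codeRow a (c j))} := by
  obtain ⟨X, α, d, hd, hρ, rfl⟩ := ha
  have hpos : 0 < N := by
    rcases eq_or_ne N 0 with rfl | h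
    · rw [godelBase_zero] at hN
      exact absurd hN not_lt_zero
    · exact pos_iff_ne_zero.2 h
  have hlt : ∀ {b γ}, godelPair (b, γ) ∈ a.2.1 → b < N ∧ γ < N := fun h =>
    lt_godelBase_iff.1 ((OrdPair.lt_bound h).trans hN)
  have hmem := fun {b γ} => hd.mem_iff b γ
  -- Indices in the field of the coded relation are below `N` as `N × N` contains all its pairs. An
  -- index outside the field is `0`, by the argument for one-element codes.
  have hαN : ∀ η < α, η < N := by
    intro η hη
    by_contra hNη
    have h1 : ∀ b, godelPair (η, b) ∉ a.2.1 := fun b hb => hNη (hlt hb).1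
    have h2 : ∀ b, godelPair (b, η) ∉ a.2.1 := fun b hb => hNη (hlt hb).2
    have hX : d ⟨η, hη⟩ = X := by
      rcases (hd.inTC ⟨η, hη⟩).cases_head with h₁ | ⟨w, hw, h₂⟩
      · exact h₁
      · obtain ⟨⟨b, hb⟩, rfl⟩ := hd.exists_of_inTC h₂
        exact absurd (hmem.2 ⟨hη, hb, hw⟩) (h1 b)
    have h0 : 0 = η := by
      have h0 : 0 < α := (zero_le).trans_lt hη
      rcases (hd.inTC ⟨0, h0⟩).cases_tail with h₁ | ⟨w, h₂, hw⟩
      · exact congrArg Subtype.val (hd.injective (h₁.symm.trans hX.symm))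
      · obtain ⟨⟨c, hc⟩, rfl⟩ := hd.exists_of_inTC (.tail .refl hw)
        rw [← hX] at hw
        exact absurd (hmem.2 ⟨hc, hη, hw⟩) (h2 c)
    exact hNη (h0 ▸ hpos)
  ext η
  constructor
  · rintro ⟨h, hp⟩
    obtain ⟨⟨η, hη⟩, rfl, hy⟩ := hd.isCode_iff.1 h
    refine ⟨?_, ?_, hp, fun b hb => ⟨?_, ?_⟩⟩
    · exact hαN η hη
    · intro j _ hj
      rw [← hy] at hj
      obtain ⟨k, hk⟩ := hd.exists_of_mem hj
      refine ⟨k.1, hd.isCode_iff.2 ⟨k, rfl, hk⟩, .inl ⟨η, hmem.2 ⟨k.2, hη, ?_⟩⟩⟩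
      rwa [Subtype.coe_eta, hk]
    · intro hb
      obtain ⟨hb', _, h'⟩ := hmem.1 hb
      obtain ⟨j, hj, hj'⟩ := hc (d ⟨b, hb'⟩) (by rwa [← hy])
      refine ⟨j, hj, ?_, hd.isCode_iff.2 ⟨⟨b, hb'⟩, rfl, hj'.symm⟩, .inl ⟨η, hb⟩⟩
      rwa [hj', ← hy]
    · rintro ⟨j, hj, hji, hb', -⟩
      obtain ⟨k, rfl, hk⟩ := hd.isCode_iff.1 hb'
      refine hmem.2 ⟨k.2, hη, ?_⟩
      rwa [Subtype.coe_eta, hk, hy]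
  · rintro ⟨hηN, hne, hp, hel⟩
    -- Here the condition on first components is used: it forces `η` into the domain of the code.
    have hη : η < α := by
      rcases hp with ⟨y, hy⟩ | rfl
      · exact (hmem.1 hy).1
      · exact hρ
    refine ⟨hd.isCode_iff.2 ⟨⟨η, hη⟩, rfl, ?_⟩, hp⟩
    ext z
    constructor
    · intro hz
      obtain ⟨⟨b, hb⟩, rfl⟩ := hd.exists_of_mem hz
      have hbη := hmem.2 ⟨hb, hη, hz⟩
      obtain ⟨j, hj, hji, hb', -⟩ := (hel b (hlt hbη).1).1 hbη
      obtain ⟨k, rfl, hk⟩ := hd.isCode_iff.1 hb'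
      rw [show (⟨k.1, hb⟩ : Set.Iio α) = k from rfl, hk]
      exact hji
    · intro hz
      obtain ⟨j, hj, rfl⟩ := hc z hz
      obtain ⟨b, hb⟩ := hne j hj hz
      obtain ⟨k, rfl, hk⟩ := hd.isCode_iff.1 hb.1
      obtain ⟨_, _, h'⟩ := hmem.1 ((hel k.1 (hαN _ k.2)).2 ⟨j, hj, hz, hb⟩)
      rw [← hk]
      exact h'

/-- A transitive set is enumerated such that elements come first. -/
theorem exists_enumeration (o : Ordinal.{u}) : ∃ (κ : Ordinal.{u}) (c : Ordinal.{u} → ZFSet.{u}),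
    (∀ i ≤ κ, ∀ z ∈ c i, ∃ j < i, c j = z) ∧ ∀ z : ZFSet.{u}, z.rank < o → ∃ i < κ, c i = z := by
  have := small_mem (ZFSet.vonNeumann o)
  obtain ⟨α, d, -, hr⟩ := exists_enum {y | y ∈ ZFSet.vonNeumann o}
  have hmem : ∀ z : ZFSet.{u}, z.rank < o → ∃ i, d i = z := by
    intro z hz
    have : z ∈ Set.range d := by
      rw [hr]
      exact ZFSet.mem_vonNeumann.2 hz
    exact this
  have hrk : ∀ i, (d i).rank < o := by
    intro i
    have : d i ∈ Set.range d := ⟨i, rfl⟩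
    rw [hr] at this
    exact ZFSet.mem_vonNeumann.1 this
  -- Index `α * r + j` is reserved for the set `d j` if its rank is `r`; all other indices are
  -- filled up with the empty set. Ordering by rank first puts elements before the sets that contain
  -- them.
  open Classical in
  let c : Ordinal.{u} → ZFSet.{u} := fun i =>
    if h : i % α < α then (if (d ⟨i % α, h⟩).rank = i / α then d ⟨i % α, h⟩ else ∅) else ∅
  have key : ∀ j : Set.Iio α, c (α * (d j).rank + j.1) = d j := by
    intro j
    have hα : α ≠ 0 := (zero_le.trans_lt j.2).ne'
    have e₁ : (α * (d j).rank + j.1) % α = j.1 := by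
      rw [Ordinal.mul_add_mod_self, Ordinal.mod_eq_of_lt j.2]
    have e₂ : (α * (d j).rank + j.1) / α = (d j).rank := by
      rw [Ordinal.mul_add_div _ hα, Ordinal.div_eq_zero_of_lt j.2, add_zero]
    simp only [c, e₁, e₂]
    exact (dif_pos j.2).trans (if_pos trivial)
  have hlt : ∀ (j : Set.Iio α) (r : Ordinal.{u}), (d j).rank < r → α * (d j).rank + j.1 < α * r := by
    intro j r h
    calc α * (d j).rank + j.1 < α * (d j).rank + α := add_lt_add_right j.2 _
      _ = α * ((d j).rank + 1) := by rw [mul_add, mul_one]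
      _ ≤ α * r := mul_le_mul_right (Order.add_one_le_iff.2 h) α
  refine ⟨α * o, c, fun i _ z hz => ?_, fun z hz => ?_⟩
  · simp only [c] at hz
    split_ifs at hz with h h'
    · have hzr := ZFSet.rank_lt_of_mem hz
      obtain ⟨j, rfl⟩ := hmem z (hzr.trans (hrk _))
      refine ⟨_, (hlt j _ hzr).trans_le ?_, key j⟩
      rw [h']
      exact Ordinal.mul_div_le i α
    · exact absurd hz (ZFSet.notMem_empty _)
    · exact absurd hz (ZFSet.notMem_empty _)
  · obtain ⟨j, rfl⟩ := hmem z hz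
    exact ⟨_, hlt j _ hz, key j⟩

/-! ### Scripts as parameters -/

/-- Mark the first cell of the tapes `z g`. -/
def start : Com :=
  .act (fun r t => match t with | .inr (.z _) => True | t => r t) fun _ _ => .stay

/-- The store after the parameter was read. -/
def prepStore (P i₁ i₂ i₃ M B : Set Ordinal.{u}) : St.{u} where
  hd _ := 0
  tp
    | .inl 0 => P
    | .inl 1 => i₁
    | .inl 2 => i₂
    | .inl 3 => i₃
    | .inr (.z _) => {0}
    | .inr .mark => M
    | .inr .bit => B
    | _ => ∅

theorem ex_start (P i₁ i₂ i₃ : Set Ordinal.{u}) :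
    Ex start .bot (initStore P i₁ i₂ i₃) (prepStore P i₁ i₂ i₃ ∅ ∅) := by
  refine .act _ _ (Store.bot_below _) (Store.ext (funext fun g => rfl) (funext fun t => ?_))
  rcases t with j | w
  · fin_cases j <;> exact Store.act_tp_eq Iff.rfl
  · cases w with
    | z g =>
      refine (Store.act_tp_or (P := True) (by simp)).trans ?_
      ext ξ
      simp [initStore, prepStore]
    | _ => exact Store.act_tp_eq Iff.rfl

/-- The parameter that describes two tapes with the contents `M` and `B`. -/
def scriptSet (Θ : Ordinal.{u}) (M B : Set Ordinal.{u}) : Set Ordinal.{u} :=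
  {z | (∃ ξ ∈ M, z = 2 * ξ) ∨ (∃ ξ ∈ B, z = 2 * ξ + 1) ∨ z = 2 * Θ}

section Script

variable {Θ : Ordinal.{u}} {M B : Set Ordinal.{u}}

theorem even_mem_scriptSet {ξ : Ordinal.{u}} : 2 * ξ ∈ scriptSet Θ M B ↔ ξ ∈ M ∨ ξ = Θ := by
  have inj : ∀ x y : Ordinal.{u}, 2 * x = 2 * y ↔ x = y := fun x y =>
    ⟨fun h => by
      rcases lt_trichotomy x y with h' | h' | h'
      · exact absurd h (OrdPair.two_mul_lt.2 h').ne
      · exact h'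
      · exact absurd h (OrdPair.two_mul_lt.2 h').ne', fun h => h ▸ rfl⟩
  simp only [scriptSet, Set.mem_ofPred_eq, inj, OrdPair.two_mul_ne, and_false, exists_false,
    false_or]
  simp

theorem odd_mem_scriptSet {ξ : Ordinal.{u}} : 2 * ξ + 1 ∈ scriptSet Θ M B ↔ ξ ∈ B := by
  simp only [scriptSet, Set.mem_ofPred_eq, (OrdPair.two_mul_ne _ _).symm, and_false, exists_false,
    false_or, or_false, OrdPair.two_mul_add_one_inj]
  simp

theorem scriptSet_le (hM : ∀ ξ ∈ M, ξ < Θ) (hB : ∀ ξ ∈ B, ξ < Θ) {z : Ordinal.{u}}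
    (hz : z ∈ scriptSet Θ M B) : z ≤ 2 * Θ := by
  rcases hz with ⟨ξ, h, rfl⟩ | ⟨ξ, h, rfl⟩ | rfl
  · exact (OrdPair.two_mul_lt.2 (hM ξ h)).le
  · exact Order.add_one_le_iff.2 (OrdPair.two_mul_lt.2 (hB ξ h))
  · exact le_rfl

/-- The parameter as a set of ordinals. -/
def scriptParam (hM : ∀ ξ ∈ M, ξ < Θ) (hB : ∀ ξ ∈ B, ξ < Θ) : OrdSet.{u} :=
  ⟨scriptSet Θ M B, 2 * Θ, fun _ => scriptSet_le hM hB⟩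

/-- The element `2 * Θ` makes the bound independent of the contents of the script. -/
theorem bound_scriptParam (hM : ∀ ξ ∈ M, ξ < Θ) (hB : ∀ ξ ∈ B, ξ < Θ) :
    (scriptParam hM hB).bound = 2 * Θ + 1 := by
  refine le_antisymm (OrdPair.bound_le fun γ h => Order.lt_add_one_iff.2 (scriptSet_le hM hB h))
    (Order.add_one_le_iff.2 ?_)
  exact OrdPair.lt_bound (a := (0, scriptParam hM hB)) (.inr (.inr rfl))

/-- Read the parameter. -/
def prepare : Com := .seq start readScript

/-- Reading ends at cell `4 * (Θ + 1)`, the terminator of the parameter. Both tapes receive a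
spurious entry in cell `Θ`: on `mark` from the element `2 * Θ`, on `bit` from the first one of the
terminator. It does no harm, as scripts lie strictly below `Θ`. -/
theorem ex_prepare (hM : ∀ ξ ∈ M, ξ < Θ) (hB : ∀ ξ ∈ B, ξ < Θ) (i₁ i₂ i₃ : Set Ordinal.{u}) :
    Ex prepare .bot (initStore (scriptParam hM hB).toPair.ones i₁ i₂ i₃)
      (prepStore (scriptParam hM hB).toPair.ones i₁ i₂ i₃ {ξ | ξ ∈ M ∨ ξ = Θ}
        {ξ | ξ ∈ B ∨ ξ = Θ}) := by
  set a := (scriptParam hM hB).toPair with ha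
  have hb : a.2.bound = 2 * Θ + 1 := bound_scriptParam hM hB
  have e4 : ∀ x : Ordinal.{u}, 4 * x = 2 * (2 * x) := fun x => by
    rw [← mul_assoc]
    norm_num
  have e3 : ∀ x : Ordinal.{u}, 4 * x + 3 = 2 * (2 * x + 1) + 1 := fun x => by
    rw [e4, OrdPair.two_mul_add_three]
  have hlt : ∀ x < Θ + 1, 2 * x < a.2.bound := by
    intro x hx
    rw [hb, Order.lt_add_one_iff]
    rcases (Order.lt_add_one_iff.1 hx).lt_or_eq with h | rfl
    · exact (OrdPair.two_mul_lt.2 h).le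
    · exact le_rfl
  refine .seq (ex_start _ _ _ _) ?_
  have := ex_readScript (σ := prepStore a.ones i₁ i₂ i₃ ∅ ∅) (n := Θ + 1) (fun _ => rfl) rfl rfl
    rfl rfl ?_ ?_
  · refine cast (congrArg _ ?_) this
    refine Store.ext rfl (funext fun t => ?_)
    have hin : (prepStore a.ones i₁ i₂ i₃ ∅ ∅).tp (.inl 0) = a.ones := rfl
    rcases t with j | w
    · fin_cases j <;> rfl
    · cases w with
      | mark =>
        ext ξ
        simp only [Store.setTp, hin]
        simp only [prepStore]
        simp only [ne_eq, reduceCtorEq, not_false_eq_true, Function.update_of_ne, Sum.inr.injEq,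
          Function.update_self, Set.mem_ofPred_eq]
        constructor
        · rintro ⟨h, h'⟩
          rw [e4, OrdPair.odd_mem_ones _ (hlt ξ h)] at h'
          exact even_mem_scriptSet.1 h'
        · intro h
          have hξ : ξ < Θ + 1 := by
            rcases h with h | rfl
            · exact (hM ξ h).trans (lt_add_one _)
            · exact lt_add_one _
          refine ⟨hξ, ?_⟩
          rw [e4, OrdPair.odd_mem_ones _ (hlt ξ hξ)]
          exact even_mem_scriptSet.2 h
      | bit =>
        ext ξ
        simp only [Store.setTp, hin]
        simp only [prepStore, Function.update_self, Set.mem_ofPred_eq, e3]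
        constructor
        · rintro ⟨h, h'⟩
          rcases (Order.lt_add_one_iff.1 h).lt_or_eq with h | h
          · rw [OrdPair.odd_mem_ones _] at h'
            · exact .inl (odd_mem_scriptSet.1 h')
            · rw [hb]
              exact lt_of_lt_of_le (Order.lt_add_one_iff.2
                (Order.add_one_le_iff.2 (OrdPair.two_mul_lt.2 h))) le_rfl
          · exact .inr h
        · rintro (h | rfl)
          · refine ⟨(hB ξ h).trans (lt_add_one _), ?_⟩
            rw [OrdPair.odd_mem_ones]
            · exact odd_mem_scriptSet.2 h
            · rw [hb, Order.lt_add_one_iff]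
              exact Order.add_one_le_iff.2 (OrdPair.two_mul_lt.2 (hB ξ h))
          · refine ⟨lt_add_one _, (OrdPair.mem_ones _).2 (.inr (.inl ?_))⟩
            rw [hb]
      | _ => rfl
  · show 4 * (Θ + 1) ∈ a.ones
    have := OrdPair.even_mem_ones a
    rwa [hb, add_assoc, one_add_one_eq_two, OrdPair.two_mul_add_two, ← e4] at this
  · intro x hx
    show 4 * x ∉ a.ones
    rw [e4]
    exact OrdPair.even_notMem_ones _ ((hlt x hx).trans (lt_add_one _))

end Script

/-- The realiser given by a structured program and a script. -/
def comRealiser (c : Com) (P : OrdSet.{u}) : Realiser.{u} :=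
  ⟨Encodable.encode (c.toProgram tapeGrp), P⟩

theorem comRealiser_computes {c : Com} {P : OrdSet.{u}} {i₁ i₂ i₃ : Set Ordinal.{u}}
    {σ : St.{u}} (h : Ex c .bot (initStore P.toPair.ones i₁ i₂ i₃) σ) :
    (comRealiser c P).Computes ![Tape.ofSet i₁, Tape.ofSet i₂, Tape.ofSet i₃]
      (Tape.ofSet (σ.tp (.inl 4))) :=
  ⟨_, Encodable.encodek _, h.outputs⟩

theorem blank_eq : blank.{u} = Tape.ofSet ∅ := by
  funext ξ
  simp [blank, Tape.ofSet]

/-- Every tape content is the output of a machine, for all inputs. -/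
theorem exists_const {D : Set Ordinal.{u}} (hD : BddAbove D) : ∃ r : Realiser.{u},
    ∀ i₁ i₂ i₃ : Set Ordinal.{u},
      r.Computes ![Tape.ofSet i₁, Tape.ofSet i₂, Tape.ofSet i₃] (Tape.ofSet D) := by
  obtain ⟨l, hl⟩ := hD
  have hB : ∀ ξ ∈ D, ξ < l + 1 := fun ξ h => Order.lt_add_one_iff.2 (hl h)
  -- One block of length `l + 1`, with `Θ` one larger: cell `l + 1` stays unmarked and ends the
  -- block in spite of the spurious mark in cell `Θ`.
  have hM : ∀ ξ ∈ Set.Iio (l + 1), ξ < l + 1 + 1 := fun ξ h => h.trans (lt_add_one _)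
  have hB' : ∀ ξ ∈ D, ξ < l + 1 + 1 := fun ξ h => (hB ξ h).trans (lt_add_one _)
  refine ⟨comRealiser (.seq prepare copyData) (scriptParam hM hB'), fun i₁ i₂ i₃ => ?_⟩
  have := comRealiser_computes (.seq (ex_prepare hM hB' i₁ i₂ i₃) (ex_copyData (p := 0) (o := 0)
    (l := l + 1) rfl rfl ?_ ?_ ?_))
  · convert this using 2
    ext ξ
    simp only [Store.setTp, Function.update_self, prepStore, Set.mem_union, Set.mem_ofPred_eq,
      zero_add]
    constructor
    · exact fun h => .inr ⟨ξ, hB ξ h, .inl h, rfl⟩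
    · rintro (h | ⟨x, hx, h | rfl, rfl⟩)
      · exact h.elim
      · exact h
      · exact absurd hx (lt_add_one _).not_gt
  · intro ξ hξ
    rw [zero_add]
    exact .inl hξ
  · rw [zero_add]
    rintro (h | h)
    · exact lt_irrefl (l + 1) h
    · exact (lt_add_one (l + 1)).ne h
  · intro ξ hξ
    exact hξ.elim

/-! ### Layouts -/

/-- The set with the parts `T i` in the consecutive blocks of lengths `d i`. -/
def layout (d : Ordinal.{u} → Ordinal.{u}) (T : Ordinal.{u} → Set Ordinal.{u}) :
    Set Ordinal.{u} :=
  {z | ∃ i, ∃ x ∈ T i, x < d i ∧ z = ordSum d i + x}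

theorem ordSum_add_inj {d : Ordinal.{u} → Ordinal.{u}} {i j x y : Ordinal.{u}} (hx : x < d i)
    (hy : y < d j) : ordSum d i + x = ordSum d j + y ↔ i = j ∧ x = y := by
  constructor
  · have key : ∀ {i j x y : Ordinal.{u}}, x < d i → i < j → ordSum d i + x < ordSum d j + y :=
      fun hx h => ((add_lt_add_right hx _).trans_le (ordSum_add_le h)).trans_le le_self_add
    intro h
    rcases lt_trichotomy i j with h' | rfl | h'
    · exact absurd h (key hx h').ne
    · exact ⟨rfl, add_left_cancel h⟩
    · exact absurd h (key hy h').ne'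
  · rintro ⟨rfl, rfl⟩
    rfl

theorem mem_layout {d : Ordinal.{u} → Ordinal.{u}} {T : Ordinal.{u} → Set Ordinal.{u}}
    {i x : Ordinal.{u}} (hx : x < d i) : ordSum d i + x ∈ layout d T ↔ x ∈ T i := by
  constructor
  · rintro ⟨j, y, hy, hyd, h⟩
    obtain ⟨rfl, rfl⟩ := (ordSum_add_inj hx hyd).1 h
    exact hy
  · exact fun h => ⟨i, x, h, hx, rfl⟩

theorem layout_lt {d : Ordinal.{u} → Ordinal.{u}} {T : Ordinal.{u} → Set Ordinal.{u}}
    {κ : Ordinal.{u}} (hT : ∀ i, ∀ x ∈ T i, i < κ) : ∀ z ∈ layout d T, z < ordSum d κ := by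
  rintro z ⟨i, x, hx, hxd, rfl⟩
  exact (add_lt_add_right hxd _).trans_le (ordSum_add_le (hT i x hx))

/-- Look up an entry of the table, for an ordinal as input. -/
def lookup : Com :=
  .seq prepare <| .seq (.loop (fun r => ¬ r (.inl 1)) <| .seq skipData <| .seq
    (.act (fun r => r) fun _ g => if g = .in1 then .right else .stay)
    (.act (fun r => r) fun _ g => if g = .in1 then .right else .stay)) copyData

/-- Tables indexed by ordinals can be computed. -/
theorem exists_table (β : Ordinal.{u}) (D : Ordinal.{u} → Set Ordinal.{u})
    (hD : ∀ γ, BddAbove (D γ)) : ∃ r : Realiser.{u}, ∀ γ < β,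
      r.Computes ![(ordPair γ).tape, blank, blank] (Tape.ofSet (D γ)) := by
  choose l hl using hD
  -- The terminator of the code of `γ` is at cell `2 * (γ + 1)`, so the loop skips `γ + 1` blocks.
  -- Hence the entry for `γ` is placed in block `γ + 1`, and block `i` holds the entry for the
  -- predecessor of `i`.
  let len : Ordinal.{u} → Ordinal.{u} := fun i => l (Ordinal.pred i) + 1
  let d : Ordinal.{u} → Ordinal.{u} := fun i => len i + 1
  have hd : ∀ i, 0 < d i := fun i => (zero_le).trans_lt (lt_add_one _)
  let TM : Ordinal.{u} → Set Ordinal.{u} := fun i => {x | x < len i ∧ i < β + 1}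
  let TB : Ordinal.{u} → Set Ordinal.{u} := fun i => {x | x ∈ D (Ordinal.pred i) ∧ i < β + 1}
  have hM := layout_lt (d := d) (T := TM) (κ := β + 1) fun i x h => h.2
  have hB := layout_lt (d := d) (T := TB) (κ := β + 1) fun i x h => h.2
  have hTM : ∀ i < β + 1, ∀ x < d i, ordSum d i + x ∈
      {ξ | ξ ∈ layout d TM ∨ ξ = ordSum d (β + 1)} ↔ x < len i := by
    intro i hi x hx
    refine (or_iff_left ?_).trans ((mem_layout hx).trans (and_iff_left hi))
    exact ((add_lt_add_right hx _).trans_le (ordSum_add_le hi)).ne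
  have hTB : ∀ i < β + 1, ∀ x < d i, ordSum d i + x ∈
      {ξ | ξ ∈ layout d TB ∨ ξ = ordSum d (β + 1)} ↔ x ∈ D (Ordinal.pred i) := by
    intro i hi x hx
    refine (or_iff_left ?_).trans ((mem_layout hx).trans (and_iff_left hi))
    exact ((add_lt_add_right hx _).trans_le (ordSum_add_le hi)).ne
  refine ⟨comRealiser lookup (scriptParam hM hB), fun γ hγ => ?_⟩
  have hγ1 : γ + 1 < β + 1 := Order.lt_add_one_iff.2 (Order.add_one_le_iff.2 hγ)
  rw [blank_eq, OrdPair.tape]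
  set σ : St.{u} := prepStore (scriptParam hM hB).toPair.ones (ordPair γ).ones ∅ ∅
    {ξ | ξ ∈ layout d TM ∨ ξ = ordSum d (β + 1)} {ξ | ξ ∈ layout d TB ∨ ξ = ordSum d (β + 1)} with hσ
  let K : Ordinal.{u} → St.{u} := fun i => (σ.setHd .sc (ordSum d i)).setHd .in1 (2 * i)
  have h0 : K 0 = σ := by
    simp only [K, ordSum_zero, mul_zero]
    have h₁ : σ.setHd .sc 0 = σ := setHd_of_eq rfl
    have h₂ : σ.setHd .in1 0 = σ := setHd_of_eq rfl
    rw [h₁, h₂]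
  -- The ordinal component of this code is `0`, so its final one lies in an odd cell and the
  -- terminator is the only even one.
  have hones : ∀ i, 2 * i ∈ (ordPair γ).ones ↔ i = γ + 1 := by
    have h1 := OrdPair.even_mem_ones (ordPair γ)
    rw [bound_Iio] at h1
    intro i
    refine ⟨fun h => ?_, fun h => h ▸ h1⟩
    by_contra hc
    rcases lt_or_gt_of_ne hc with h' | h'
    · refine OrdPair.even_notMem_ones (ordPair γ) ?_ h
      rwa [bound_Iio]
    · have h3 := OrdPair.two_mul_lt.2 h'
      rcases (OrdPair.mem_ones _).1 h with ⟨x, _, hx⟩ | hx | hx | hx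
      · exact OrdPair.two_mul_ne _ _ hx
      · exact OrdPair.two_mul_ne _ _ hx
      · rw [bound_Iio, OrdPair.two_mul_add_two] at hx
        exact h3.ne' hx
      · rw [bound_Iio] at hx
        have : (ordPair γ).1 = 0 := rfl
        rw [this, add_zero, OrdPair.two_mul_add_three] at hx
        exact OrdPair.two_mul_ne _ _ hx
  have hb : ∀ i, (K i).rd tapeGrp (.inl 1) ↔ i = γ + 1 := by
    intro i
    rw [← hones]
    have : (K i).hd .in1 = 2 * i := by simp [K, Store.setHd]
    show (K i).hd .in1 ∈ _ ↔ _
    rw [this]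
    rfl
  have hloop := Exec.loop (grp := tapeGrp) (b := fun r => ¬ r (.inl 1)) (L := .bot)
    (c := .seq skipData <| .seq
    (.act (fun r => r) fun _ g => if g = .in1 then .right else .stay)
    (.act (fun r => r) fun _ g => if g = .in1 then .right else .stay)) K (γ + 1)
    (fun i hi => mt (hb i).1 hi.ne) (not_not.2 ((hb _).2 rfl)) ?_ ?_
    (fun _ _ => Store.bot_below _)
  · have hp : ordSum d (γ + 1) + len (γ + 1) < ordSum d (γ + 1) + d (γ + 1) :=
      add_lt_add_right (lt_add_one _) _
    have hlen : len (γ + 1) = l γ + 1 := by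
      simp only [len]
      rw [Ordinal.pred_add_one]
    rw [h0] at hloop
    have := comRealiser_computes (c := lookup) (.seq (ex_prepare hM hB (ordPair γ).ones ∅ ∅)
      (.seq hloop (ex_copyData (σ := K (γ + 1)) (p := ordSum d (γ + 1)) (o := 0)
        (l := len (γ + 1)) ?_ ?_ ?_ ?_ ?_)))
    · convert this using 2
      ext ξ
      simp only [Store.setTp, Function.update_self, Set.mem_union, Set.mem_ofPred_eq, zero_add]
      constructor
      · intro h
        have hξ : ξ < len (γ + 1) := by
          rw [hlen]
          exact Order.lt_add_one_iff.2 (hl γ h)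
        refine .inr ⟨ξ, hξ, (hTB _ hγ1 ξ (hξ.trans (lt_add_one _))).2 ?_, rfl⟩
        rwa [Ordinal.pred_add_one]
      · rintro (h | ⟨x, hx, h, rfl⟩)
        · exact h.elim
        · have := (hTB _ hγ1 ξ (hx.trans (lt_add_one _))).1 h
          rwa [Ordinal.pred_add_one] at this
    · simp [K, Store.setHd]
    · simp [K, Store.setHd, hσ, prepStore]
    · intro ξ hξ
      exact (hTM _ hγ1 ξ (hξ.trans (lt_add_one _))).2 hξ
    · exact fun h => lt_irrefl _ ((hTM _ hγ1 _ (lt_add_one _)).1 h)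
    · intro ξ hξ
      exact hξ.elim
  · intro i hi
    have hi' : i < β + 1 := hi.trans hγ1
    have hskip := ex_skipData (σ := K i) (p := ordSum d i) (l := len i)
      (by simp [K, Store.setHd]) (fun ξ hξ => (hTM i hi' ξ (hξ.trans (lt_add_one _))).2 hξ)
      (fun h => lt_irrefl _ ((hTM i hi' _ (lt_add_one _)).1 h))
    have e1 : ordSum d i + len i + 1 = ordSum d (i + 1) := by
      rw [ordSum_add_one, add_assoc]
    rw [e1] at hskip
    set ρ := (K i).setHd .sc (ordSum d (i + 1)) with hρ
    have bρ : (K i).Below ρ := below_setHd (by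
      simp only [K, Store.setHd]
      exact ordSum_mono d (lt_add_one i).le)
    have h1 : ρ.setHd .in1 (2 * i) = ρ := setHd_of_eq (by simp [ρ, K, Store.setHd])
    have hle : ρ.hd .in1 ≤ 2 * i + 1 := by simp [ρ, K, Store.setHd]
    refine .seq hskip (.seq (σ₁ := ρ.setHd .in1 (2 * i + 1)) (.act _ _ bρ ?_)
      (.act _ _ (bρ.trans (below_setHd hle)) ?_))
    · have := act_setHd_right ρ .in1 (2 * i)
      rwa [h1] at this
    · refine (act_setHd_right ρ .in1 (2 * i + 1)).trans ?_
      rw [← two_mul_add_one']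
      refine Store.ext (funext fun g => ?_) rfl
      by_cases h : g = .in1
      · subst h; simp [ρ, K, Store.setHd]
      · by_cases h' : g = .sc
        · subst h'; simp [ρ, K, Store.setHd]
        · simp [ρ, K, Store.setHd, h, h']
  · refine fun o _ ho => ⟨fun g => ?_, fun t => TapeLim.const ho _⟩
    by_cases h : g = .in1
    · subst h
      simpa [K, Store.setHd] using HeadLim.of_isNormal (mul_isNormal (a := 2) (by simp)) ho
    · by_cases h' : g = .sc
      · subst h'
        simpa [K, Store.setHd] using HeadLim.of_isNormal (ordSum_isNormal hd) ho
      · simpa [K, Store.setHd, h, h'] using HeadLim.const ho _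

/-! ### Searching for a set -/

/-- The tapes `M` and `B` describe the sets `c i`, for `i ≤ κ`, with data `D i` of lengths
`len i`. -/
structure IsScript (κ : Ordinal.{u}) (c : Ordinal.{u} → ZFSet.{u}) (len : Ordinal.{u} → Ordinal.{u})
    (D : Ordinal.{u} → Set Ordinal.{u}) (M B : Set Ordinal.{u}) : Prop where
  row : ∀ i ≤ κ, ∀ j < i, segPos len i + j ∈ M
  row_end : ∀ i ≤ κ, segPos len i + i ∉ M
  data : ∀ i ≤ κ, ∀ x < len i, segPos len i + i + 2 + x ∈ M
  data_end : ∀ i ≤ κ, segPos len i + i + 2 + len i ∉ M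
  bit_row : ∀ i ≤ κ, ∀ j < i, segPos len i + j ∈ B ↔ c j ∈ c i
  bit_self : ∀ i ≤ κ, segPos len i + i ∈ B
  bit_force : ∀ i ≤ κ, segPos len i + i + 1 ∈ B ↔ i = κ
  bit_data : ∀ i ≤ κ, ∀ x < len i, segPos len i + i + 2 + x ∈ B ↔ x ∈ D i

theorem exists_script (κ : Ordinal.{u}) (c : Ordinal.{u} → ZFSet.{u})
    (len : Ordinal.{u} → Ordinal.{u}) (D : Ordinal.{u} → Set Ordinal.{u}) :
    ∃ (Θ : Ordinal.{u}) (M B : Set Ordinal.{u}), (∀ ξ ∈ M, ξ < Θ) ∧ (∀ ξ ∈ B, ξ < Θ) ∧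
      IsScript κ c len D {ξ | ξ ∈ M ∨ ξ = Θ} {ξ | ξ ∈ B ∨ ξ = Θ} := by
  let d : Ordinal.{u} → Ordinal.{u} := fun i => i + 2 + len i + 1
  -- The control cells `i` and `i + 1` and the closing cell are left unmarked.
  let TM : Ordinal.{u} → Set Ordinal.{u} := fun i =>
    {x | i < κ + 1 ∧ (x < i ∨ ∃ y < len i, x = i + 2 + y)}
  let TB : Ordinal.{u} → Set Ordinal.{u} := fun i =>
    {x | i < κ + 1 ∧ ((x < i ∧ c x ∈ c i) ∨ x = i ∨ (x = i + 1 ∧ i = κ) ∨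
      ∃ y ∈ D i, x = i + 2 + y)}
  have key : ∀ (T : Ordinal.{u} → Set Ordinal.{u}), ∀ i ≤ κ, ∀ x < d i, segPos len i + x ∈
      {ξ | ξ ∈ layout d T ∨ ξ = ordSum d (κ + 1)} ↔ x ∈ T i := by
    intro T i hi x hx
    refine (or_iff_left ?_).trans (mem_layout hx)
    exact ((add_lt_add_right hx _).trans_le (ordSum_add_le (Order.lt_add_one_iff.2 hi))).ne
  have l0 : ∀ i, ∀ j < i, j < d i := fun i j h => h.trans_le <|
    le_self_add.trans <| le_self_add.trans (le_self_add (a := i + 2 + len i))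
  have l1 : ∀ i : Ordinal.{u}, i < i + 2 := fun i => lt_add_of_pos_right _ (by simp)
  have l1' : ∀ i, i < d i := fun i => (l1 i).trans_le (le_self_add.trans le_self_add)
  have l2 : ∀ i : Ordinal.{u}, i + 1 < i + 2 := fun i => by
    rw [← one_add_one_eq_two, ← add_assoc]
    exact lt_add_one _
  have l2' : ∀ i, i + 1 < d i := fun i => (l2 i).trans_le (le_self_add.trans le_self_add)
  have l3 : ∀ i, ∀ x ≤ len i, i + 2 + x < d i := fun i x hx =>
    Order.lt_add_one_iff.2 (add_le_add_right hx _)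
  have hκ : ∀ {i}, i ≤ κ → i < κ + 1 := fun h => Order.lt_add_one_iff.2 h
  have ge : ∀ i x : Ordinal.{u}, i < i + 2 + x := fun i x => (l1 i).trans_le le_self_add
  have ge' : ∀ i x : Ordinal.{u}, i + 1 < i + 2 + x := fun i x => (l2 i).trans_le le_self_add
  refine ⟨ordSum d (κ + 1), layout d TM, layout d TB, layout_lt fun i x h => h.1,
    layout_lt fun i x h => h.1, ?_, ?_, ?_, ?_, ?_, ?_, ?_, ?_⟩
  · exact fun i hi j hj => (key TM i hi j (l0 i j hj)).2 ⟨hκ hi, .inl hj⟩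
  · intro i hi h
    rcases ((key TM i hi i (l1' i)).1 h).2 with h | ⟨y, -, h⟩
    · exact lt_irrefl i h
    · exact (ge i y).ne h
  · intro i hi x hx
    rw [add_assoc, add_assoc, ← add_assoc i]
    exact (key TM i hi _ (l3 i x hx.le)).2 ⟨hκ hi, .inr ⟨x, hx, rfl⟩⟩
  · intro i hi h
    rw [add_assoc, add_assoc, ← add_assoc i] at h
    rcases ((key TM i hi _ (l3 i _ le_rfl)).1 h).2 with h | ⟨y, hy, h⟩
    · exact (ge i (len i)).not_gt h
    · exact hy.ne (add_left_cancel h).symm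
  · intro i hi j hj
    rw [key TB i hi j (l0 i j hj)]
    constructor
    · rintro ⟨-, h | rfl | ⟨rfl, -⟩ | ⟨y, -, rfl⟩⟩
      · exact h.2
      · exact absurd hj (lt_irrefl _)
      · exact absurd hj (lt_add_one i).not_gt
      · exact absurd hj (ge i y).not_gt
    · exact fun h => ⟨hκ hi, .inl ⟨hj, h⟩⟩
  · exact fun i hi => (key TB i hi i (l1' i)).2 ⟨hκ hi, .inr (.inl rfl)⟩
  · intro i hi
    rw [add_assoc, key TB i hi _ (l2' i)]
    constructor
    · rintro ⟨-, ⟨h, -⟩ | h | ⟨-, h⟩ | ⟨y, -, h⟩⟩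
      · exact absurd h (lt_add_one i).not_gt
      · exact absurd h (lt_add_one i).ne'
      · exact h
      · exact absurd h (ge' i y).ne
    · exact fun h => ⟨hκ hi, .inr (.inr (.inl ⟨rfl, h⟩))⟩
  · intro i hi x hx
    rw [add_assoc, add_assoc, ← add_assoc i, key TB i hi _ (l3 i x hx.le)]
    constructor
    · rintro ⟨-, ⟨h, -⟩ | h | ⟨h, -⟩ | ⟨y, hy, h⟩⟩
      · exact absurd h (ge i x).not_gt
      · exact absurd h (ge i x).ne'
      · exact absurd h (ge' i x).ne'
      · rwa [add_left_cancel h]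
    · exact fun h => ⟨hκ hi, .inr (.inr (.inr ⟨x, h, rfl⟩))⟩

theorem exists_godelBase (a b : Ordinal.{u}) : ∃ N, (a < godelBase N ∧ b < godelBase N) ∧
    ∀ m < N, ¬ (a < godelBase m ∧ b < godelBase m) := by
  have hle : ∀ x : Ordinal.{u}, x < godelBase (x + 1) := fun x =>
    (godelBase_isNormal.strictMono.le_apply).trans_lt
      (godelBase_isNormal.strictMono (lt_add_one x))
  have ex : ∃ N, a < godelBase N ∧ b < godelBase N := ⟨max a b + 1,
    (le_max_left a b).trans_lt (hle _), (le_max_right a b).trans_lt (hle _)⟩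
  obtain ⟨N, hN, hmin⟩ := WellFounded.has_min (wellFounded_lt (α := Ordinal.{u}))
    {N | a < godelBase N ∧ b < godelBase N} ex
  exact ⟨N, hN, fun m hm h => hmin m h hm⟩

/-- By `codeRow_eq` the sets `codeRow (a k) (c i)` satisfy the recursion that the main loop carries
out, the bits of the script being the relation `c j ∈ c i`. The search ends at the first `h` for
which `t` denotes `c h` in the first code, or at `κ`, where the script forces an end. -/
theorem ex_search {σ : St.{u}} (hσ : σ.Ready) (m : Bool) (hsc : σ.hd .sc = 0)
    (hee : ∀ k, σ.tp (.inr (.ee k)) = ∅) (hem : σ.tp (.inr .em) = ∅) {κ : Ordinal.{u}}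
    {c : Ordinal.{u} → ZFSet.{u}} {len : Ordinal.{u} → Ordinal.{u}}
    {D : Ordinal.{u} → Set Ordinal.{u}}
    (hs : IsScript κ c len D (σ.tp (.inr .mark)) (σ.tp (.inr .bit)))
    (hc : ∀ i ≤ κ, ∀ z ∈ c i, ∃ j < i, c j = z) {a : Bool → OrdPair.{u}} {x : Bool → ZFSet.{u}}
    (ha : ∀ k, IsCode (a k) (x k)) (hqb : ∀ k, σ.tp (.inr (.qb k)) = (a k).2.1)
    (hqe : ∀ k, σ.tp (.inr (.qe k)) = {(a k).2.bound})
    (hrho : ∀ k, σ.tp (.inr (.rho k)) = {(a k).1}) {t : Ordinal.{u}} (ht : σ.tp (target m) = {t})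
    {h : Ordinal.{u}} (hκ : h ≤ κ) (hh : t ∈ codeRow (a false) (c h) ∨ h = κ)
    (hlt : ∀ i < h, t ∉ codeRow (a false) (c i)) :
    ∃ E M, Ex (mainLoop m) .bot σ (segmentStore σ (segPos len h + h + 2) E M
      (codeRow (a true) (c h)) {0}) := by
  obtain ⟨N, hN, hmin⟩ := exists_godelBase (a false).2.bound (a true).2.bound
  have hN' : ∀ k, (a k).2.bound < godelBase N := fun k => by cases k; exacts [hN.1, hN.2]
  have hR : ∀ i ≤ h, ∀ k, codeRow (a k) (c i) = {η | η < N ∧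
      (∀ j < i, segPos len i + j ∈ σ.tp (.inr .bit) → (codeRow (a k) (c j)).Nonempty) ∧
      ((∃ y, godelPair (η, y) ∈ σ.tp (.inr (.qb k))) ∨ η ∈ σ.tp (.inr (.rho k))) ∧
      ∀ b < N, (godelPair (b, η) ∈ σ.tp (.inr (.qb k)) ↔ ∃ j < i,
        segPos len i + j ∈ σ.tp (.inr .bit) ∧ b ∈ codeRow (a k) (c j))} := by
    intro i hi k
    rw [codeRow_eq (ha k) (hN' k) (hc i (hi.trans hκ)), hqb, hrho]
    ext η
    refine and_congr Iff.rfl (and_congr (forall_congr' fun j => forall_congr' fun hj =>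
      imp_congr (hs.bit_row i (hi.trans hκ) j hj).symm Iff.rfl) (and_congr Iff.rfl
      (forall_congr' fun b => forall_congr' fun _ => iff_congr Iff.rfl (exists_congr fun j =>
        and_congr_right fun hj => and_congr (hs.bit_row i (hi.trans hκ) j hj).symm Iff.rfl))))
  have hH : ∀ i ≤ h, (t ∈ codeRow (a false) (c i) ∨ i = κ) ↔
      (segPos len i + i ∈ σ.tp (.inr .bit) ∧ ∃ η ∈ codeRow (a false) (c i), η ∈ σ.tp (target m)) ∨
        segPos len i + i + 1 ∈ σ.tp (.inr .bit) := by
    intro i hi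
    rw [hs.bit_force i (hi.trans hκ), ht]
    refine or_congr ?_ Iff.rfl
    simp [hs.bit_self i (hi.trans hκ)]
  obtain ⟨E, M, H⟩ := ex_mainLoop hσ m hsc hee hem (N := N) (h := h)
    (fun k => ⟨_, by rw [hqe]; rfl, hN' k⟩)
    (fun n hn hk => hmin n hn ⟨by
      obtain ⟨c, hc, h⟩ := hk false
      rw [hqe] at hc
      rwa [← (show c = _ from hc)], by
      obtain ⟨c, hc, h⟩ := hk true
      rw [hqe] at hc
      rwa [← (show c = _ from hc)]⟩)
    (fun k c hc => by
      rw [hqb] at hc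
      exact (OrdPair.lt_bound hc).trans (hN' k))
    len (fun i hi => hs.row i (hi.trans hκ)) (fun i hi => hs.row_end i (hi.trans hκ))
    (fun i hi => hs.data i (hi.le.trans hκ)) (fun i hi => hs.data_end i (hi.le.trans hκ))
    (fun i k => codeRow (a k) (c i)) hR (fun i => t ∈ codeRow (a false) (c i) ∨ i = κ) hH hh
    (by
      rintro i hi (h' | h')
      · exact hlt i hi h'
      · exact absurd (h' ▸ hi) (not_lt.2 hκ))
  exact ⟨E, M, Exec.mono H (Store.bot_below _)⟩

/-- The store after reading the codes `a` and `b` and, possibly, an ordinal. -/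
def readStore (P i₁ i₂ i₃ M B : Set Ordinal.{u}) (a : Bool → OrdPair.{u})
    (J R : Set Ordinal.{u}) : St.{u} where
  hd _ := 0
  tp
    | .inl 0 => P
    | .inl 1 => i₁
    | .inl 2 => i₂
    | .inl 3 => i₃
    | .inr (.z _) => {0}
    | .inr .mark => M
    | .inr .bit => B
    | .inr (.qb k) => (a k).2.1
    | .inr (.qe k) => {(a k).2.bound}
    | .inr (.rho k) => {(a k).1}
    | .inr .jk => J
    | .inr .r => R
    | _ => ∅

theorem readStore_ready (P i₁ i₂ i₃ M B : Set Ordinal.{u}) (a : Bool → OrdPair.{u})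
    (J R : Set Ordinal.{u}) : (readStore P i₁ i₂ i₃ M B a J R).Ready := by
  constructor <;> intros <;> rfl

/-- Read two codes from the tapes `t₁` and `t₂`. -/
def readCodes (t₁ t₂ : Tp) : Com := .seq (readCode t₁ false) (readCode t₂ true)

theorem ex_readCodes {P i₁ i₂ i₃ M B : Set Ordinal.{u}} {a : Bool → OrdPair.{u}} {t₁ t₂ : Fin 5}
    (h₁ : (prepStore P i₁ i₂ i₃ M B).tp (.inl t₁) = (a false).ones)
    (h₂ : (prepStore P i₁ i₂ i₃ M B).tp (.inl t₂) = (a true).ones) :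
    Ex (readCodes (.inl t₁) (.inl t₂)) .bot (prepStore P i₁ i₂ i₃ M B)
      (readStore P i₁ i₂ i₃ M B a ∅ ∅) := by
  have hq : ∀ t : Fin 5, tapeGrp (.inl t) ≠ .q := by intro t; fin_cases t <;> simp [tapeGrp]
  have hh : ∀ t : Fin 5, tapeGrp (.inl t) ≠ .h1 := by intro t; fin_cases t <;> simp [tapeGrp]
  refine cast (congrArg _ ?_) (Exec.seq
    (ex_readCode (k := false) (a := a false) (hq _) (hh _) (fun _ => rfl) rfl rfl rfl rfl rfl rfl h₁)
    (ex_readCode (k := true) (a := a true) (hq _) (hh _) ?_ rfl rfl rfl ?_ ?_ ?_ ?_))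
  · refine Store.ext rfl (funext fun t => ?_)
    rcases t with j | w
    · fin_cases j <;> rfl
    · cases w <;> first | rfl | (rename_i k; cases k <;> rfl)
  all_goals first | exact fun _ => rfl | rfl | exact h₂

/-- The search for the first code among the two in the input, for lookup by sets. -/
def lookupSet : Com :=
  .seq prepare <| .seq (readCodes (.inl 1) (.inl 1)) <| .seq (mainLoop false) copyData

/-- The search for an ordinal in the first code, to translate it to the second code. -/
def translate : Com :=
  .seq prepare <| .seq (readCodes (.inl 1) (.inl 2)) <| .seq readOrd <|
    .seq (mainLoop true) <| .seq writeOrd copyData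

/-- The search for the set with the first code in the second code. -/
def locate : Com :=
  .seq prepare <| .seq (readCodes (.inl 1) (.inl 2)) <|
    .seq (mainLoop false) <| .seq writeOrd copyData

theorem exists_least {p : Ordinal.{u} → Prop} (h : ∃ i, p i) : ∃ i, p i ∧ ∀ j < i, ¬ p j := by
  obtain ⟨i, hi, hmin⟩ := WellFounded.has_min (wellFounded_lt (α := Ordinal.{u})) {i | p i} h
  exact ⟨i, hi, fun j hj hp => hmin j hp hj⟩

theorem ex_copyEntry {σ : St.{u}} {κ h : Ordinal.{u}} {c : Ordinal.{u} → ZFSet.{u}}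
    {len : Ordinal.{u} → Ordinal.{u}} {D : Ordinal.{u} → Set Ordinal.{u}}
    (hs : IsScript κ c len D (σ.tp (.inr .mark)) (σ.tp (.inr .bit))) (hκ : h ≤ κ)
    (hsc : σ.hd .sc = segPos len h + h + 2) (hD : ∀ x ∈ D h, x < len h)
    (ho : ∀ ξ ∈ σ.tp (.inl 4), ξ < σ.hd .out) : ∃ σ', Ex copyData .bot σ σ' ∧
      σ'.tp (.inl 4) = σ.tp (.inl 4) ∪ {ξ | ∃ x ∈ D h, ξ = σ.hd .out + x} := by
  refine ⟨_, ex_copyData hsc rfl (hs.data h hκ) (hs.data_end h hκ) ho, ?_⟩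
  ext ξ
  simp only [Store.setTp, Function.update_self, Set.mem_union, Set.mem_ofPred_eq]
  refine or_congr Iff.rfl (exists_congr fun x => ⟨?_, ?_⟩)
  · rintro ⟨hx, h₁, h₂⟩
    exact ⟨(hs.bit_data h hκ x hx).1 h₁, h₂⟩
  · rintro ⟨hx, h₂⟩
    exact ⟨hD x hx, (hs.bit_data h hκ x (hD x hx)).2 hx, h₂⟩

/-- Tables indexed by sets can be computed from codes of these sets. -/
theorem exists_setTable (o : Ordinal.{u}) (D : ZFSet.{u} → Set Ordinal.{u}) (D₀ : Set Ordinal.{u})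
    (hD : ∀ x, BddAbove (D x)) (hD' : ∀ x, o ≤ x.rank → D x = D₀) :
    ∃ r : Realiser.{u}, ∀ a x, IsCode a x → r.Computes₁ a (Tape.ofSet (D x)) := by
  obtain ⟨κ, c, hc, hco⟩ := exists_enumeration o
  have hx₀ : o ≤ o.toZFSet.rank := (Ordinal.rank_toZFSet o).ge
  choose l hl using hD
  -- The last segment, where the search is forced to end, carries the default data: the von Neumann
  -- ordinal `o` has rank `o`, so its data are `D₀`.
  open Classical in
  let E : Ordinal.{u} → ZFSet.{u} := fun i => if i = κ then o.toZFSet else c i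
  obtain ⟨Θ, M, B, hM, hB, hs⟩ := exists_script κ c (fun i => l (E i) + 1) (fun i => D (E i))
  refine ⟨comRealiser lookupSet (scriptParam hM hB), fun a x ha => ?_⟩
  obtain ⟨h, hh, hlt⟩ := exists_least (p := fun i => a.1 ∈ codeRow a (c i) ∨ i = κ) ⟨κ, .inr rfl⟩
  have hκ : h ≤ κ := by
    by_contra! hc
    exact hlt κ hc (.inr rfl)
  -- If nothing is found before `κ`, then `x` is not enumerated, so its rank is at least `o` and the
  -- default data are the right ones.
  have hDx : D (E h) = D x := by
    by_cases hhκ : h = κ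
    · simp only [E, if_pos hhκ]
      rw [hD' _ hx₀, hD']
      by_contra! hx
      obtain ⟨i, hi, rfl⟩ := hco x hx
      exact hlt i (hhκ ▸ hi) (.inl (mem_codeRow_self ha))
    · simp only [E, if_neg hhκ]
      rw [IsCode.unique ((hh.resolve_right hhκ).1) ha]
  obtain ⟨E', M', hE⟩ := ex_search (readStore_ready (scriptParam hM hB).toPair.ones a.ones ∅ ∅
    {ξ | ξ ∈ M ∨ ξ = Θ} {ξ | ξ ∈ B ∨ ξ = Θ} (fun _ => a) ∅ ∅) false rfl (fun _ => rfl) rfl hs hc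
    (fun _ => ha) (fun _ => rfl) (fun _ => rfl) (fun _ => rfl) (t := a.1) rfl hκ hh
    fun i hi h' => hlt i hi (.inl h')
  obtain ⟨σ', hσ', ho⟩ := ex_copyEntry (σ := segmentStore (readStore (scriptParam hM hB).toPair.ones
    a.ones ∅ ∅ {ξ | ξ ∈ M ∨ ξ = Θ} {ξ | ξ ∈ B ∨ ξ = Θ} (fun _ => a) ∅ ∅)
    (segPos (fun i => l (E i) + 1) h + h + 2) E' M' (codeRow a (c h)) {0}) hs hκ rfl
    (fun ξ hξ => Order.lt_add_one_iff.2 (hl _ hξ)) fun ξ hξ => hξ.elim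
  have := comRealiser_computes (.seq (ex_prepare hM hB a.ones ∅ ∅)
    (.seq (ex_readCodes (a := fun _ => a) (t₁ := 1) (t₂ := 1) rfl rfl) (.seq hE hσ')))
  have e : (∅ ∪ {ξ | ∃ y ∈ D x, ξ = 0 + y} : Set Ordinal.{u}) = D x := by
    simp
  rw [ho, hDx] at this
  rw [Realiser.Computes₁, blank_eq, ← e]
  exact this

/-- `writeOrd` produces the first part; the tail at `2 * η` has the same shape for all `η`, so it
can be stored as data in the script. -/
theorem ones_ordPair (η : Ordinal.{u}) : (ordPair η).ones =
    {ξ | ∃ x < η, ξ = 2 * x + 1} ∪ {ξ | ∃ x ∈ ({1, 2, 3} : Set Ordinal.{u}), ξ = 2 * η + x} := by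
  ext ξ
  rw [OrdPair.mem_ones, bound_Iio]
  have h0 : (ordPair η).1 = 0 := rfl
  simp only [h0, add_zero, Set.mem_union, Set.mem_ofPred_eq, Set.mem_insert_iff,
    Set.mem_singleton_iff, exists_eq_or_imp, exists_eq_left]
  rfl

theorem two_mul_add_one_lt {η : Ordinal.{u}} :
    ∀ ξ ∈ {ξ : Ordinal.{u} | ∃ x < η, ξ = 2 * x + 1}, ξ < 2 * η := by
  rintro _ ⟨x, hx, rfl⟩
  refine lt_of_lt_of_le (b := 2 * (x + 1)) ?_ (mul_le_mul_right (Order.add_one_le_iff.2 hx) 2)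
  rw [two_mul_add_one']
  exact lt_add_one _

theorem len_ordPair (η : Ordinal.{u}) : (ordPair η).len = 2 * η + 4 := by
  rw [OrdPair.len, bound_Iio]
  have h0 : (ordPair η).1 = 0 := rfl
  rw [h0, add_zero, add_assoc]
  norm_num

/-- Ordinals that represent sets of bounded rank can be translated from code to code. -/
theorem exists_translate (o : Ordinal.{u}) : ∃ r : Realiser.{u}, ∀ a b x y z ξ η, IsCode a x →
    IsCode b y → z.rank < o → ξ ∈ codeRow a z → η ∈ codeRow b z →
    r.Computes₃ a b (ordPair ξ) (ordPair η).tape := by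
  obtain ⟨κ, c, hc, hco⟩ := exists_enumeration o
  -- The data of every segment are the tail of the low-level code of an ordinal; `4` is the least
  -- length that covers its cells `1`, `2`, `3`.
  obtain ⟨Θ, M, B, hM, hB, hs⟩ := exists_script κ c (fun _ => 4) (fun i => {1, 2, 3})
  refine ⟨comRealiser translate (scriptParam hM hB), fun a b x y z ξ η ha hb hz hξ hη => ?_⟩
  obtain ⟨i, hi, rfl⟩ := hco z hz
  -- The enumeration may repeat sets, so the search can stop before `i`, but at an entry for the
  -- same set.
  obtain ⟨h, hh, hlt⟩ := exists_least (p := fun i => ξ ∈ codeRow a (c i)) ⟨i, hξ⟩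
  have hhi : h ≤ i := by
    by_contra! hc
    exact hlt i hc hξ
  have hch : c h = c i := IsCode.unique hh.1 hξ.1
  let a' : Bool → OrdPair.{u} := fun k => if k then b else a
  let x' : Bool → ZFSet.{u} := fun k => if k then y else x
  have ha' : ∀ k, IsCode (a' k) (x' k) := by intro k; cases k; exacts [ha, hb]
  have hro := ex_readOrd (σ := readStore (scriptParam hM hB).toPair.ones a.ones b.ones
    (ordPair ξ).ones {ξ | ξ ∈ M ∨ ξ = Θ} {ξ | ξ ∈ B ∨ ξ = Θ} a' ∅ ∅) (ξ := ξ) (fun _ => rfl) rfl rfl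
    rfl rfl rfl
  have er : ((readStore (scriptParam hM hB).toPair.ones a.ones b.ones
    (ordPair ξ).ones {ξ | ξ ∈ M ∨ ξ = Θ} {ξ | ξ ∈ B ∨ ξ = Θ} a' ∅ ∅).setTp (.inr .jk)
      (Set.Iio ξ)).setTp (.inr .r) {ξ} = readStore (scriptParam hM hB).toPair.ones a.ones b.ones
    (ordPair ξ).ones {ξ | ξ ∈ M ∨ ξ = Θ} {ξ | ξ ∈ B ∨ ξ = Θ} a' (Set.Iio ξ) {ξ} := by
    refine Store.ext rfl (funext fun t => ?_)
    rcases t with j | w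
    · fin_cases j <;> rfl
    · cases w <;> rfl
  rw [er] at hro
  obtain ⟨E', M', hE⟩ := ex_search (readStore_ready (scriptParam hM hB).toPair.ones a.ones b.ones
    (ordPair ξ).ones {ξ | ξ ∈ M ∨ ξ = Θ} {ξ | ξ ∈ B ∨ ξ = Θ} a' (Set.Iio ξ) {ξ}) true rfl
    (fun _ => rfl) rfl hs hc ha' (fun _ => rfl) (fun _ => rfl) (fun _ => rfl) (t := ξ) rfl
    (hhi.trans hi.le) (.inl hh) hlt
  have hη' : ∀ η', η' ∈ codeRow b (c h) → η' = η := fun η' h' => by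
    rw [hch] at h'
    exact hb.injective h'.1 hη.1
  have hw := ex_writeOrd (σ := segmentStore (readStore (scriptParam hM hB).toPair.ones a.ones b.ones
    (ordPair ξ).ones {ξ | ξ ∈ M ∨ ξ = Θ} {ξ | ξ ∈ B ∨ ξ = Θ} a' (Set.Iio ξ) {ξ})
    (segPos (fun _ => 4) h + h + 2) E' M' (codeRow b (c h)) {0}) rfl rfl rfl (η := η)
    (show η ∈ codeRow b (c h) by rwa [hch]) (fun x hx h' => hx.ne (hη' x h'))
  obtain ⟨σ', hσ', ho⟩ := ex_copyEntry (σ := writeStore (segmentStore (readStore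
    (scriptParam hM hB).toPair.ones a.ones b.ones (ordPair ξ).ones {ξ | ξ ∈ M ∨ ξ = Θ}
    {ξ | ξ ∈ B ∨ ξ = Θ} a' (Set.Iio ξ) {ξ}) (segPos (fun _ => 4) h + h + 2) E' M'
    (codeRow b (c h)) {0}) (2 * η) η {ξ | ∃ x < η, ξ = 2 * x + 1}) hs (hhi.trans hi.le) rfl
    (by rintro x (rfl | rfl | rfl) <;> norm_num) two_mul_add_one_lt
  have := comRealiser_computes (.seq (ex_prepare hM hB a.ones b.ones (ordPair ξ).ones)
    (.seq (ex_readCodes (a := a') (t₁ := 1) (t₂ := 2) rfl rfl) (.seq hro (.seq hE (.seq hw hσ')))))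
  rw [ho] at this
  rw [OrdPair.tape, ones_ordPair]
  exact this

theorem OrdPair.lt_len {q : OrdPair.{u}} {ξ : Ordinal.{u}} (h : ξ ∈ q.ones) : ξ < q.len := by
  rw [OrdPair.len, Order.lt_add_one_iff]
  rcases h with ⟨x, hx, rfl⟩ | rfl | rfl | rfl
  · refine le_trans (le_of_lt ?_) (le_self_add.trans le_self_add)
    exact two_mul_add_one_lt _ ⟨x, OrdPair.lt_bound hx, rfl⟩
  · exact le_trans (add_le_add_right (by norm_num) _) le_self_add
  · exact le_trans (add_le_add_right (by norm_num) _) le_self_add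
  · exact le_rfl

/-- The part of the low-level code of `⟨η, q⟩` that follows the block of the bits of `η`. -/
def pairTail (q : OrdPair.{u}) : Set Ordinal.{u} :=
  {1, 2, 3} ∪ {ξ | ∃ x ∈ q.ones, ξ = 4 + x} ∪
    {ξ | ∃ x ∈ ({0, 1, 2, 3} : Set Ordinal.{u}), ξ = 4 + q.len + x}

theorem pairTail_lt (q : OrdPair.{u}) : ∀ ξ ∈ pairTail q, ξ < 4 + q.len + 4 := by
  have h4 : (4 : Ordinal.{u}) ≤ 4 + q.len := le_self_add
  have h0 : 4 + q.len ≤ 4 + q.len + 4 := le_self_add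
  rintro ξ ((h | ⟨x, hx, rfl⟩) | ⟨x, hx, rfl⟩)
  · refine lt_of_lt_of_le ?_ (h4.trans h0)
    rcases h with rfl | rfl | rfl <;> norm_num
  · refine ((add_lt_add_iff_left 4).2 ?_).trans_le h0
    exact OrdPair.lt_len hx
  · refine (add_lt_add_iff_left _).2 ?_
    rcases hx with rfl | rfl | rfl | rfl <;> norm_num

theorem tape₂_ordPair (η : Ordinal.{u}) (q : OrdPair.{u}) : OrdPair.tape₂ (ordPair η) q =
    Tape.ofSet ({ξ | ∃ x < η, ξ = 2 * x + 1} ∪ {ξ | ∃ x ∈ pairTail q, ξ = 2 * η + x}) := by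
  rw [OrdPair.tape₂, ones_ordPair, len_ordPair]
  congr 1
  ext ξ
  constructor
  · rintro (((h | ⟨x, hx, rfl⟩) | ⟨x, hx, rfl⟩) | h)
    · exact .inl h
    · exact .inr ⟨x, .inl (.inl hx), rfl⟩
    · exact .inr ⟨4 + x, .inl (.inr ⟨x, hx, rfl⟩), add_assoc _ _ _⟩
    · rcases h with rfl | rfl | rfl | rfl
      · exact .inr ⟨4 + q.len + 0, .inr ⟨0, by simp, rfl⟩, by simp only [add_assoc, add_zero]⟩
      · exact .inr ⟨4 + q.len + 1, .inr ⟨1, by simp, rfl⟩, by simp only [add_assoc]⟩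
      · exact .inr ⟨4 + q.len + 2, .inr ⟨2, by simp, rfl⟩, by simp only [add_assoc]⟩
      · exact .inr ⟨4 + q.len + 3, .inr ⟨3, by simp, rfl⟩, by simp only [add_assoc]⟩
  · rintro (h | ⟨_, (hx | ⟨x, hx, rfl⟩) | ⟨x, hx, rfl⟩, rfl⟩)
    · exact .inl (.inl (.inl h))
    · exact .inl (.inl (.inr ⟨_, hx, rfl⟩))
    · exact .inl (.inr ⟨x, hx, add_assoc _ _ _⟩)
    · refine .inr ?_
      rcases hx with rfl | rfl | rfl | rfl
      · exact .inl (by simp only [add_assoc, add_zero])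
      · exact .inr (.inl (by simp only [add_assoc]))
      · exact .inr (.inr (.inl (by simp only [add_assoc])))
      · exact .inr (.inr (.inr (by simp only [add_assoc]; rfl)))

/-- Sets of bounded rank can be found in the codes of sets that contain them. -/
theorem exists_locate (o : Ordinal.{u}) (s : Realiser.{u}) : ∃ r : Realiser.{u},
    ∀ a b x y η, IsCode a x → IsCode b y → x.rank < o → η ∈ codeRow b x →
    r.Computes₂ a b (OrdPair.tape₂ (ordPair η) s.toPair) := by
  obtain ⟨κ, c, hc, hco⟩ := exists_enumeration o
  -- The code of the realiser `s` is part of the data, the same in all segments; hence the returned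
  -- realiser does not depend on the input codes.
  obtain ⟨Θ, M, B, hM, hB, hs⟩ := exists_script κ c (fun _ => 4 + s.toPair.len + 4)
    (fun i => pairTail s.toPair)
  refine ⟨comRealiser locate (scriptParam hM hB), fun a b x y η ha hb hx hη => ?_⟩
  obtain ⟨i, hi, rfl⟩ := hco x hx
  obtain ⟨h, hh, hlt⟩ := exists_least (p := fun i => a.1 ∈ codeRow a (c i))
    ⟨i, mem_codeRow_self ha⟩
  have hhi : h ≤ i := by
    by_contra! hc
    exact hlt i hc (mem_codeRow_self ha)
  have hch : c h = c i := IsCode.unique hh.1 ha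
  let a' : Bool → OrdPair.{u} := fun k => if k then b else a
  let x' : Bool → ZFSet.{u} := fun k => if k then y else c i
  have ha' : ∀ k, IsCode (a' k) (x' k) := by intro k; cases k; exacts [ha, hb]
  obtain ⟨E', M', hE⟩ := ex_search (readStore_ready (scriptParam hM hB).toPair.ones a.ones b.ones
    ∅ {ξ | ξ ∈ M ∨ ξ = Θ} {ξ | ξ ∈ B ∨ ξ = Θ} a' ∅ ∅) false rfl
    (fun _ => rfl) rfl hs hc ha' (fun _ => rfl) (fun _ => rfl) (fun _ => rfl) (t := a.1) rfl
    (hhi.trans hi.le) (.inl hh) hlt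
  have hη' : ∀ η', η' ∈ codeRow b (c h) → η' = η := fun η' h' => by
    rw [hch] at h'
    exact hb.injective h'.1 hη.1
  have hw := ex_writeOrd (σ := segmentStore (readStore (scriptParam hM hB).toPair.ones a.ones b.ones
    ∅ {ξ | ξ ∈ M ∨ ξ = Θ} {ξ | ξ ∈ B ∨ ξ = Θ} a' ∅ ∅)
    (segPos (fun _ => 4 + s.toPair.len + 4) h + h + 2) E' M' (codeRow b (c h)) {0}) rfl rfl rfl
    (η := η) (show η ∈ codeRow b (c h) by rwa [hch]) (fun x hx h' => hx.ne (hη' x h'))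
  obtain ⟨σ', hσ', ho⟩ := ex_copyEntry (σ := writeStore (segmentStore (readStore
    (scriptParam hM hB).toPair.ones a.ones b.ones ∅ {ξ | ξ ∈ M ∨ ξ = Θ}
    {ξ | ξ ∈ B ∨ ξ = Θ} a' ∅ ∅) (segPos (fun _ => 4 + s.toPair.len + 4) h + h + 2) E' M'
    (codeRow b (c h)) {0}) (2 * η) η {ξ | ∃ x < η, ξ = 2 * x + 1}) hs (hhi.trans hi.le) rfl
    (pairTail_lt _) two_mul_add_one_lt
  have := comRealiser_computes (.seq (ex_prepare hM hB a.ones b.ones ∅)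
    (.seq (ex_readCodes (a := a') (t₁ := 1) (t₂ := 2) rfl rfl) (.seq hE (.seq hw hσ'))))
  rw [ho] at this
  rw [Realiser.Computes₂, tape₂_ordPair, blank_eq]
  exact this

/-! ### Unique readability of low-level codes -/

theorem Tape.ofSet_injective : Function.Injective Tape.ofSet.{u} := by
  intro S T h
  ext ξ
  have := congrFun h ξ
  simpa [Tape.ofSet] using this

namespace OrdPair

theorem bound_le_of_agree {a a' : OrdPair.{u}} {S : Set Ordinal.{u}}
    (h : ∀ ξ < a.len, ξ ∈ S ↔ ξ ∈ a.ones) (h' : ∀ ξ < a'.len, ξ ∈ S ↔ ξ ∈ a'.ones) :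
    a'.2.bound ≤ a.2.bound := by
  by_contra! hc
  have h₁ := (h _ (lt_len a.even_mem_ones)).2 a.even_mem_ones
  have hlt : a.2.bound + 1 < a'.2.bound + 1 := by simpa using hc
  have h₂ : 2 * (a.2.bound + 1) < a'.len := (two_mul_lt.2 hlt).trans (lt_len a'.even_mem_ones)
  exact a'.even_notMem_ones hlt ((h' _ h₂).1 h₁)

/-- Low-level codes form a prefix code: the first even cell with a one gives the bound, the odd
cells before it the set, and the next one after the terminator the ordinal. So two codes that are
initial segments of the same sequence coincide. -/
theorem eq_of_agree {a a' : OrdPair.{u}} {S : Set Ordinal.{u}}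
    (h : ∀ ξ < a.len, ξ ∈ S ↔ ξ ∈ a.ones) (h' : ∀ ξ < a'.len, ξ ∈ S ↔ ξ ∈ a'.ones) : a = a' := by
  have hb : a.2.bound = a'.2.bound :=
    le_antisymm (bound_le_of_agree h' h) (bound_le_of_agree h h')
  have h2 : ∀ {a a' : OrdPair.{u}}, (∀ ξ < a.len, ξ ∈ S ↔ ξ ∈ a.ones) →
      (∀ ξ < a'.len, ξ ∈ S ↔ ξ ∈ a'.ones) → a.2.bound = a'.2.bound → a.2.1 ⊆ a'.2.1 := by
    intro a a' h h' hb x hx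
    have hxb := lt_bound hx
    have h₁ := (a.odd_mem_ones hxb).2 hx
    have h₂ := (h _ (lt_len h₁)).2 h₁
    rw [hb] at hxb
    refine (a'.odd_mem_ones hxb).1 ((h' _ ?_).1 h₂)
    refine (two_mul_add_one_lt _ ⟨x, hxb, rfl⟩).trans
      ((two_mul_lt.2 (lt_add_one _)).trans (lt_len a'.even_mem_ones))
  have h1 : ∀ {a a' : OrdPair.{u}}, (∀ ξ < a.len, ξ ∈ S ↔ ξ ∈ a.ones) →
      (∀ ξ < a'.len, ξ ∈ S ↔ ξ ∈ a'.ones) → a.2.bound = a'.2.bound → a'.1 ≤ a.1 := by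
    intro a a' h h' hb
    by_contra! hc
    have h₁ : 2 * a.2.bound + 3 + a.1 ∈ a.ones := a.tail_mem_ones.2 rfl
    have h₂ := (h _ (lt_len h₁)).2 h₁
    rw [hb] at h₂
    have h₃ := (h' _ (((add_lt_add_iff_left _).2 hc).trans (lt_len (a'.tail_mem_ones.2 rfl)))).1 h₂
    exact hc.ne (a'.tail_mem_ones.1 h₃)
  exact Prod.ext (le_antisymm (h1 h' h hb.symm) (h1 h h' hb))
    (Subtype.ext (Set.Subset.antisymm (h2 h h' hb) (h2 h' h hb.symm)))

theorem tape_injective : Function.Injective tape.{u} := by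
  intro a a' h
  have := Tape.ofSet_injective h
  exact eq_of_agree (S := a.ones) (fun _ _ => Iff.rfl) (fun ξ _ => by rw [this])

theorem agree_left (a b : OrdPair.{u}) : ∀ ξ < a.len, ξ ∈ a.ones ∪ (fun ξ => a.len + ξ) '' b.ones ∪
    {a.len + b.len, a.len + b.len + 1, a.len + b.len + 2, a.len + b.len + 3} ↔ ξ ∈ a.ones := by
  intro ξ hξ
  constructor
  · rintro ((h | ⟨x, -, rfl⟩) | rfl | rfl | rfl | rfl)
    · exact h
    · exact absurd hξ (not_lt.2 le_self_add)
    all_goals exact absurd hξ (not_lt.2 (by first | exact le_self_add | (rw [add_assoc]; exact le_self_add)))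
  · exact fun h => .inl (.inl h)

theorem agree_right (a b : OrdPair.{u}) : ∀ ξ < b.len, ξ ∈ {ξ | a.len + ξ ∈
    a.ones ∪ (fun ξ => a.len + ξ) '' b.ones ∪
    {a.len + b.len, a.len + b.len + 1, a.len + b.len + 2, a.len + b.len + 3}} ↔ ξ ∈ b.ones := by
  intro ξ hξ
  constructor
  · rintro ((h | ⟨x, h, h'⟩) | h)
    · exact absurd (lt_len h) (not_lt.2 le_self_add)
    · rwa [← add_left_cancel (show a.len + x = a.len + ξ from h')]
    · simp only [add_assoc, Set.mem_insert_iff, Set.mem_singleton_iff] at h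
      rcases h with h | h | h | h <;> refine absurd hξ (not_lt.2 ?_) <;>
        rw [add_left_cancel h]
      all_goals exact le_self_add
  · exact fun h => .inl (.inr ⟨ξ, h, rfl⟩)

theorem tape₂_inj {a b a' b' : OrdPair.{u}} (h : tape₂ a b = tape₂ a' b') : a = a' ∧ b = b' := by
  have h := Tape.ofSet_injective h
  obtain rfl : a = a' := eq_of_agree (agree_left a b) (h ▸ agree_left a' b')
  exact ⟨rfl, eq_of_agree (agree_right a b) (h ▸ agree_right a b')⟩

end OrdPair

theorem OrdSet.toPair_injective : Function.Injective OrdSet.toPair.{u} :=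
  fun _ _ h => (Prod.mk.inj h).2

theorem ordPair_injective : Function.Injective ordPair.{u} := by
  intro α β h
  exact Set.Iio_injective (congrArg Subtype.val (OrdSet.toPair_injective h))

theorem Realiser.toPair_injective : Function.Injective Realiser.toPair.{u} := by
  rintro ⟨n, P⟩ ⟨m, Q⟩ h
  obtain ⟨h₁, rfl⟩ := Prod.mk.inj h
  obtain rfl : n = m := by exact_mod_cast h₁
  rfl

theorem bddAbove_ones (a : OrdPair.{u}) : BddAbove a.ones :=
  ⟨a.len, fun _ h => (OrdPair.lt_len h).le⟩

/-- A code of a sequence determines its entries, so a realiser may be chosen for `seqSet X` instead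
of `X`. -/
theorem seqSet_injective {α : Ordinal.{u}} : Function.Injective (seqSet (α := α)) := by
  intro X Y h
  funext i
  have : ZFSet.pair i.1.toZFSet (X i) ∈ seqSet Y := by
    rw [← h]
    exact ZFSet.mem_range.2 ⟨i, rfl⟩
  obtain ⟨j, hj⟩ := ZFSet.mem_range.1 this
  obtain ⟨h₁, h₂⟩ := ZFSet.pair_inj.1 hj
  rw [← h₂, Subtype.ext (Ordinal.toZFSet_injective h₁)]

/-! ### Realisers of atomic formulas -/

theorem mem_codeRow {a : OrdPair.{u}} {x y : ZFSet.{u}} {ξ : Ordinal.{u}} (ha : IsCode a x)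
    (hy : InTC y x) (h : IsCode (ξ, a.2) y) : ξ ∈ codeRow a y := by
  obtain ⟨η, hη⟩ := exists_codeRow_of_inTC ha hy
  rwa [ha.injective h hη.1]

/-- A code isomorphism maps representative to representative and preserves the denoted sets. -/
theorem RealisesEq.eq {r : Realiser.{u}} {X Y : ZFSet.{u}} (h : RealisesEq r X Y) : X = Y := by
  obtain ⟨a, ha⟩ := exists_isCode X
  obtain ⟨b, hb⟩ := exists_isCode Y
  obtain ⟨f, hf, -⟩ := h a b ha hb
  obtain ⟨y, hy, hy'⟩ := hf.decode_eq a.1 ⟨X, X, ha, ha, .refl⟩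
  rw [hf.map_rep] at hy'
  rw [IsCode.unique ha hy, IsCode.unique hb hy']

/-- The sets in the transitive closure have rank at most that of `X`, so a single translation
machine serves all codes of `X`. Its values form a bijection because every set of the closure has
exactly one index in each of the two codes. -/
theorem exists_realisesEq (X : ZFSet.{u}) : ∃ r, RealisesEq r X X := by
  obtain ⟨r, hr⟩ := exists_translate (X.rank + 1)
  refine ⟨r, fun a b ha hb => ?_⟩
  have dec : ∀ ξ ∈ essdom a, ∃ y η, InTC y X ∧ ξ ∈ codeRow a y ∧ η ∈ codeRow b y := by
    rintro ξ ⟨x, y, hx, hy, hyx⟩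
    obtain rfl := IsCode.unique ha hx
    obtain ⟨η, hη⟩ := exists_codeRow_of_inTC hb hyx
    exact ⟨y, η, hyx, mem_codeRow ha hyx hy, hη⟩
  choose! d f hd hda hdb using dec
  refine ⟨f, ⟨⟨?_, ?_, ?_⟩, ?_, fun ξ hξ => ⟨d ξ, (hda ξ hξ).1, (hdb ξ hξ).1⟩⟩, fun ξ hξ =>
    hr a b X X (d ξ) ξ (f ξ) ha hb (Order.lt_add_one_iff.2 (hd ξ hξ).rank_le) (hda ξ hξ)
      (hdb ξ hξ)⟩
  · exact fun ξ hξ => ⟨X, d ξ, hb, (hdb ξ hξ).1, hd ξ hξ⟩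
  · intro ξ hξ ξ' hξ' h
    have e := (hdb ξ hξ).1
    rw [h] at e
    exact ha.injective (y := d ξ) (hda ξ hξ).1 (e.unique (hdb ξ' hξ').1 ▸ (hda ξ' hξ').1)
  · rintro η ⟨x, y, hx, hy, hyx⟩
    obtain rfl := IsCode.unique hb hx
    obtain ⟨ξ, hξ⟩ := exists_codeRow_of_inTC ha hyx
    have he : ξ ∈ essdom a := ⟨X, y, ha, hξ.1, hyx⟩
    refine ⟨ξ, he, ?_⟩
    have e := (hda ξ he).1.unique hξ.1
    exact hb.injective (y := y) (e ▸ (hdb ξ he).1) hy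
  · have he : a.1 ∈ essdom a := ⟨X, X, ha, ha, .refl⟩
    have e := (hda _ he).1.unique ha
    exact hb.injective (y := X) (e ▸ (hdb _ he).1) hb

theorem realisesEq_iff {X Y : ZFSet.{u}} : (∃ r, RealisesEq r X Y) ↔ X = Y :=
  ⟨fun ⟨_, h⟩ => h.eq, fun h => h ▸ exists_realisesEq X⟩

theorem RealisesMem.mem {r : Realiser.{u}} {X Y : ZFSet.{u}} (h : RealisesMem r X Y) : X ∈ Y := by
  obtain ⟨a, ha⟩ := exists_isCode X
  obtain ⟨b, hb⟩ := exists_isCode Y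
  obtain ⟨α, s, Z, -, -, hZ, hs⟩ := h a b ha hb
  rwa [hs.eq]

/-- The machine returns the index of `X` in the code `b`, together with a fixed realiser of `X = X`.
Since outputs are unique and low-level codes uniquely readable, single-valuedness follows. -/
theorem exists_realisesMem {X Y : ZFSet.{u}} (h : X ∈ Y) :
    ∃ r, RealisesMem r X Y ∧ SingleValuedMem r X Y := by
  obtain ⟨s, hs⟩ := exists_realisesEq X
  obtain ⟨r, hr⟩ := exists_locate (X.rank + 1) s
  have key : ∀ a b, IsCode a X → IsCode b Y → ∃ η, IsCode (η, b.2) X ∧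
      r.Computes₂ a b (OrdPair.tape₂ (ordPair η) s.toPair) := by
    intro a b ha hb
    obtain ⟨η, hη⟩ := exists_codeRow_of_inTC hb (.single h)
    exact ⟨η, hη.1, hr a b X Y η ha hb (lt_add_one _) hη⟩
  refine ⟨r, fun a b ha hb => ?_, fun a a' b b' ha ha' hb hb' α α' t t' h₁ h₂ => ?_⟩
  · obtain ⟨η, hη, h'⟩ := key a b ha hb
    exact ⟨η, s, X, h', hη, h, hs⟩
  · obtain ⟨η, hη, h'⟩ := key a b ha hb
    obtain ⟨η', hη', h''⟩ := key a' b' ha' hb'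
    obtain ⟨e₁, e₂⟩ := OrdPair.tape₂_inj (h₁.unique h')
    obtain ⟨e₃, e₄⟩ := OrdPair.tape₂_inj (h₂.unique h'')
    rw [ordPair_injective e₁, ordPair_injective e₃]
    exact ⟨⟨X, hη, hη'⟩, Realiser.toPair_injective (e₂.trans e₄.symm)⟩

/-! ### Realisers of compound formulas -/

/-- Under all assignments, the formula is uniformly realised if and only if it is true. -/
def RealisedIffTrue (φ : Formula.{u}) : Prop :=
  ∀ v, UniformlyRealised φ v ↔ φ.IsTrue v

theorem exists_constantRealiser {D : Set Ordinal.{u}} (hD : BddAbove D) :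
    ∃ r : Realiser.{u}, ∀ a, r.Computes₁ a (Tape.ofSet D) := by
  obtain ⟨r, hr⟩ := exists_const hD
  refine ⟨r, fun a => ?_⟩
  rw [Realiser.Computes₁, blank_eq]
  exact hr _ _ _

theorem bddAbove_tape₂ (a b : OrdPair.{u}) : BddAbove (a.ones ∪ (fun ξ => a.len + ξ) '' b.ones ∪
    {a.len + b.len, a.len + b.len + 1, a.len + b.len + 2, a.len + b.len + 3}) := by
  refine ((bddAbove_ones a).union ⟨a.len + b.len, ?_⟩).union (Set.Finite.bddAbove (by simp))
  rintro _ ⟨x, hx, rfl⟩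
  exact add_le_add_right (OrdPair.lt_len hx).le _

namespace RealisedIffTrue

theorem bot : RealisedIffTrue .bot.{u} := fun _ => ⟨fun ⟨_, h⟩ => h, fun h => h.elim⟩

theorem mem (x y : Var.{u}) : RealisedIffTrue (.mem x y) := fun v =>
  ⟨fun ⟨_, h, _⟩ => h.mem, fun h => by
    obtain ⟨r, h₁, h₂⟩ := exists_realisesMem h
    exact ⟨r, h₁, fun _ => h₂⟩⟩

theorem eq (x y : Var.{u}) : RealisedIffTrue (.eq x y) := fun _ => realisesEq_iff

variable {φ ψ : Formula.{u}}

/-- A false antecedent has no realisers, by the induction hypothesis, so any realiser will do. If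
the antecedent is true, a realiser of the conclusion is returned regardless of the input. -/
theorem imp (hφ : RealisedIffTrue φ) (hψ : RealisedIffTrue ψ) : RealisedIffTrue (.imp φ ψ) := by
  refine fun v => ⟨fun ⟨r, h⟩ hv => ?_, fun h => ?_⟩
  · obtain ⟨s, hs⟩ := (hφ v).2 hv
    obtain ⟨t, -, ht⟩ := h s hs
    exact (hψ v).1 ⟨t, ht⟩
  · by_cases hv : φ.IsTrue v
    · obtain ⟨t, ht⟩ := (hψ v).2 (h hv)
      obtain ⟨r, hr⟩ := exists_constantRealiser (bddAbove_ones t.toPair)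
      exact ⟨r, fun s _ => ⟨t, hr _, ht⟩⟩
    · exact ⟨⟨0, ⟨∅, bddAbove_empty⟩⟩, fun s hs => absurd ((hφ v).1 ⟨s, hs⟩) hv⟩

theorem disj {β : Ordinal.{u}} {φ : Set.Iio β → Formula.{u}} (h : ∀ α, RealisedIffTrue (φ α)) :
    RealisedIffTrue (.disj β φ) := by
  refine fun v => ⟨fun ⟨r, γ, s, _, hs⟩ => ⟨γ, (h γ v).1 ⟨s, hs⟩⟩, fun ⟨γ, hγ⟩ => ?_⟩
  obtain ⟨s, hs⟩ := (h γ v).2 hγ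
  obtain ⟨r, hr⟩ := exists_constantRealiser (bddAbove_tape₂ (ordPair γ.1) s.toPair)
  exact ⟨r, γ, s, hr _, hs⟩

theorem conj {β : Ordinal.{u}} {φ : Set.Iio β → Formula.{u}} (h : ∀ α, RealisedIffTrue (φ α)) :
    RealisedIffTrue (.conj β φ) := by
  refine fun v => ⟨fun ⟨r, hr⟩ γ => ?_, fun hv => ?_⟩
  · obtain ⟨s, -, hs⟩ := hr γ
    exact (h γ v).1 ⟨s, hs⟩
  · have ex : ∀ γ, ∃ s, Realises True (φ γ) v s := fun γ => (h γ v).2 (hv γ)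
    choose s hs using ex
    open Classical in
    obtain ⟨r, hr⟩ := exists_table β (fun γ => if hγ : γ < β then (s ⟨γ, hγ⟩).toPair.ones else ∅)
      fun γ => by split_ifs; exacts [bddAbove_ones _, bddAbove_empty]
    refine ⟨r, fun γ => ⟨s γ, ?_, hs γ⟩⟩
    have := hr γ.1 γ.2
    rwa [dif_pos (show γ.1 < β from γ.2)] at this

theorem ex (x : Context.{u}) (h : RealisedIffTrue φ) : RealisedIffTrue (.ex x φ) := by
  refine fun v => ⟨fun ⟨r, X, a, s, _, _, hs⟩ => ⟨X, (h _).1 ⟨s, hs⟩⟩, fun ⟨X, hX⟩ => ?_⟩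
  obtain ⟨s, hs⟩ := (h _).2 hX
  obtain ⟨a, ha⟩ := exists_isCode (seqSet X)
  obtain ⟨r, hr⟩ := exists_constantRealiser (bddAbove_tape₂ a s.toPair)
  exact ⟨r, X, a, s, hr _, ha, hs⟩

/-- The bound `o` on ranks reduces the choice of realisers for all `X` to a table indexed by the
sets of rank below `o`. The table is read by the set that the input encodes, which gives
single-valuedness. -/
theorem all {β : Formula.{u}} (x : Context.{u}) (hβ : RealisedIffTrue β) (hφ : RealisedIffTrue φ)
    (hr : ∀ v : Assignment.{u}, ∃ o : Ordinal.{u}, ∀ X, β.IsTrue (v.update x X) →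
      (seqSet X).rank < o) : RealisedIffTrue (.all x (.imp β φ)) := by
  refine fun v => ⟨fun ⟨r, hr, _⟩ X => ?_, fun hv => ?_⟩
  · obtain ⟨a, ha⟩ := exists_isCode (seqSet X)
    obtain ⟨s, -, hs⟩ := hr X a ha
    exact (hβ.imp hφ _).1 ⟨s, hs⟩
  · obtain ⟨o, ho⟩ := hr v
    have ex : ∀ X, ∃ s, Realises True (.imp β φ) (v.update x X) s := fun X =>
      (hβ.imp hφ _).2 (hv X)
    choose s hs using ex
    let s₀ : Realiser.{u} := ⟨0, ⟨∅, bddAbove_empty⟩⟩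
    -- The chosen realiser is made a function of the set `seqSet X`, constant from rank `o` on, as
    -- required for `exists_setTable`.
    open Classical in
    let t : ZFSet.{u} → Realiser.{u} := fun z =>
      if h : z.rank < o ∧ ∃ X, seqSet X = z then s h.2.choose else s₀
    have ht : ∀ X, Realises True (.imp β φ) (v.update x X) (t (seqSet X)) := by
      intro X
      by_cases h : (seqSet X).rank < o
      · have h' : (seqSet X).rank < o ∧ ∃ Y : Set.Iio x.length → ZFSet.{u}, seqSet Y = seqSet X :=
          ⟨h, X, rfl⟩
        simp only [t, dif_pos h']
        rw [seqSet_injective h'.2.choose_spec]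
        exact hs X
      -- For large rank the bounding condition is false, so it has no realisers and the default
      -- realises the implication vacuously.
      · exact fun u hu => absurd (ho X ((hβ _).1 ⟨u, hu⟩)) h
    obtain ⟨r, hr⟩ := exists_setTable o (fun z => (t z).toPair.ones) s₀.toPair.ones
      (fun z => bddAbove_ones _) (fun z hz => by
        simp only [t, dif_neg (fun h : z.rank < o ∧ _ => h.1.not_ge hz)])
    refine ⟨r, fun X a ha => ⟨t (seqSet X), hr a _ ha, ht X⟩, fun _ X a a' ha ha' s s' h h' => ?_⟩
    have e := OrdPair.tape_injective (h.unique (hr a _ ha))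
    have e' := OrdPair.tape_injective (h'.unique (hr a' _ ha'))
    exact Realiser.toPair_injective (e.trans e'.symm)

end RealisedIffTrue

/-! ### Bounded formulas -/

namespace Assignment

variable (v : Assignment.{u}) (x : Context.{u}) (X : Set.Iio x.length → ZFSet.{u})

theorem update_var (j : Set.Iio x.length) : v.update x X (x.var j) = X j :=
  x.inj.extend_apply _ _ _

variable {x}

theorem update_of_notMem {y : Var.{u}} (h : y ∉ Set.range x.var) : v.update x X y = v y :=
  Function.extend_apply' _ _ _ h

theorem update_single_of_ne {x y : Var.{u}} (X : Set.Iio (Context.single x).length → ZFSet.{u})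
    (h : y ≠ x) : v.update (.single x) X y = v y :=
  v.update_of_notMem X fun ⟨_, h'⟩ => h h'.symm

end Assignment

namespace Formula

theorem isTrue_and {φ ψ : Formula.{u}} {v : Assignment.{u}} :
    (and φ ψ).IsTrue v ↔ φ.IsTrue v ∧ ψ.IsTrue v := by
  have h0 : (0 : Ordinal.{u}) < 2 := by norm_num
  have h1 : (1 : Ordinal.{u}) < 2 := by norm_num
  constructor
  · intro h
    have e0 := h ⟨0, h0⟩
    have e1 := h ⟨1, h1⟩
    simp only [if_true, one_ne_zero, if_false] at e0 e1
    exact ⟨e0, e1⟩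
  · rintro ⟨h, h'⟩ i
    dsimp only
    split_ifs
    exacts [h, h']

theorem isTrue_exIn {x y : Var.{u}} {φ : Formula.{u}} {v : Assignment.{u}} (hxy : y ≠ x)
    (h : (exIn x y φ).IsTrue v) : ∃ X, v.update (.single x) X x ∈ v y ∧
      φ.IsTrue (v.update (.single x) X) := by
  obtain ⟨X, hX⟩ := h
  obtain ⟨h₁, h₂⟩ := isTrue_and.1 hX
  refine ⟨X, ?_, h₂⟩
  rw [← v.update_single_of_ne X hxy]
  exact h₁

end Formula

/-- The second component lies in `t`, which lies in `p`. The distinctness hypotheses keep the bound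
variables from capturing `p` and `b`. -/
theorem rank_lt_of_isPair {v : Assignment.{u}} {p a b s t w : Var.{u}} (hs : p ≠ s) (ht : p ≠ t)
    (hbs : b ≠ s) (hbt : b ≠ t) (h : (Formula.isPair p a b s t w).IsTrue v) :
    (v b).rank < (v p).rank := by
  obtain ⟨S, -, h⟩ := Formula.isTrue_exIn hs h
  obtain ⟨T, hT, h⟩ := Formula.isTrue_exIn ht h
  have hb := (Formula.isTrue_and.1 (Formula.isTrue_and.1 (Formula.isTrue_and.1
    (Formula.isTrue_and.1 h).2).1).2).1
  rw [Assignment.update_single_of_ne _ _ hs] at hT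
  refine lt_trans ?_ (ZFSet.rank_lt_of_mem hT)
  have := ZFSet.rank_lt_of_mem hb
  rwa [Assignment.update_single_of_ne _ _ hbt, Assignment.update_single_of_ne _ _ hbs] at this

theorem rank_lt_of_appEq {v : Assignment.{u}} {f z x p s t w : Var.{u}} (hf : f ≠ p)
    (hs : p ≠ s) (ht : p ≠ t) (hxp : x ≠ p) (hxs : x ≠ s) (hxt : x ≠ t)
    (h : (Formula.appEq f z x p s t w).IsTrue v) : (v x).rank < (v f).rank := by
  obtain ⟨P, hP, h⟩ := Formula.isTrue_exIn hf h
  have := rank_lt_of_isPair hs ht hxs hxt h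
  rw [Assignment.update_single_of_ne _ _ hxp] at this
  exact this.trans (ZFSet.rank_lt_of_mem hP)

section Fresh

variable {x : Context.{u}} {y : Var.{u}}

theorem var_lt_freshBase (j : Set.Iio x.length) : x.var j < Formula.freshBase x y :=
  (Order.lt_succ _).trans_le <|
    (Ordinal.le_iSup (fun j => succ (x.var j)) j).trans (le_max_left _ _)

theorem lt_freshBase : y < Formula.freshBase x y :=
  (Order.lt_succ _).trans_le (le_max_right _ _)

/-- `x_j` is the second component of a pair in `f`, and `f ∈ y`. Only these two parts of the formula
matter for the rank. -/
theorem rank_lt_of_memSeq {v : Assignment.{u}} (h : (Formula.memSeq x y).IsTrue v)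
    (j : Set.Iio x.length) : (v (x.var j)).rank < (v y).rank := by
  obtain ⟨F, D, Z, h⟩ := h
  obtain ⟨-, h⟩ := Formula.isTrue_and.1 h
  obtain ⟨h₁, hy⟩ := Formula.isTrue_and.1 h
  have hj := (Formula.isTrue_and.1 ((Formula.isTrue_and.1 ((Formula.isTrue_and.1 h₁).1 j)).2)).2
  -- All the variables bound in the formula have indices from `freshBase` on, so `y` and the
  -- variables of `x` keep their values.
  have hu : ∀ w < Formula.freshBase x y, ((((v.update (.single (Formula.freshBase x y)) F).update (.single (Formula.freshBase x y + 1)) D).update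
      (Formula.freshContext (Formula.freshBase x y + Ordinal.omega0) x.length) Z) w) = v w := by
    intro w hw
    rw [Assignment.update_of_notMem, Assignment.update_single_of_ne,
      Assignment.update_single_of_ne _ _ hw.ne]
    · exact (hw.trans_le le_self_add).ne
    · rintro ⟨i, rfl⟩
      exact absurd hw (not_lt.2 (le_self_add.trans le_self_add))
  have hc : ∀ n : ℕ, Formula.freshBase x y < Formula.freshBase x y + 2 + n := fun n =>
    (lt_add_of_pos_right _ (by norm_num)).trans_le le_self_add
  have hcc : ∀ n m : ℕ, n ≠ m → Formula.freshBase x y + 2 + (n : Ordinal.{u}) ≠ Formula.freshBase x y + 2 + m := fun n m h h' =>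
    h (by exact_mod_cast add_left_cancel h')
  have hxc : ∀ n : ℕ, x.var j ≠ Formula.freshBase x y + 2 + n := fun n => ((var_lt_freshBase j).trans (hc n)).ne
  have := (rank_lt_of_appEq (hc 0).ne (hcc 0 1 (by norm_num)) (hcc 0 2 (by norm_num)) (hxc 0)
    (hxc 1) (hxc 2) hj).trans (ZFSet.rank_lt_of_mem hy)
  rwa [hu _ (var_lt_freshBase j), hu _ lt_freshBase] at this

end Fresh

theorem rank_lt_of_isBound {x : Context.{u}} {y : Var.{u}} {β : Formula.{u}}
    (hβ : Formula.IsBound x y β) {v : Assignment.{u}} (h : β.IsTrue v) (j : Set.Iio x.length) :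
    (v (x.var j)).rank < (v y).rank := by
  cases hβ with
  | single w hw =>
    subst hw
    exact ZFSet.rank_lt_of_mem h
  | finite _ => exact ZFSet.rank_lt_of_mem (h j)
  | infinite _ => exact rank_lt_of_memSeq h j

/-- The index and the entry have rank below `max α o`. The three successors account for the two
levels of a Kuratowski pair and for the set of pairs. -/
theorem rank_seqSet_lt {α o : Ordinal.{u}} {X : Set.Iio α → ZFSet.{u}}
    (h : ∀ j, (X j).rank < o) : (seqSet X).rank < max α o + 1 + 1 + 1 := by
  rw [Order.lt_add_one_iff, ZFSet.rank_le_iff]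
  intro z hz
  obtain ⟨i, rfl⟩ := ZFSet.mem_range.1 hz
  have hi : i.1.toZFSet.rank < max α o := by
    rw [Ordinal.rank_toZFSet]
    exact lt_max_of_lt_left i.2
  have hX : (X i).rank < max α o := lt_max_of_lt_right (h i)
  rw [Order.lt_add_one_iff, ZFSet.rank_le_iff]
  intro w hw
  rw [Order.lt_add_one_iff, ZFSet.rank_le_iff]
  intro y hy
  rcases ZFSet.mem_pair.1 hw with rfl | rfl
  · rwa [ZFSet.mem_singleton.1 hy]
  · rcases ZFSet.mem_pair.1 hy with rfl | rfl
    exacts [hi, hX]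

/-! ### Defined connectives, bounding formulas and the induction. -/

namespace RealisedIffTrue

variable {φ ψ : Formula.{u}}

theorem and (hφ : RealisedIffTrue φ) (hψ : RealisedIffTrue ψ) : RealisedIffTrue (φ.and ψ) :=
  conj fun i => by split_ifs; exacts [hφ, hψ]

theorem or (hφ : RealisedIffTrue φ) (hψ : RealisedIffTrue ψ) : RealisedIffTrue (φ.or ψ) :=
  disj fun i => by split_ifs; exacts [hφ, hψ]

/-- Each `X j` has smaller rank than the value of `y`, which the quantifier does not change because
`y` is not in `x`. With `rank_seqSet_lt` this bounds the rank of the whole sequence. -/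
theorem allBdd {x : Context.{u}} {y : Var.{u}} {β : Formula.{u}} (hy : y ∉ Set.range x.var)
    (hb : Formula.IsBound x y β) (hβ : RealisedIffTrue β) (hφ : RealisedIffTrue φ) :
    RealisedIffTrue (.all x (.imp β φ)) :=
  all x hβ hφ fun v => ⟨_, fun X hX => rank_seqSet_lt fun j => by
    have := rank_lt_of_isBound hb hX j
    rwa [v.update_var, v.update_of_notMem X hy] at this⟩

theorem exIn (x y : Var.{u}) (hφ : RealisedIffTrue φ) : RealisedIffTrue (.exIn x y φ) :=
  ex _ ((mem x y).and hφ)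

theorem allIn {x y : Var.{u}} (hxy : x ≠ y) (hφ : RealisedIffTrue φ) :
    RealisedIffTrue (.allIn x y φ) :=
  allBdd (fun ⟨_, h⟩ => hxy h) (.single x rfl) (mem x y) hφ

theorem isPair (p a b s t w : Var.{u}) (hs : w ≠ s) (ht : w ≠ t) (hp : w ≠ p) :
    RealisedIffTrue (.isPair p a b s t w) :=
  exIn _ _ <| exIn _ _ <| (((mem a s).and (allIn hs (eq w a))).and <|
    ((mem a t).and ((mem b t).and (allIn ht ((eq w a).or (eq w b))))).and <|
    allIn hp ((eq w s).or (eq w t)))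

theorem hasFirst (p a e b s t w : Var.{u}) (hs : w ≠ s) (ht : w ≠ t) (hp : w ≠ p) :
    RealisedIffTrue (.hasFirst p a e b s t w) :=
  exIn _ _ <| exIn _ _ <| isPair _ _ _ _ _ _ hs ht hp

theorem isOrdinal {d k l w : Var.{u}} (hk : k ≠ d) (hl : l ≠ k) (hw : w ≠ l) :
    RealisedIffTrue (.isOrdinal d k l w) :=
  allIn hk <| allIn hl <| (mem l d).and (allIn hw (mem w k))

theorem isFunction {f d p q a e b s t w : Var.{u}} (hp : p ≠ f) (hq : q ≠ f) (ha : a ≠ d)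
    (hs : w ≠ s) (ht : w ≠ t) (hwp : w ≠ p) (hwq : w ≠ q) :
    RealisedIffTrue (.isFunction f d p q a e b s t w) :=
  have h := hasFirst p a e b s t w hs ht hwp
  (allIn hp (exIn a d h)).and <| (allIn ha (exIn p f h)).and <|
    allIn ha <| allIn hp <| allIn hq <| (h.and (hasFirst q a e b s t w hs ht hwq)).imp (eq p q)

theorem appEq (f z x : Var.{u}) {p s t w : Var.{u}} (hs : w ≠ s) (ht : w ≠ t) (hp : w ≠ p) :
    RealisedIffTrue (.appEq f z x p s t w) :=
  exIn _ _ <| isPair _ _ _ _ _ _ hs ht hp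

/-- The bounding formula starts with unbounded existential quantifiers. These are harmless, as `ex`
needs no bound; all of its universal quantifiers are bounded by a single variable. -/
theorem memSeq (x : Context.{u}) (y : Var.{u}) : RealisedIffTrue (.memSeq x y) := by
  set B := Formula.freshBase x y with hB
  have hc : ∀ n : ℕ, B + 2 + n ≠ B := fun n =>
    ((lt_add_of_pos_right B (by norm_num)).trans_le le_self_add).ne'
  have hd : ∀ n : ℕ, B + 2 + n ≠ B + 1 := fun n =>
    (((add_lt_add_iff_left B).2 (by norm_num)).trans_le le_self_add).ne'
  have hcc : ∀ n m : ℕ, n ≠ m → B + 2 + (n : Ordinal.{u}) ≠ B + 2 + m := fun n m h h' =>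
    h (by exact_mod_cast add_left_cancel h')
  refine ex _ <| ex _ <| ex _ <| (and ?_ ?_).and <| (and (conj fun j => ?_) ?_).and (mem _ _)
  · exact isOrdinal (hd 0) (hcc 1 0 (by norm_num)) (hcc 2 1 (by norm_num))
  · exact isFunction (hc 0) (hc 1) (hd 2) (hcc 7 5 (by norm_num)) (hcc 7 6 (by norm_num))
      (hcc 7 0 (by norm_num)) (hcc 7 1 (by norm_num))
  · exact (conj fun i => mem _ _).and <| (mem _ _).and <| appEq _ _ _ (hcc 3 1 (by norm_num))
      (hcc 3 2 (by norm_num)) (hcc 3 0 (by norm_num))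
  · exact allIn (hd 0) (disj fun j => eq _ _)

theorem of_isBound {x : Context.{u}} {y : Var.{u}} {β : Formula.{u}}
    (hβ : Formula.IsBound x y β) : RealisedIffTrue β := by
  cases hβ with
  | single w _ => exact mem w y
  | finite _ => exact conj fun j => mem _ _
  | infinite _ => exact memSeq x y

theorem of_isDeltaZero (hφ : φ.IsDeltaZero) : RealisedIffTrue φ := by
  induction hφ with
  | bot => exact bot
  | mem x y => exact mem x y
  | eq x y => exact eq x y
  | imp _ _ h h' => exact h.imp h'
  | disj _ h => exact disj h
  | conj _ h => exact conj h
  | exBdd _ hβ _ h => exact ex _ ((of_isBound hβ).and h)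
  | allBdd hy hβ _ h => exact allBdd hy hβ (of_isBound hβ) h

end RealisedIffTrue

end

end OTMRealisability

theorem mainTheorem6 (φ : OTMRealisability.Formula.{u}) (hφ : φ.IsSigmaOne)
    (x : OTMRealisability.Context.{u}) (hx : φ.HasContext x)
    (X : Set.Iio x.length → ZFSet.{u}) :
    OTMRealisability.UniformlyRealised φ (OTMRealisability.substitution x X) ↔
      φ.IsTrue (OTMRealisability.substitution x X) := by
  obtain ⟨y, ψ, hψ, rfl⟩ := hφ
  exact (OTMRealisability.RealisedIffTrue.of_isDeltaZero hψ).ex y _
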